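/- Let $p\in\mathbb{R}$ be such that $s_c:=\tfrac32-\tfrac2p$ satisfies $1<s_c<\tfrac32$ (equivalently $p>4$). For a function $f$ on $\mathbb{R}^3$ let $\|f\|_{\dot H^{s}_x}:=\||\nabla|^{s}f\|_{L^2_x(\mathbb{R}^3)}$, where $|\nabla|^s$ is the Fourier multiplier with symbol $|\xi|^s$ (for the convention $\hat f(\xi)=(2\pi)^{-3/2}\int e^{-ix\cdot\xi}f(x)\,dx$). Given an interval $I\subset\mathbb{R}$, a function $u:I\times\mathbb{R}^3\to\mathbb{C}$ is called a solution of the defocusing nonlinear Schrödinger equation $(i\partial_t+\Delta)u=|u|^pu$ if $u\in C_t\dot H^{s_c}_x(K\times\mathbb{R}^3)\cap L^{5p/2}_{t,x}(K\times\mathbb{R}^3)$ for every compact $K\subset I$ and, for some $t_0\in I$, the Duhamel formula $$u(t)=e^{i(t-t_0)\Delta}u(t_0)-i\int_{t_0}^t e^{i(t-s)\Delta}\big(|u|^pu\big)(s)\,ds$$ holds for all $t\in I$, as an identity of tempered distributions. Then there is a constant $A$ depending only on $p$ such that for every interval $I$ (of length $|I|$), every solution $u:I\times\mathbb{R}^3\to\mathbb{C}$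 and every $C\ge 1$, $$\int_I\int_{|x|\le C|I|^{1/2}}\frac{|u(t,x)|^{p+2}}{|x|}\,dx\,dt\;\le\; A\,\big(C|I|^{1/2}\big)^{2s_c-1}\Big\{\|u\|_{L^\infty_t\dot H^{s_c}_x(I\times\mathbb{R}^3)}^2+\|u\|_{L^\infty_t\dot H^{s_c}_x(I\times\mathbb{R}^3)}^{p+2}\Big\}.$$ Both sides are read in $[0,\infty]$ with $0\cdot\infty=0$. -/

import Mathlib

open MeasureTheory Filter Topology
open scoped ENNReal NNReal FourierTransform SchwartzMap

/-- Three-dimensional Euclidean space. -/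
abbrev R3 : Type := EuclideanSpace ℝ (Fin 3)

/-- `g` is the Fourier transform of `f` in the sense of tempered distributions (with the kernel
`exp (-2πi x·ξ)`); both `f` and `g` are functions that are integrable against every Schwartz
function. Such a `g` is unique up to null sets. -/
def IsFourierTransform (f g : R3 → ℂ) : Prop :=
  ∀ φ : 𝓢(R3, ℂ),
    Integrable (fun x => f x * 𝓕 φ x) ∧ Integrable (fun ξ => g ξ * φ ξ) ∧
      ∫ x, f x * 𝓕 φ x = ∫ ξ, g ξ * φ ξ

/-- The homogeneous Sobolev norm `‖|∇|^s f‖_{L²}`, computed on the Fourier side. With the kernel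
`exp (-2πi x·ξ)` the operator `|∇|^s` is multiplication by `(2π|ξ|)^s`. The value is `∞` if the
Fourier transform of `f` is not a function. -/
noncomputable def homSobolevNorm (s : ℝ) (f : R3 → ℂ) : ℝ≥0∞ :=
  ⨅ (g : R3 → ℂ) (_ : IsFourierTransform f g),
    eLpNorm (fun ξ => (((2 * Real.pi * ‖ξ‖) ^ s : ℝ) : ℂ) * g ξ) 2 volume

/-- The free Schrödinger evolution `e^{itΔ} φ` of a Schwartz function, i.e. the Fourier multiplier
with symbol `exp (-it |2πξ|²)`. -/
noncomputable def freeEvolution (t : ℝ) (φ : 𝓢(R3, ℂ)) : R3 → ℂ :=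
  𝓕⁻ (fun ξ : R3 => Complex.exp (-Complex.I * ((t * (2 * Real.pi * ‖ξ‖) ^ 2 : ℝ) : ℂ)) * 𝓕 φ ξ)

/-- The defocusing nonlinearity `|z|^p z`. -/
noncomputable def nlsNonlinearity (p : ℝ) (z : ℂ) : ℂ := ((‖z‖ ^ p : ℝ) : ℂ) * z

/-- The critical regularity `3/2 - 2/p` in three dimensions. -/
noncomputable def criticalRegularity (p : ℝ) : ℝ := 3 / 2 - 2 / p

/-- `u` is a (strong) solution of `(i∂ₜ + Δ)u = |u|^p u` on the time interval `I`. Only the values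
`u t` with `t ∈ I` matter. -/
structure IsNLSSolution (p : ℝ) (I : Set ℝ) (u : ℝ → R3 → ℂ) : Prop where
  /-- `u t` lies in the critical homogeneous Sobolev space for every time in `I`. -/
  mem_sobolev : ∀ t ∈ I, homSobolevNorm (criticalRegularity p) (u t) < ∞
  /-- `t ↦ u t` is continuous on `I` in the critical homogeneous Sobolev norm. -/
  continuous_sobolev : ∀ t₁ ∈ I,
    Tendsto (fun t => homSobolevNorm (criticalRegularity p) (u t - u t₁)) (𝓝[I] t₁) (𝓝 0)
  /-- `u` belongs to `L^{5p/2}` in space-time over every compact set of times in `I`. -/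
  memLp : ∀ K : Set ℝ, IsCompact K → K ⊆ I →
    MemLp (Function.uncurry u) (ENNReal.ofReal (5 * p / 2)) ((volume.restrict K).prod volume)
  /-- The Duhamel formula
  `u(t) = e^{i(t-t₀)Δ} u(t₀) - i ∫_{t₀}^t e^{i(t-s)Δ} (|u|^p u)(s) ds` for all `t ∈ I`, as an
  identity of tempered distributions. The propagator acts on distributions by duality,
  `⟨e^{itΔ} f, φ⟩ = ⟨f, e^{itΔ} φ⟩` for the bilinear pairing `⟨f, φ⟩ = ∫ f φ`. -/
  duhamel : ∃ t₀ ∈ I, ∀ t ∈ I, ∀ φ : 𝓢(R3, ℂ),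
    ∫ x, u t x * φ x =
      (∫ x, u t₀ x * freeEvolution (t - t₀) φ x) -
        Complex.I * ∫ s in t₀..t, ∫ x, nlsNonlinearity p (u s x) * freeEvolution (t - s) φ x

/-- The norm of `u` in `L^∞_t Ḣ^s_x (I × ℝ³)`. -/
noncomputable def supSobolevNorm (s : ℝ) (I : Set ℝ) (u : ℝ → R3 → ℂ) : ℝ≥0∞ :=
  essSup (fun t => homSobolevNorm s (u t)) (volume.restrict I)

/-! ### Plancherel's theorem -/

/-- Every square-integrable function has a Fourier transform in the sense of distributions. -/
theorem exists_isFourierTransform_of_memLp_two {h : R3 → ℂ} (hh : MemLp h 2 volume) :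
    ∃ g : R3 → ℂ, MemLp g 2 volume ∧ IsFourierTransform h g := by
  set f : Lp ℂ 2 (volume : Measure R3) := hh.toLp h
  refine ⟨(𝓕 f : Lp ℂ 2 (volume : Measure R3)), Lp.memLp _, fun φ => ⟨?_, ?_, ?_⟩⟩
  · exact hh.integrable_mul ((𝓕 φ).memLp 2)
  · exact (Lp.memLp _).integrable_mul (φ.memLp 2)
  · have := congrArg (fun T => T φ) (Lp.fourier_toTemperedDistribution_eq f)
    simp only [TemperedDistribution.fourier_apply, Lp.toTemperedDistribution_apply,
      smul_eq_mul] at this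
    rw [← integral_congr_ae (f := fun x => 𝓕 φ x * f x)]
    · rw [this]; simp_rw [mul_comm]
    · filter_upwards [hh.coeFn_toLp] with x hx
      rw [hx, mul_comm]

theorem integral_fourierInv_mul_eq_integral_mul_fourierInv {f g : R3 → ℂ} (hf : Integrable f)
    (hg : Integrable g) : ∫ x, 𝓕⁻ f x * g x = ∫ x, f x * 𝓕⁻ g x := by
  have hf' : Integrable (fun x => f (-x)) := hf.comp_neg
  have key := VectorFourier.integral_fourierIntegral_smul_eq_flip (L := innerₗ R3)
    (μ := volume) (ν := volume) Real.continuous_fourierChar continuous_inner hf' hg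
  have e1 : ∀ ξ, VectorFourier.fourierIntegral Real.fourierChar volume (innerₗ R3)
      (fun x => f (-x)) ξ = 𝓕⁻ f ξ := by
    intro ξ
    rw [Real.fourierInv_eq_fourier_comp_neg]; rfl
  have e2 : ∀ x, VectorFourier.fourierIntegral Real.fourierChar volume (innerₗ R3).flip g x
      = 𝓕 g x := by
    intro ξ
    rw [flip_innerₗ]; rfl
  simp only [e1, e2, smul_eq_mul] at key
  rw [key, ← integral_neg_eq_self]
  simp [Real.fourierInv_eq_fourier_neg]

/-- Plancherel's inequality for a function in `L¹ ∩ L²`. -/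
theorem eLpNorm_fourierInv_le {G : R3 → ℂ} (hG : Integrable G) (hG2 : MemLp G 2 volume) :
    eLpNorm (𝓕⁻ G) 2 volume ≤ eLpNorm G 2 volume := by
  set f : Lp ℂ 2 (volume : Measure R3) := hG2.toLp G
  have hcont : Continuous (𝓕⁻ G) := by
    rw [Real.fourierInv_eq_fourier_comp_neg]
    exact VectorFourier.fourierIntegral_continuous Real.continuous_fourierChar
      continuous_inner hG.comp_neg
  have hae : ∀ᵐ x, (𝓕⁻ f : Lp ℂ 2 (volume : Measure R3)) x = 𝓕⁻ G x := by
    apply ae_eq_of_integral_contDiff_smul_eq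
    · exact (Lp.memLp _).locallyIntegrable (by norm_num)
    · exact hcont.locallyIntegrable
    intro θ hθ hθc
    have hθc' : HasCompactSupport (fun x => (θ x : ℂ)) :=
      hθc.comp_left (g := fun r : ℝ => (r : ℂ)) (by simp)
    have hθ' : ContDiff ℝ ((⊤ : ℕ∞) : WithTop ℕ∞) (fun x => (θ x : ℂ)) := Complex.ofRealCLM.contDiff.comp hθ
    set φ : 𝓢(R3, ℂ) := hθc'.toSchwartzMap hθ'
    have hφ : ∀ x, φ x = (θ x : ℂ) := fun x => rfl
    have h1 := congrArg (fun T => T φ) (Lp.fourierInv_toTemperedDistribution_eq f)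
    simp only [TemperedDistribution.fourierInv_apply, Lp.toTemperedDistribution_apply,
      smul_eq_mul, hφ] at h1
    simp only [Complex.real_smul]
    rw [← h1]
    have h2 := integral_fourierInv_mul_eq_integral_mul_fourierInv hG φ.integrable
    simp only [hφ] at h2
    rw [show (∫ x, (θ x : ℂ) * 𝓕⁻ G x) = ∫ x, 𝓕⁻ G x * (θ x : ℂ) by simp_rw [mul_comm], h2]
    apply integral_congr_ae
    filter_upwards [hG2.coeFn_toLp] with x hx
    rw [hx, mul_comm, SchwartzMap.fourierInv_coe]
  rw [← eLpNorm_congr_ae hae, ← eLpNorm_congr_ae hG2.coeFn_toLp]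
  have := (Lp.fourierTransformₗᵢ R3 ℂ).symm.norm_map f
  have h3 : ‖(𝓕⁻ f : Lp ℂ 2 (volume : Measure R3))‖ = ‖f‖ := this
  rw [Lp.norm_def, Lp.norm_def] at h3
  exact le_of_eq ((ENNReal.toReal_eq_toReal_iff' (Lp.eLpNorm_ne_top _) (Lp.eLpNorm_ne_top _)).1 h3)

/-! ### The homogeneous Sobolev inequality -/

theorem lintegral_comp_smul_R3 (f : R3 → ℝ≥0∞) (hf : Measurable f) {A : ℝ} (hA : 0 < A) :
    ∫⁻ x, f x = ENNReal.ofReal (A ^ 3) * ∫⁻ y, f (A • y) := by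
  have h := Measure.map_addHaar_smul (volume : Measure R3) hA.ne'
  have h2 : ∫⁻ y, f (A • y) = ∫⁻ x, f x ∂(Measure.map (A • ·) (volume : Measure R3)) :=
    (lintegral_map hf (measurable_const_smul A)).symm
  rw [h2, h, lintegral_smul_measure, smul_eq_mul, ← mul_assoc, ← ENNReal.ofReal_mul (by positivity)]
  have : Module.finrank ℝ R3 = 3 := by simp
  rw [this, abs_of_pos (by positivity), mul_inv_cancel₀ (by positivity)]
  simp

theorem exists_lintegral_ball_rpow_le {σ : ℝ} (hσ : σ < 3 / 2) :
    ∃ c : ℝ≥0, 0 < c ∧ ∀ A : ℝ, 0 < A →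
      ∫⁻ ξ in {ξ : R3 | ‖ξ‖ < A}, ENNReal.ofReal (‖ξ‖ ^ (-(2 * σ))) ≤
        c * ENNReal.ofReal (A ^ (3 - 2 * σ)) := by
  set I₁ := ∫⁻ ξ in {ξ : R3 | ‖ξ‖ < 1}, ENNReal.ofReal (‖ξ‖ ^ (-(2 * σ)))
  have hfin : I₁ < ∞ := by
    have hm : Measurable fun ξ : R3 => ‖ξ‖ ^ (-(2 * σ)) := by fun_prop
    have h := locallyIntegrable_of_norm_le_rpow (E := R3) (μ := volume) (by simp)
      (f := fun ξ : R3 => ‖ξ‖ ^ (-(2 * σ))) (C := 1) (α := 2 * σ) (by simp; linarith)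
      (ae_of_all _ fun x => by
        rw [Real.norm_of_nonneg (by positivity), one_mul]) hm.aestronglyMeasurable
    have h2 := (h.integrableOn_isCompact (isCompact_closedBall (0 : R3) 1)).lintegral_lt_top
    refine lt_of_le_of_lt (lintegral_mono_set fun x hx => ?_) h2
    simpa using (le_of_lt hx : ‖x‖ ≤ 1)
  refine ⟨I₁.toNNReal + 1, by positivity, fun A hA => ?_⟩
  have hset : ∀ A : ℝ, MeasurableSet {ξ : R3 | ‖ξ‖ < A} := fun A =>
    measurableSet_lt measurable_norm measurable_const
  rw [← lintegral_indicator (hset A), lintegral_comp_smul_R3 _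
    (Measurable.indicator (by fun_prop) (hset A)) hA]
  have : ∀ y : R3, Set.indicator {ξ : R3 | ‖ξ‖ < A}
      (fun ξ => ENNReal.ofReal (‖ξ‖ ^ (-(2 * σ)))) (A • y) =
      ENNReal.ofReal (A ^ (-(2 * σ))) * Set.indicator {ξ : R3 | ‖ξ‖ < 1}
      (fun ξ => ENNReal.ofReal (‖ξ‖ ^ (-(2 * σ)))) y := by
    intro y
    have hn : ‖A • y‖ = A * ‖y‖ := by rw [norm_smul, Real.norm_of_nonneg hA.le]
    by_cases hy : ‖y‖ < 1
    · rw [Set.indicator_of_mem, Set.indicator_of_mem (by exact hy), hn,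
        Real.mul_rpow hA.le (norm_nonneg _), ENNReal.ofReal_mul (by positivity)]
      change ‖A • y‖ < A
      rw [hn]; nlinarith
    · rw [Set.indicator_of_notMem, Set.indicator_of_notMem (by exact hy), mul_zero]
      change ¬ ‖A • y‖ < A
      rw [hn]; nlinarith
  simp_rw [this]
  rw [lintegral_const_mul' _ _ ENNReal.ofReal_ne_top, lintegral_indicator (hset 1), ← mul_assoc,
    ← ENNReal.ofReal_mul (by positivity), mul_comm]
  have e : A ^ 3 * A ^ (-(2 * σ)) = A ^ (3 - 2 * σ) := by
    rw [← Real.rpow_natCast, ← Real.rpow_add hA]; congr 1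
  rw [e]
  gcongr
  change I₁ ≤ _
  push_cast
  rw [ENNReal.coe_toNNReal hfin.ne]
  exact le_self_add

theorem norm_fourierInv_le_integral_norm (f : R3 → ℂ) (x : R3) : ‖𝓕⁻ f x‖ ≤ ∫ v, ‖f v‖ := by
  rw [Real.fourierInv_eq]
  refine (norm_integral_le_integral_norm _).trans (le_of_eq ?_)
  congr 1 with v
  exact Circle.norm_smul _ _

theorem fourierInv_add_apply {f g : R3 → ℂ} (hf : Integrable f) (hg : Integrable g) (x : R3) :
    𝓕⁻ (f + g) x = 𝓕⁻ f x + 𝓕⁻ g x := by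
  have h : ∀ {f : R3 → ℂ}, Integrable f →
      Integrable fun v => Real.fourierChar (inner ℝ v x) • f v := by
    intro f hf
    have := (Real.fourierIntegral_convergent_iff (μ := volume) (f := f) (-x)).2 hf
    simpa using this
  simp only [Real.fourierInv_eq, Pi.add_apply, smul_add]
  exact integral_add (h hf) (h hg)

/-- The homogeneous Sobolev inequality in dimension three, for the inverse Fourier transform of an
integrable function. -/
theorem exists_sobolev {σ : ℝ} (hσ₀ : 0 < σ) (hσ : σ < 3 / 2) {q : ℝ} (hq : q = 6 / (3 - 2 * σ)) :
    ∃ C : ℝ≥0, ∀ G : R3 → ℂ, Integrable G →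
      ∫⁻ x, ‖𝓕⁻ G x‖ₑ ^ q ≤
        C * (∫⁻ ξ, ENNReal.ofReal (‖ξ‖ ^ (2 * σ)) * ‖G ξ‖ₑ ^ 2) ^ (q / 2) := by
  obtain ⟨c, hc, hlow⟩ := exists_lintegral_ball_rpow_le hσ
  have hσ3 : 0 < 3 - 2 * σ := by linarith
  have hq2 : 2 < q := by
    rw [hq, lt_div_iff₀ hσ3]; linarith
  set a : ℝ := 3 / 2 - σ with ha
  have ha0 : 0 < a := by simp only [ha]; linarith
  have haq : a * (q - 2) = 2 * σ := by
    rw [hq, ha]; field_simp; ring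
  set c0 : ℝ := Real.sqrt c with hc0
  have hc0pos : 0 < c0 := Real.sqrt_pos.2 (by exact_mod_cast hc)
  set Cst : ℝ := q * (4 * ((2 * c0) ^ (q - 2) / (q - 2))) with hCst
  have hCst0 : 0 < Cst := by
    have : 0 < q - 2 := by linarith
    positivity
  refine ⟨Cst.toNNReal, fun G hG => ?_⟩
  set N2 := ∫⁻ ξ, ENNReal.ofReal (‖ξ‖ ^ (2 * σ)) * ‖G ξ‖ₑ ^ 2 with hN2
  have hGm : AEMeasurable (fun ξ => ‖G ξ‖ₑ ^ 2) volume := hG.1.enorm.pow_const 2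
  have hwm : Measurable fun ξ : R3 => ENNReal.ofReal (‖ξ‖ ^ (2 * σ)) := by fun_prop
  rcases eq_or_ne N2 0 with h0 | h0
  · have : G =ᵐ[volume] 0 := by
      replace h0 := (lintegral_eq_zero_iff' (hwm.aemeasurable.mul hGm)).1 h0
      have hne : ∀ᵐ ξ : R3, ξ ≠ 0 := Measure.ae_ne volume 0
      filter_upwards [h0, hne] with ξ h1 h2
      have h3 : 0 < ‖ξ‖ ^ (2 * σ) := Real.rpow_pos_of_pos (norm_pos_iff.2 h2) _
      simpa [h3.not_ge] using h1
    have hz : ∀ x, 𝓕⁻ G x = 0 := by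
      intro x
      rw [Real.fourierInv_eq, integral_congr_ae (g := fun _ => 0)]
      · simp
      · filter_upwards [this] with v hv
        simp [hv]
    simp [hz, show 0 < q by linarith]
  rcases eq_or_ne N2 ∞ with htop | htop
  · rw [htop, ENNReal.top_rpow_of_pos (by linarith), ENNReal.mul_top]
    · exact le_top
    · simpa using hCst0
  set N : ℝ := Real.sqrt N2.toReal with hN
  have hN2pos : 0 < N2.toReal := ENNReal.toReal_pos h0 htop
  have hNpos : 0 < N := Real.sqrt_pos.2 hN2pos
  have hNsq : N ^ 2 = N2.toReal := Real.sq_sqrt hN2pos.le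
  set K : ℝ := 2 * c0 * N with hK
  have hKpos : 0 < K := by positivity
  have hcont : Continuous (𝓕⁻ G) := by
    rw [Real.fourierInv_eq_fourier_comp_neg]
    exact VectorFourier.fourierIntegral_continuous Real.continuous_fourierChar
      continuous_inner hG.comp_neg
  let H : ℝ → Set R3 := fun l => {ξ | l ≤ K * ‖ξ‖ ^ a}
  have hHm : ∀ l, MeasurableSet (H l) := fun l =>
    measurableSet_le measurable_const (by fun_prop)
  -- low frequencies
  have hlowl : ∀ l : ℝ, 0 < l → ∫⁻ ξ in (H l)ᶜ, ‖G ξ‖ₑ ≤ ENNReal.ofReal (l / 2) := by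
    intro l hl
    set A : ℝ := (l / K) ^ a⁻¹ with hA
    have hApos : 0 < A := by positivity
    have hsub : (H l)ᶜ ⊆ {ξ : R3 | ‖ξ‖ < A} := by
      intro ξ hξ
      simp only [H, Set.mem_compl_iff, Set.mem_ofPred_eq, not_le] at hξ ⊢
      rw [hA, Real.lt_rpow_inv_iff_of_pos (norm_nonneg _) (by positivity) ha0, lt_div_iff₀ hKpos]
      linarith
    have hAa : A ^ (3 - 2 * σ) = (l / K) ^ 2 := by
      rw [hA, ← Real.rpow_mul (by positivity), ← Real.rpow_natCast]
      congr 1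
      rw [ha]; field_simp; norm_num
    have hsplit : ∀ ξ : R3, ξ ≠ 0 → ‖G ξ‖ₑ =
        ENNReal.ofReal (‖ξ‖ ^ (-σ)) * (ENNReal.ofReal (‖ξ‖ ^ σ) * ‖G ξ‖ₑ) := by
      intro ξ hξ
      rw [← mul_assoc, ← ENNReal.ofReal_mul (by positivity), ← Real.rpow_add (norm_pos_iff.2 hξ)]
      simp
    calc ∫⁻ ξ in (H l)ᶜ, ‖G ξ‖ₑ
        ≤ ∫⁻ ξ in {ξ : R3 | ‖ξ‖ < A}, ‖G ξ‖ₑ := lintegral_mono_set hsub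
      _ = ∫⁻ ξ in {ξ : R3 | ‖ξ‖ < A},
            (ENNReal.ofReal (‖ξ‖ ^ (-σ)) * (ENNReal.ofReal (‖ξ‖ ^ σ) * ‖G ξ‖ₑ)) := by
          apply lintegral_congr_ae
          filter_upwards [ae_restrict_of_ae (Measure.ae_ne volume (0 : R3))] with ξ hξ
          exact hsplit ξ hξ
      _ ≤ (∫⁻ ξ in {ξ : R3 | ‖ξ‖ < A}, ENNReal.ofReal (‖ξ‖ ^ (-σ)) ^ (2 : ℝ)) ^ (1 / 2 : ℝ) *
          (∫⁻ ξ in {ξ : R3 | ‖ξ‖ < A}, (ENNReal.ofReal (‖ξ‖ ^ σ) * ‖G ξ‖ₑ) ^ (2 : ℝ))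
            ^ (1 / 2 : ℝ) := by
          apply ENNReal.lintegral_mul_le_Lp_mul_Lq _ Real.HolderConjugate.two_two
          · exact (by fun_prop : Measurable fun ξ : R3 => ENNReal.ofReal (‖ξ‖ ^ (-σ))).aemeasurable
          · exact ((by fun_prop : Measurable fun ξ : R3 =>
              ENNReal.ofReal (‖ξ‖ ^ σ)).aemeasurable.mul hG.1.enorm).restrict
      _ ≤ (c * ENNReal.ofReal ((l / K) ^ 2)) ^ (1 / 2 : ℝ) * N2 ^ (1 / 2 : ℝ) := by
          gcongr
          · rw [← hAa]
            refine le_trans (le_of_eq ?_) (hlow A hApos)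
            congr 1 with ξ
            rw [ENNReal.ofReal_rpow_of_nonneg (by positivity) (by norm_num),
              ← Real.rpow_mul (norm_nonneg _)]
            congr 2; ring
          · refine le_trans (setLIntegral_le_lintegral _ _) (le_of_eq ?_)
            rw [hN2]
            congr 1 with ξ
            rw [ENNReal.mul_rpow_of_nonneg _ _ (by norm_num),
              ENNReal.ofReal_rpow_of_nonneg (by positivity) (by norm_num),
              ← Real.rpow_mul (norm_nonneg _), mul_comm σ 2]
            norm_num
      _ = ENNReal.ofReal (l / 2) := by
          have e1 : (c : ℝ≥0∞) = ENNReal.ofReal (c0 ^ 2) := by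
            rw [hc0, Real.sq_sqrt c.coe_nonneg]; simp
          have e2 : N2 = ENNReal.ofReal (N ^ 2) := by
            rw [hNsq, ENNReal.ofReal_toReal htop]
          rw [e1, e2, ← ENNReal.ofReal_mul (by positivity), ← mul_pow,
            ENNReal.ofReal_rpow_of_nonneg (by positivity) (by norm_num),
            ENNReal.ofReal_rpow_of_nonneg (by positivity) (by norm_num),
            ← ENNReal.ofReal_mul (by positivity), ← Real.sqrt_eq_rpow, ← Real.sqrt_eq_rpow,
            Real.sqrt_sq (by positivity), Real.sqrt_sq hNpos.le]
          congr 1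
          rw [hK]; field_simp
  -- distribution function
  have hdist : ∀ l : ℝ, 0 < l → volume {x | l < ‖𝓕⁻ G x‖} ≤
      ENNReal.ofReal (4 * l ^ (-2 : ℝ)) * ∫⁻ ξ in H l, ‖G ξ‖ₑ ^ 2 := by
    intro l hl
    have hGh2 : ∫⁻ ξ in H l, ‖G ξ‖ₑ ^ 2 < ∞ := by
      set B : ℝ := (l / K) ^ a⁻¹ with hB
      have hBpos : 0 < B := by positivity
      have hle : ∫⁻ ξ in H l, ‖G ξ‖ₑ ^ 2 ≤ ∫⁻ ξ in H l,
          ENNReal.ofReal (B ^ (-(2 * σ))) * (ENNReal.ofReal (‖ξ‖ ^ (2 * σ)) * ‖G ξ‖ₑ ^ 2) := by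
        apply setLIntegral_mono' (hHm l)
        intro ξ hξ
        have hBξ : B ≤ ‖ξ‖ := by
          rw [hB, Real.rpow_inv_le_iff_of_pos (by positivity) (norm_nonneg _) ha0, div_le_iff₀ hKpos]
          have : l ≤ K * ‖ξ‖ ^ a := hξ
          linarith
        rw [← mul_assoc, ← ENNReal.ofReal_mul (by positivity)]
        apply le_mul_of_one_le_left (by simp)
        rw [ENNReal.one_le_ofReal, Real.rpow_neg hBpos.le, inv_mul_eq_div,
          one_le_div (by positivity)]
        exact Real.rpow_le_rpow hBpos.le hBξ (by linarith)
      refine lt_of_le_of_lt hle ?_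
      rw [lintegral_const_mul' _ _ ENNReal.ofReal_ne_top]
      exact ENNReal.mul_lt_top ENNReal.ofReal_lt_top
        (lt_of_le_of_lt (setLIntegral_le_lintegral _ _) (lt_top_iff_ne_top.2 htop))
    set G1 := (H l)ᶜ.indicator G with hG1
    set G2 := (H l).indicator G with hG2
    have hG1i : Integrable G1 := hG.indicator (hHm l).compl
    have hG2i : Integrable G2 := hG.indicator (hHm l)
    have hsum : G = G1 + G2 := by
      rw [hG1, hG2, Set.indicator_compl_add_self]
    have hlow1 : ∀ x, ‖𝓕⁻ G1 x‖ ≤ l / 2 := by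
      intro x
      refine (norm_fourierInv_le_integral_norm G1 x).trans ?_
      rw [integral_norm_eq_lintegral_enorm hG1i.1]
      apply ENNReal.toReal_le_of_le_ofReal (by positivity)
      refine le_trans (le_of_eq ?_) (hlowl l hl)
      rw [← lintegral_indicator (hHm l).compl]
      congr 1 with ξ
      rw [hG1, enorm_indicator_eq_indicator_enorm]
    have hG2L2 : eLpNorm G2 2 volume ^ 2 = ∫⁻ ξ in H l, ‖G ξ‖ₑ ^ 2 := by
      rw [eLpNorm_indicator_eq_eLpNorm_restrict (hHm l)]
      have := eLpNorm_nnreal_pow_eq_lintegral (f := G) (p := 2) (μ := volume.restrict (H l))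
        (by norm_num)
      simpa using this
    have hG2mem : MemLp G2 2 volume := by
      refine ⟨hG2i.1, ?_⟩
      by_contra hcon
      rw [not_lt, top_le_iff] at hcon
      rw [hcon] at hG2L2
      simp at hG2L2
      exact hGh2.ne hG2L2.symm
    have hsubset : {x | l < ‖𝓕⁻ G x‖} ⊆ {x | ENNReal.ofReal (l / 2) ≤ ‖𝓕⁻ G2 x‖ₑ} := by
      intro x hx
      have h1 : ‖𝓕⁻ G x‖ ≤ ‖𝓕⁻ G1 x‖ + ‖𝓕⁻ G2 x‖ := by
        conv_lhs => rw [hsum, fourierInv_add_apply hG1i hG2i]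
        exact norm_add_le _ _
      have h2 := hlow1 x
      simp only [Set.mem_ofPred_eq] at hx ⊢
      rw [← ofReal_norm]
      apply ENNReal.ofReal_le_ofReal
      linarith
    have hcont2 : Continuous (𝓕⁻ G2) := by
      rw [Real.fourierInv_eq_fourier_comp_neg]
      exact VectorFourier.fourierIntegral_continuous Real.continuous_fourierChar
        continuous_inner hG2i.comp_neg
    have hcheb := mul_meas_ge_le_pow_eLpNorm' volume (p := 2) (by norm_num) (by norm_num)
      hcont2.aestronglyMeasurable (ENNReal.ofReal (l / 2))
    have hpl := eLpNorm_fourierInv_le hG2i hG2mem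
    have hmain : ENNReal.ofReal (l / 2) ^ (2 : ℝ) * volume {x | l < ‖𝓕⁻ G x‖} ≤
        ∫⁻ ξ in H l, ‖G ξ‖ₑ ^ 2 := by
      rw [← hG2L2]
      calc _ ≤ ENNReal.ofReal (l / 2) ^ (2 : ℝ) *
            volume {x | ENNReal.ofReal (l / 2) ≤ ‖𝓕⁻ G2 x‖ₑ} := by gcongr
        _ ≤ eLpNorm (𝓕⁻ G2) 2 volume ^ (2 : ℝ) := by simpa using hcheb
        _ ≤ eLpNorm G2 2 volume ^ (2 : ℝ) := by gcongr
        _ = _ := by norm_num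
    calc volume {x | l < ‖𝓕⁻ G x‖}
        = ENNReal.ofReal (4 * l ^ (-2 : ℝ)) * (ENNReal.ofReal (l / 2) ^ (2 : ℝ) *
            volume {x | l < ‖𝓕⁻ G x‖}) := by
          rw [ENNReal.ofReal_rpow_of_nonneg (by positivity) (by norm_num), ← mul_assoc,
            ← ENNReal.ofReal_mul (by positivity)]
          have : 4 * l ^ (-2 : ℝ) * (l / 2) ^ (2 : ℝ) = 1 := by
            rw [Real.rpow_neg hl.le]
            norm_num
            field_simp
            norm_num
          rw [this]; simp
      _ ≤ _ := by gcongr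
  -- layer cake
  have hcake := lintegral_rpow_eq_lintegral_meas_lt_mul (volume : Measure R3)
    (f := fun x => ‖𝓕⁻ G x‖) (ae_of_all _ fun x => norm_nonneg _)
    hcont.norm.measurable.aemeasurable (p := q) (by linarith)
  have hinner : ∀ ξ : R3, ∫⁻ l in Set.Ioi (0 : ℝ),
      ENNReal.ofReal (4 * l ^ (q - 3)) * (H l).indicator (fun _ => (1 : ℝ≥0∞)) ξ ≤
      ENNReal.ofReal (4 * ((2 * c0) ^ (q - 2) / (q - 2)) * N ^ (q - 2) * ‖ξ‖ ^ (2 * σ)) := by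
    intro ξ
    set L : ℝ := K * ‖ξ‖ ^ a with hL
    have hL0 : 0 ≤ L := by positivity
    have hval : ∫⁻ l in Set.Ioc (0 : ℝ) L, ENNReal.ofReal (4 * l ^ (q - 3)) =
        ENNReal.ofReal (4 * (L ^ (q - 2) / (q - 2))) := by
      have hint : IntervalIntegrable (fun l : ℝ => 4 * l ^ (q - 3)) volume 0 L :=
        (intervalIntegral.intervalIntegrable_rpow' (by linarith)).const_mul 4
      rw [← ofReal_integral_eq_lintegral_ofReal
        ((intervalIntegrable_iff_integrableOn_Ioc_of_le hL0).1 hint)]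
      · rw [← intervalIntegral.integral_of_le hL0, intervalIntegral.integral_const_mul,
          integral_rpow (Or.inl (by linarith))]
        rw [show q - 3 + 1 = q - 2 by ring, Real.zero_rpow (by linarith), sub_zero]
      · filter_upwards [ae_restrict_mem measurableSet_Ioc] with l hl
        have := hl.1
        positivity
    have hLq : 4 * (L ^ (q - 2) / (q - 2)) =
        4 * ((2 * c0) ^ (q - 2) / (q - 2)) * N ^ (q - 2) * ‖ξ‖ ^ (2 * σ) := by
      rw [hL, hK, Real.mul_rpow (by positivity) (by positivity),
        Real.mul_rpow (by positivity) (by positivity), ← Real.rpow_mul (norm_nonneg _), haq]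
      ring
    rw [← hLq, ← hval, ← lintegral_indicator measurableSet_Ioi,
      ← lintegral_indicator measurableSet_Ioc]
    apply lintegral_mono
    intro l
    by_cases h1 : 0 < l
    · rw [Set.indicator_of_mem (by exact h1)]
      by_cases h2 : l ≤ L
      · rw [Set.indicator_of_mem (by exact h2), Set.indicator_of_mem (by exact ⟨h1, h2⟩), mul_one]
      · rw [Set.indicator_of_notMem (by exact h2)]; simp
    · rw [Set.indicator_of_notMem (by exact h1)]; simp
  have hjm : Measurable fun z : ℝ × R3 => (H z.1).indicator (fun _ => (1 : ℝ≥0∞)) z.2 := by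
    have : MeasurableSet {z : ℝ × R3 | z.1 ≤ K * ‖z.2‖ ^ a} :=
      measurableSet_le measurable_fst (by fun_prop)
    exact measurable_const.indicator this
  calc ∫⁻ x, ‖𝓕⁻ G x‖ₑ ^ q = ∫⁻ x, ENNReal.ofReal (‖𝓕⁻ G x‖ ^ q) := by
        congr 1 with x
        rw [← ofReal_norm, ENNReal.ofReal_rpow_of_nonneg (norm_nonneg _) (by linarith)]
    _ = ENNReal.ofReal q * ∫⁻ t in Set.Ioi 0, volume {x | t < ‖𝓕⁻ G x‖} *
          ENNReal.ofReal (t ^ (q - 1)) := hcake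
    _ ≤ ENNReal.ofReal q * ∫⁻ t in Set.Ioi (0 : ℝ), ∫⁻ ξ, ‖G ξ‖ₑ ^ 2 *
          (ENNReal.ofReal (4 * t ^ (q - 3)) * (H t).indicator (fun _ => (1 : ℝ≥0∞)) ξ) := by
        gcongr ENNReal.ofReal q * ?_
        apply setLIntegral_mono' measurableSet_Ioi
        intro t ht
        have ht : 0 < t := ht
        have e : ∀ ξ, ‖G ξ‖ₑ ^ 2 * (ENNReal.ofReal (4 * t ^ (q - 3)) *
            (H t).indicator (fun _ => (1 : ℝ≥0∞)) ξ) =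
            ENNReal.ofReal (4 * t ^ (q - 3)) * (H t).indicator (fun ξ => ‖G ξ‖ₑ ^ 2) ξ := by
          intro ξ
          by_cases h : ξ ∈ H t
          · simp [h, mul_comm]
          · simp [h]
        simp_rw [e]
        rw [lintegral_const_mul' _ _ ENNReal.ofReal_ne_top, lintegral_indicator (hHm t)]
        calc _ ≤ (ENNReal.ofReal (4 * t ^ (-2 : ℝ)) * ∫⁻ ξ in H t, ‖G ξ‖ₑ ^ 2) *
              ENNReal.ofReal (t ^ (q - 1)) := by gcongr; exact hdist t ht
          _ = _ := by
            rw [mul_right_comm, ← ENNReal.ofReal_mul (by positivity), mul_assoc,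
              ← Real.rpow_add ht]
            congr 4; ring
    _ = ENNReal.ofReal q * ∫⁻ ξ, ‖G ξ‖ₑ ^ 2 * ∫⁻ t in Set.Ioi (0 : ℝ),
          (ENNReal.ofReal (4 * t ^ (q - 3)) * (H t).indicator (fun _ => (1 : ℝ≥0∞)) ξ) := by
        congr 1
        rw [lintegral_lintegral_swap]
        · congr 1 with ξ
          rw [lintegral_const_mul' _ _ (by simp)]
        · apply AEMeasurable.mul
          · exact hGm.comp_snd
          · exact ((by fun_prop : Measurable fun z : ℝ × R3 =>
              ENNReal.ofReal (4 * z.1 ^ (q - 3))).mul hjm).aemeasurable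
    _ ≤ ENNReal.ofReal q * ∫⁻ ξ, ENNReal.ofReal (4 * ((2 * c0) ^ (q - 2) / (q - 2)) * N ^ (q - 2)) *
          (ENNReal.ofReal (‖ξ‖ ^ (2 * σ)) * ‖G ξ‖ₑ ^ 2) := by
        gcongr ENNReal.ofReal q * ?_
        apply lintegral_mono
        intro ξ
        have : 0 < q - 2 := by linarith
        refine (mul_le_mul' le_rfl (hinner ξ)).trans (le_of_eq ?_)
        rw [ENNReal.ofReal_mul (by positivity)]; ring
    _ = _ := by
        have hq2' : 0 < q - 2 := by linarith
        rw [lintegral_const_mul' _ _ ENNReal.ofReal_ne_top, ← hN2, ← mul_assoc,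
          ← ENNReal.ofReal_mul (by linarith)]
        have e2 : N2 = ENNReal.ofReal (N ^ 2) := by
          rw [hNsq, ENNReal.ofReal_toReal htop]
        rw [e2, ENNReal.ofReal_rpow_of_nonneg (by positivity) (by linarith),
          ← ENNReal.ofReal_mul (by positivity)]
        change _ = ENNReal.ofReal Cst * _
        rw [← ENNReal.ofReal_mul hCst0.le]
        congr 1
        have e3 : (N ^ 2) ^ (q / 2) = N ^ (q - 2) * N ^ 2 := by
          rw [← Real.rpow_natCast, ← Real.rpow_mul hNpos.le, ← Real.rpow_add hNpos]
          congr 1; push_cast; ring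
        rw [e3, hCst]; ring

/-! ### Iterated integrals over a triangle and the product rule -/

theorem integrable_indicator_triangle {H : ℝ → ℝ → ℂ} {a b : ℝ}
    (hH : Integrable (Function.uncurry H)
      ((volume.restrict (Set.Ioc a b)).prod (volume.restrict (Set.Ioc a b)))) :
    Integrable (Function.uncurry fun s τ => if s < τ then H s τ else 0)
      ((volume.restrict (Set.Ioc a b)).prod (volume.restrict (Set.Ioc a b))) := by
  have hT : MeasurableSet {z : ℝ × ℝ | z.1 < z.2} := measurableSet_lt measurable_fst measurable_snd
  refine (hH.indicator hT).congr (ae_of_all _ fun z => ?_)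
  by_cases h : z.1 < z.2
  · rw [Set.indicator_of_mem (by exact h)]; simp [Function.uncurry, h]
  · rw [Set.indicator_of_notMem (by exact h)]; simp [Function.uncurry, h]

theorem setIntegral_indicator_triangle_right (H : ℝ → ℝ → ℂ) {a b s : ℝ}
    (hs : s ∈ Set.Ioc a b) :
    ∫ τ in Set.Ioc a b, (if s < τ then H s τ else 0) = ∫ τ in s..b, H s τ := by
  rw [intervalIntegral.integral_of_le hs.2]
  have : (fun τ => if s < τ then H s τ else 0) = (Set.Ioi s).indicator (fun τ => H s τ) := by
    ext τ; simp [Set.indicator_apply]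
  rw [this, setIntegral_indicator measurableSet_Ioi]
  congr 2
  ext τ
  simp only [Set.mem_inter_iff, Set.mem_Ioc, Set.mem_Ioi]
  constructor
  · rintro ⟨⟨_, h⟩, h'⟩; exact ⟨h', h⟩
  · rintro ⟨h, h'⟩; exact ⟨⟨hs.1.trans h, h'⟩, h⟩

theorem setIntegral_indicator_triangle_left (H : ℝ → ℝ → ℂ) {a b τ : ℝ}
    (hτ : τ ∈ Set.Ioc a b) :
    ∫ s in Set.Ioc a b, (if s < τ then H s τ else 0) = ∫ s in a..τ, H s τ := by
  rw [intervalIntegral.integral_of_le hτ.1.le, integral_Ioc_eq_integral_Ioo (y := τ)]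
  have : (fun s => if s < τ then H s τ else 0) = (Set.Iio τ).indicator (fun s => H s τ) := by
    ext s; simp [Set.indicator_apply]
  rw [this, setIntegral_indicator measurableSet_Iio]
  congr 2
  ext s
  simp only [Set.mem_inter_iff, Set.mem_Ioc, Set.mem_Iio, Set.mem_Ioo]
  constructor
  · rintro ⟨⟨h, _⟩, h'⟩; exact ⟨h, h'⟩
  · rintro ⟨h, h'⟩; exact ⟨⟨h, (h'.trans_le hτ.2).le⟩, h'⟩

theorem integral_triangle_swap {H : ℝ → ℝ → ℂ} {a b : ℝ} (hab : a ≤ b)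
    (hH : Integrable (Function.uncurry H)
      ((volume.restrict (Set.Ioc a b)).prod (volume.restrict (Set.Ioc a b)))) :
    ∫ s in a..b, ∫ τ in s..b, H s τ = ∫ τ in a..b, ∫ s in a..τ, H s τ := by
  have h := integral_integral_swap (integrable_indicator_triangle hH)
  rw [intervalIntegral.integral_of_le hab, intervalIntegral.integral_of_le hab]
  rw [setIntegral_congr_fun measurableSet_Ioc
      (fun s hs => (setIntegral_indicator_triangle_right H hs).symm),
    setIntegral_congr_fun measurableSet_Ioc
      (fun τ hτ => (setIntegral_indicator_triangle_left H hτ).symm)]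
  exact h

theorem intervalIntegrable_triangle_left {H : ℝ → ℝ → ℂ} {a b : ℝ} (hab : a ≤ b)
    (hH : Integrable (Function.uncurry H)
      ((volume.restrict (Set.Ioc a b)).prod (volume.restrict (Set.Ioc a b)))) :
    IntervalIntegrable (fun τ => ∫ s in a..τ, H s τ) volume a b := by
  rw [intervalIntegrable_iff_integrableOn_Ioc_of_le hab]
  refine (integrable_indicator_triangle hH).integral_prod_right.congr ?_
  filter_upwards [ae_restrict_mem measurableSet_Ioc] with τ hτ
  exact setIntegral_indicator_triangle_left H hτ

theorem intervalIntegrable_triangle_right {H : ℝ → ℝ → ℂ} {a b : ℝ} (hab : a ≤ b)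
    (hH : Integrable (Function.uncurry H)
      ((volume.restrict (Set.Ioc a b)).prod (volume.restrict (Set.Ioc a b)))) :
    IntervalIntegrable (fun s => ∫ τ in s..b, H s τ) volume a b := by
  rw [intervalIntegrable_iff_integrableOn_Ioc_of_le hab]
  refine (integrable_indicator_triangle hH).integral_prod_left.congr ?_
  filter_upwards [ae_restrict_mem measurableSet_Ioc] with τ hτ
  exact setIntegral_indicator_triangle_right H hτ

/-- The product rule for primitives of integrable functions. -/
theorem integral_product_rule {α β α' β' : ℝ → ℂ} {a b : ℝ} (hab : a ≤ b)
    (hα' : IntervalIntegrable α' volume a b) (hβ' : IntervalIntegrable β' volume a b)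
    (hα : ∀ t ∈ Set.Icc a b, α t = α a + ∫ s in a..t, α' s)
    (hβ : ∀ t ∈ Set.Icc a b, β t = β a + ∫ s in a..t, β' s) :
    ∫ s in a..b, (α' s * β s + α s * β' s) = α b * β b - α a * β a := by
  have hαi := (intervalIntegrable_iff_integrableOn_Ioc_of_le hab).1 hα'
  have hβi := (intervalIntegrable_iff_integrableOn_Ioc_of_le hab).1 hβ'
  have hH : Integrable (Function.uncurry fun s τ => α' s * β' τ)
      ((volume.restrict (Set.Ioc a b)).prod (volume.restrict (Set.Ioc a b))) :=
    Integrable.mul_prod hαi hβi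
  have htri := integral_triangle_swap hab hH
  have hL := intervalIntegrable_triangle_left hab hH
  have hR := intervalIntegrable_triangle_right hab hH
  have hsub : ∀ s ∈ Set.Icc a b, IntervalIntegrable β' volume a s := fun s hs =>
    hβ'.mono_set (by rw [Set.uIcc_of_le hs.1, Set.uIcc_of_le hab]; exact Set.Icc_subset_Icc_right hs.2)
  have hsub' : ∀ s ∈ Set.Icc a b, IntervalIntegrable β' volume s b := fun s hs =>
    hβ'.mono_set (by rw [Set.uIcc_of_le hs.2, Set.uIcc_of_le hab]; exact Set.Icc_subset_Icc_left hs.1)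
  have e : ∫ s in a..b, (α' s * β s + α s * β' s) =
      ∫ s in a..b, (((α' s * β b) - ∫ τ in s..b, α' s * β' τ) +
        ((α a * β' s) + ∫ r in a..s, α' r * β' s)) := by
    apply intervalIntegral.integral_congr
    intro s hs
    rw [Set.uIcc_of_le hab] at hs
    have h1 := hβ s hs
    have h2 := hβ b ⟨hab, le_rfl⟩
    have h3 := intervalIntegral.integral_add_adjacent_intervals (hsub s hs) (hsub' s hs)
    simp only [intervalIntegral.integral_const_mul, intervalIntegral.integral_mul_const]
    rw [hα s hs, h1, h2, ← h3]; ring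
  rw [e, intervalIntegral.integral_add ((hα'.mul_const _).sub hR) ((hβ'.const_mul _).add hL),
    intervalIntegral.integral_sub (hα'.mul_const _) hR,
    intervalIntegral.integral_add (hβ'.const_mul _) hL, htri,
    intervalIntegral.integral_mul_const, intervalIntegral.integral_const_mul,
    hα b ⟨hab, le_rfl⟩, hβ b ⟨hab, le_rfl⟩]
  ring

/-- The oriented version of `integral_triangle_swap`. -/
theorem integral_triangle_swap_of_mem {H : ℝ → ℝ → ℂ} {a b t₀ t : ℝ} (ht₀ : t₀ ∈ Set.Icc a b)
    (ht : t ∈ Set.Icc a b)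
    (hH : Integrable (Function.uncurry H)
      ((volume.restrict (Set.Icc a b)).prod (volume.restrict (Set.Icc a b)))) :
    (∫ s in t₀..t, ∫ τ in s..t, H s τ = ∫ τ in t₀..t, ∫ s in t₀..τ, H s τ) ∧
      IntervalIntegrable (fun s => ∫ τ in s..t, H s τ) volume t₀ t ∧
      IntervalIntegrable (fun τ => ∫ s in t₀..τ, H s τ) volume t₀ t := by
  have hmono : ∀ c d, c ∈ Set.Icc a b → d ∈ Set.Icc a b → Integrable (Function.uncurry H)
      ((volume.restrict (Set.Ioc c d)).prod (volume.restrict (Set.Ioc c d))) := by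
    intro c d hc hd
    have hsub : Set.Ioc c d ⊆ Set.Icc a b := fun x hx => ⟨hc.1.trans hx.1.le, hx.2.trans hd.2⟩
    refine hH.mono_measure ?_
    rw [Measure.prod_restrict, Measure.prod_restrict]
    exact Measure.restrict_mono (Set.prod_mono hsub hsub) le_rfl
  rcases le_total t₀ t with h | h
  · have := hmono t₀ t ht₀ ht
    exact ⟨integral_triangle_swap h this, intervalIntegrable_triangle_right h this,
      intervalIntegrable_triangle_left h this⟩
  · have h1 := hmono t t₀ ht ht₀
    have h2 : Integrable (Function.uncurry fun τ s => H s τ)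
      ((volume.restrict (Set.Ioc t t₀)).prod (volume.restrict (Set.Ioc t t₀))) := h1.swap
    have e := integral_triangle_swap h h2
    have i1 := intervalIntegrable_triangle_left h h2
    have i2 := intervalIntegrable_triangle_right h h2
    refine ⟨?_, ?_, ?_⟩
    · rw [intervalIntegral.integral_symm, intervalIntegral.integral_symm (a := t) (b := t₀)]
      simp_rw [fun s => intervalIntegral.integral_symm (μ := volume) (f := fun τ => H s τ) t s,
        fun τ => intervalIntegral.integral_symm (μ := volume) (f := fun s => H s τ) τ t₀]
      rw [intervalIntegral.integral_neg, intervalIntegral.integral_neg, e]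
    · refine (i1.neg.symm).congr fun s _ => ?_
      simp only [Pi.neg_apply]
      rw [← intervalIntegral.integral_symm]
    · refine (i2.neg.symm).congr fun s _ => ?_
      simp only [Pi.neg_apply]
      rw [← intervalIntegral.integral_symm]

/-! ### The free evolution of Schwartz functions -/

/-- The symbol of the free Schrödinger evolution. -/
noncomputable def schrodingerSymbol (t : ℝ) (ξ : R3) : ℂ :=
  Complex.exp (-Complex.I * ((t * (2 * Real.pi * ‖ξ‖) ^ 2 : ℝ) : ℂ))

theorem norm_schrodingerSymbol (t : ℝ) (ξ : R3) : ‖schrodingerSymbol t ξ‖ = 1 := by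
  rw [schrodingerSymbol, Complex.norm_exp]
  simp [-Complex.ofReal_mul, -Complex.ofReal_pow]

theorem continuous_schrodingerSymbol : Continuous (Function.uncurry schrodingerSymbol) := by
  unfold Function.uncurry schrodingerSymbol
  fun_prop

theorem hasTemperateGrowth_cexp_neg_I_mul :
    Function.HasTemperateGrowth fun y : ℝ => Complex.exp (-Complex.I * (y : ℂ)) := by
  have hd : ∀ n : ℕ, iteratedDeriv n (fun y : ℝ => Complex.exp (-Complex.I * (y : ℂ))) =
      fun y : ℝ => (-Complex.I) ^ n * Complex.exp (-Complex.I * (y : ℂ)) := by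
    intro n
    induction n with
    | zero => simp
    | succ n ih =>
      rw [iteratedDeriv_succ, ih]
      ext y
      have h1 : HasDerivAt (fun y : ℝ => -Complex.I * (y : ℂ)) (-Complex.I * 1) y :=
        (Complex.ofRealCLM.hasDerivAt (x := y)).const_mul (-Complex.I)
      have := (h1.cexp.const_mul ((-Complex.I) ^ n)).deriv
      rw [this]; ring
  refine ⟨(contDiff_const.mul Complex.ofRealCLM.contDiff).cexp, fun n => ⟨0, 1, fun x => ?_⟩⟩
  rw [norm_iteratedFDeriv_eq_norm_iteratedDeriv, hd]
  simp [Complex.norm_exp]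

theorem hasTemperateGrowth_schrodingerSymbol (t : ℝ) :
    Function.HasTemperateGrowth (schrodingerSymbol t) := by
  have h : Function.HasTemperateGrowth fun ξ : R3 => t * (2 * Real.pi * ‖ξ‖) ^ 2 := by
    have : (fun ξ : R3 => t * (2 * Real.pi * ‖ξ‖) ^ 2) =
        fun ξ : R3 => (t * (2 * Real.pi) ^ 2) * ‖ξ‖ ^ 2 := by ext; ring
    rw [this]
    fun_prop
  exact hasTemperateGrowth_cexp_neg_I_mul.comp h

/-- The free Schrödinger evolution as an operator on Schwartz functions. -/
noncomputable def schwartzEvolution (t : ℝ) (φ : 𝓢(R3, ℂ)) : 𝓢(R3, ℂ) :=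
  SchwartzMap.fourierMultiplierCLM ℂ (schrodingerSymbol t) φ

theorem coe_schwartzEvolution (t : ℝ) (φ : 𝓢(R3, ℂ)) :
    (schwartzEvolution t φ : R3 → ℂ) = freeEvolution t φ := by
  rw [schwartzEvolution, SchwartzMap.fourierMultiplierCLM_apply, SchwartzMap.fourierInv_coe,
    SchwartzMap.smulLeftCLM_apply (hasTemperateGrowth_schrodingerSymbol t)]
  rfl

theorem fourierInv_schwartzEvolution (t : ℝ) (φ : 𝓢(R3, ℂ)) (ξ : R3) :
    𝓕⁻ (schwartzEvolution t φ) ξ = schrodingerSymbol t ξ * 𝓕⁻ φ ξ := by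
  rw [SchwartzMap.fourierInv_coe, Real.fourierInv_eq_fourier_neg, ← SchwartzMap.fourier_coe,
    schwartzEvolution, SchwartzMap.fourierMultiplierCLM_apply,
    FourierTransform.fourier_fourierInv_eq,
    SchwartzMap.smulLeftCLM_apply_apply (hasTemperateGrowth_schrodingerSymbol t),
    SchwartzMap.fourierInv_coe, Real.fourierInv_eq_fourier_neg, SchwartzMap.fourier_coe]
  simp [schrodingerSymbol]

/-- The generator `iΔ` of the free evolution. -/
noncomputable def schwartzGenerator (φ : 𝓢(R3, ℂ)) : 𝓢(R3, ℂ) :=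
  Complex.I • Laplacian.laplacian φ

theorem fourierInv_schwartzGenerator (φ : 𝓢(R3, ℂ)) (ξ : R3) :
    𝓕⁻ (schwartzGenerator φ) ξ =
      -Complex.I * (((2 * Real.pi * ‖ξ‖) ^ 2 : ℝ) : ℂ) * 𝓕⁻ φ ξ := by
  have h : 𝓕⁻ (Laplacian.laplacian φ) ξ = -(((2 * Real.pi * ‖ξ‖) ^ 2 : ℝ) : ℂ) * 𝓕⁻ φ ξ := by
    rw [SchwartzMap.fourierInv_coe, Real.fourierInv_eq_fourier_neg, ← SchwartzMap.fourier_coe,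
      SchwartzMap.laplacian_eq_fourierMultiplierCLM, FourierTransform.fourier_smul,
      SchwartzMap.fourierMultiplierCLM_apply,
      FourierTransform.fourier_fourierInv_eq]
    rw [smul_apply, SchwartzMap.smulLeftCLM_apply_apply (by fun_prop),
      SchwartzMap.fourierInv_coe, Real.fourierInv_eq_fourier_neg, SchwartzMap.fourier_coe]
    simp
    ring
  rw [schwartzGenerator, FourierTransform.fourierInv_smul, smul_apply, h]
  simp
  ring

theorem IsFourierTransform.integral_mul_eq {h g : R3 → ℂ} (hg : IsFourierTransform h g)
    (φ : 𝓢(R3, ℂ)) :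
    Integrable (fun x => h x * φ x) ∧ Integrable (fun ξ => g ξ * 𝓕⁻ φ ξ) ∧
      ∫ x, h x * φ x = ∫ ξ, g ξ * 𝓕⁻ φ ξ := by
  have := hg (𝓕⁻ φ)
  rwa [FourierTransform.fourier_fourierInv_eq] at this

theorem IsFourierTransform.integral_mul_freeEvolution {h g : R3 → ℂ} (hg : IsFourierTransform h g)
    (t : ℝ) (φ : 𝓢(R3, ℂ)) :
    ∫ x, h x * freeEvolution t φ x = ∫ ξ, g ξ * (schrodingerSymbol t ξ * 𝓕⁻ φ ξ) := by
  have := (hg.integral_mul_eq (schwartzEvolution t φ)).2.2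
  simp_rw [fourierInv_schwartzEvolution] at this
  rw [← this, coe_schwartzEvolution]

theorem integral_schrodingerSymbol (s t : ℝ) (ξ : R3) :
    ∫ τ in s..t, schrodingerSymbol (τ - s) ξ * (-Complex.I * (((2 * Real.pi * ‖ξ‖) ^ 2 : ℝ) : ℂ)) =
      schrodingerSymbol (t - s) ξ - 1 := by
  have hd : ∀ τ ∈ Set.uIcc s t, HasDerivAt (fun τ : ℝ => schrodingerSymbol (τ - s) ξ)
      (schrodingerSymbol (τ - s) ξ * (-Complex.I * (((2 * Real.pi * ‖ξ‖) ^ 2 : ℝ) : ℂ))) τ := by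
    intro τ _
    unfold schrodingerSymbol
    have h1 : HasDerivAt (fun τ : ℝ => (τ - s) * (2 * Real.pi * ‖ξ‖) ^ 2)
        (1 * (2 * Real.pi * ‖ξ‖) ^ 2) τ := ((hasDerivAt_id τ).sub_const s).mul_const _
    have h2 := (h1.ofReal_comp.const_mul (-Complex.I)).cexp
    simpa using h2
  rw [intervalIntegral.integral_eq_sub_of_hasDerivAt hd]
  · simp [schrodingerSymbol]
  · apply Continuous.intervalIntegrable
    have := continuous_schrodingerSymbol.comp
      (by fun_prop : Continuous fun τ : ℝ => ((τ - s, ξ) : ℝ × R3))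
    exact this.mul continuous_const

/-- The fundamental theorem of calculus for the free evolution, tested against a distribution whose
Fourier transform is a function. -/
theorem IsFourierTransform.integral_mul_freeEvolution_eq_add {h g : R3 → ℂ}
    (hg : IsFourierTransform h g) (s t : ℝ) (φ : 𝓢(R3, ℂ)) :
    ∫ x, h x * freeEvolution (t - s) φ x =
      (∫ x, h x * φ x) +
        ∫ τ in s..t, ∫ x, h x * freeEvolution (τ - s) (schwartzGenerator φ) x := by
  simp_rw [hg.integral_mul_freeEvolution]
  have hint := (hg.integral_mul_eq (schwartzGenerator φ)).2.1
  have hint0 := (hg.integral_mul_eq φ).2.1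
  have hsym : ∀ τ, Continuous fun ξ => schrodingerSymbol τ ξ := fun τ =>
    continuous_schrodingerSymbol.comp (by fun_prop : Continuous fun ξ : R3 => ((τ, ξ) : ℝ × R3))
  have hjoint : Integrable (Function.uncurry fun (τ : ℝ) (ξ : R3) =>
      g ξ * (schrodingerSymbol (τ - s) ξ * 𝓕⁻ (schwartzGenerator φ) ξ))
      ((volume.restrict (Set.uIoc s t)).prod volume) := by
    have : IsFiniteMeasure (volume.restrict (Set.uIoc s t)) := by
      unfold Set.uIoc; infer_instance
    have h1 : Integrable (fun z : ℝ × R3 => (1 : ℝ) • (g z.2 * 𝓕⁻ (schwartzGenerator φ) z.2))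
        ((volume.restrict (Set.uIoc s t)).prod volume) :=
      Integrable.smul_prod (f := fun _ : ℝ => (1 : ℝ)) (integrable_const _) hint
    have hc : Continuous fun z : ℝ × R3 => schrodingerSymbol (z.1 - s) z.2 :=
      continuous_schrodingerSymbol.comp
        (by fun_prop : Continuous fun z : ℝ × R3 => ((z.1 - s, z.2) : ℝ × R3))
    refine (h1.bdd_mul (c := 1) hc.aestronglyMeasurable
      (ae_of_all _ fun z => (norm_schrodingerSymbol _ _).le)).congr (ae_of_all _ fun z => ?_)
    simp only [Function.uncurry, one_smul]
    ring
  rw [intervalIntegral_integral_swap hjoint, (hg.integral_mul_eq φ).2.2, ← integral_add hint0]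
  · congr 1 with ξ
    have e := integral_schrodingerSymbol s t ξ
    have : ∀ τ, g ξ * (schrodingerSymbol (τ - s) ξ * 𝓕⁻ (schwartzGenerator φ) ξ) =
        (g ξ * 𝓕⁻ φ ξ) * (schrodingerSymbol (τ - s) ξ *
          (-Complex.I * (((2 * Real.pi * ‖ξ‖) ^ 2 : ℝ) : ℂ))) := by
      intro τ; rw [fourierInv_schwartzGenerator]; ring
    simp_rw [this]
    rw [intervalIntegral.integral_const_mul, e]
    ring
  · simp_rw [intervalIntegral.intervalIntegral_eq_integral_uIoc]
    exact hjoint.integral_prod_right.smul _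

theorem continuous_freeEvolution (φ : 𝓢(R3, ℂ)) :
    Continuous fun z : ℝ × R3 => freeEvolution z.1 φ z.2 := by
  unfold freeEvolution
  simp_rw [Real.fourierInv_eq']
  apply continuous_of_dominated (bound := fun ξ => ‖𝓕 φ ξ‖)
  · intro z
    apply Continuous.aestronglyMeasurable
    have := (𝓕 φ).continuous
    fun_prop
  · intro z
    refine ae_of_all _ fun ξ => le_of_eq ?_
    rw [norm_smul, norm_mul]
    have := norm_schrodingerSymbol z.1 ξ
    rw [schrodingerSymbol] at this
    rw [this, Complex.norm_exp]
    simp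
  · exact (𝓕 φ).integrable.norm
  · refine ae_of_all _ fun ξ => ?_
    fun_prop

theorem eLpNorm_freeEvolution_le (t : ℝ) (φ : 𝓢(R3, ℂ)) :
    eLpNorm (freeEvolution t φ) 2 volume ≤ eLpNorm (fun ξ => 𝓕 φ ξ) 2 volume := by
  set G : 𝓢(R3, ℂ) := SchwartzMap.smulLeftCLM ℂ (schrodingerSymbol t) (𝓕 φ)
  have hG : ∀ ξ, G ξ = schrodingerSymbol t ξ * 𝓕 φ ξ := fun ξ =>
    SchwartzMap.smulLeftCLM_apply_apply (hasTemperateGrowth_schrodingerSymbol t) _ _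
  have e : freeEvolution t φ = 𝓕⁻ (G : R3 → ℂ) := by
    rw [← coe_schwartzEvolution, schwartzEvolution, SchwartzMap.fourierMultiplierCLM_apply,
      SchwartzMap.fourierInv_coe]
  rw [e]
  refine (eLpNorm_fourierInv_le G.integrable (G.memLp 2)).trans (eLpNorm_mono fun ξ => ?_)
  rw [hG, norm_mul, norm_schrodingerSymbol, one_mul]

/-! ### The weak form of the Duhamel formula -/

theorem aestronglyMeasurable_comp_fst_fst {Y : Type*} [MeasurableSpace Y] {μ : Measure ℝ}
    [SFinite μ] {ν : Measure Y} [SFinite ν] {h : ℝ → R3 → ℂ}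
    (hh : AEStronglyMeasurable (Function.uncurry h) (μ.prod volume)) :
    AEStronglyMeasurable (fun z : (ℝ × Y) × R3 => h z.1.1 z.2) ((μ.prod ν).prod volume) :=
  hh.comp_quasiMeasurePreserving
    (QuasiMeasurePreserving.prodMap Measure.quasiMeasurePreserving_fst
      (Measure.QuasiMeasurePreserving.id volume))

theorem eLpNorm_two_eq_lintegral {α : Type*} [MeasurableSpace α] (μ : Measure α) (f : α → ℂ) :
    eLpNorm f 2 μ ^ 2 = ∫⁻ x, ‖f x‖ₑ ^ 2 ∂μ := by
  have := eLpNorm_nnreal_pow_eq_lintegral (f := f) (p := 2) (μ := μ) (by norm_num)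
  simpa using this

theorem memLp_two_iff_lintegral {α : Type*} [MeasurableSpace α] {μ : Measure α} {f : α → ℂ}
    (hf : AEStronglyMeasurable f μ) : MemLp f 2 μ ↔ ∫⁻ x, ‖f x‖ₑ ^ 2 ∂μ < ∞ := by
  rw [← eLpNorm_two_eq_lintegral, MemLp, and_iff_right hf]
  simp [ENNReal.pow_lt_top_iff]

theorem memLp_two_freeEvolution_sub {a b : ℝ} (ψ : 𝓢(R3, ℂ)) :
    MemLp (fun z : (ℝ × ℝ) × R3 => freeEvolution (z.1.2 - z.1.1) ψ z.2) 2
      (((volume.restrict (Set.Icc a b)).prod (volume.restrict (Set.Icc a b))).prod volume) := by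
  have hc : Continuous fun z : (ℝ × ℝ) × R3 => freeEvolution (z.1.2 - z.1.1) ψ z.2 := by
    have h := (continuous_freeEvolution ψ).comp
      (by fun_prop : Continuous fun z : (ℝ × ℝ) × R3 => ((z.1.2 - z.1.1, z.2) : ℝ × R3))
    simpa only [Function.comp_def] using h
  rw [memLp_two_iff_lintegral hc.aestronglyMeasurable,
    lintegral_prod _ (hc.enorm.measurable.pow_const 2).aemeasurable]
  have hB : eLpNorm (fun ξ => 𝓕 ψ ξ) 2 volume < ∞ :=
    (SchwartzMap.memLp (𝓕 ψ : 𝓢(R3, ℂ)) 2 (volume : Measure R3)).eLpNorm_lt_top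
  calc _ ≤ ∫⁻ _ : ℝ × ℝ, eLpNorm (fun ξ => 𝓕 ψ ξ) 2 volume ^ 2
        ∂((volume.restrict (Set.Icc a b)).prod (volume.restrict (Set.Icc a b))) := by
        apply lintegral_mono
        intro z
        dsimp only
        rw [← eLpNorm_two_eq_lintegral volume (fun x => freeEvolution (z.2 - z.1) ψ x)]
        gcongr
        exact eLpNorm_freeEvolution_le _ _
    _ < ∞ := by
        rw [lintegral_const]
        exact ENNReal.mul_lt_top (ENNReal.pow_lt_top hB) (measure_lt_top _ _)

theorem memLp_two_comp_fst_fst {a b : ℝ} {F : ℝ → R3 → ℂ}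
    (hF : MemLp (Function.uncurry F) 2 ((volume.restrict (Set.Icc a b)).prod volume)) :
    MemLp (fun z : (ℝ × ℝ) × R3 => F z.1.1 z.2) 2
      (((volume.restrict (Set.Icc a b)).prod (volume.restrict (Set.Icc a b))).prod volume) := by
  have hm := aestronglyMeasurable_comp_fst_fst (ν := volume.restrict (Set.Icc a b)) hF.1
  have hF2 := (memLp_two_iff_lintegral hF.1).1 hF
  rw [lintegral_prod _ (hF.1.enorm.pow_const 2)] at hF2
  rw [memLp_two_iff_lintegral hm, lintegral_prod _ (hm.enorm.pow_const 2)]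
  have hm2 : AEMeasurable (fun s => ∫⁻ x, ‖F s x‖ₑ ^ 2) (volume.restrict (Set.Icc a b)) :=
    (hF.1.enorm.pow_const 2).lintegral_prod_right'
  have hm3 : AEMeasurable (fun z : ℝ × ℝ => ∫⁻ x, ‖F z.1 x‖ₑ ^ 2)
      ((volume.restrict (Set.Icc a b)).prod (volume.restrict (Set.Icc a b))) := hm2.comp_fst
  rw [lintegral_prod _ hm3]
  simp only [lintegral_const]
  rw [lintegral_mul_const'' _ hm2]
  exact ENNReal.mul_lt_top hF2 (measure_lt_top _ _)

theorem integrable_pairing_freeEvolution {a b : ℝ} {F : ℝ → R3 → ℂ}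
    (hF : MemLp (Function.uncurry F) 2 ((volume.restrict (Set.Icc a b)).prod volume))
    (ψ : 𝓢(R3, ℂ)) :
    Integrable (Function.uncurry fun s τ : ℝ => ∫ x, F s x * freeEvolution (τ - s) ψ x)
      ((volume.restrict (Set.Icc a b)).prod (volume.restrict (Set.Icc a b))) :=
  ((memLp_two_comp_fst_fst hF).integrable_mul (memLp_two_freeEvolution_sub ψ)).integral_prod_left

theorem memLp_two_slice {μ : Measure ℝ} [SFinite μ] {F : ℝ → R3 → ℂ}
    (hF : MemLp (Function.uncurry F) 2 (μ.prod volume)) :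
    ∀ᵐ s ∂μ, MemLp (F s) 2 volume := by
  have hF2 := (memLp_two_iff_lintegral hF.1).1 hF
  rw [lintegral_prod _ (hF.1.enorm.pow_const 2)] at hF2
  have hm2 : AEMeasurable (fun s => ∫⁻ x, ‖F s x‖ₑ ^ 2) μ :=
    (hF.1.enorm.pow_const 2).lintegral_prod_right'
  filter_upwards [ae_lt_top' hm2 hF2.ne, hF.1.prodMk_left] with s h1 h2
  exact (memLp_two_iff_lintegral h2).2 h1

theorem integrable_pairing {a b : ℝ} {F : ℝ → R3 → ℂ}
    (hF : MemLp (Function.uncurry F) 2 ((volume.restrict (Set.Icc a b)).prod volume))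
    (ψ : 𝓢(R3, ℂ)) :
    IntegrableOn (fun s => ∫ x, F s x * ψ x) (Set.Icc a b) := by
  have h2 : MemLp (fun z : ℝ × R3 => ψ z.2) 2 ((volume.restrict (Set.Icc a b)).prod volume) :=
    (ψ.memLp 2).comp_snd _
  exact (hF.integrable_mul h2).integral_prod_left

theorem IsFourierTransform.continuous_pairing {h g : R3 → ℂ} (hg : IsFourierTransform h g)
    (t₀ : ℝ) (ψ : 𝓢(R3, ℂ)) :
    Continuous fun τ : ℝ => ∫ x, h x * freeEvolution (τ - t₀) ψ x := by
  simp_rw [hg.integral_mul_freeEvolution]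
  have hint := (hg.integral_mul_eq ψ).2.1
  apply continuous_of_dominated (bound := fun ξ => ‖g ξ * 𝓕⁻ ψ ξ‖)
  · intro τ
    have hc : Continuous fun ξ => schrodingerSymbol (τ - t₀) ξ :=
      continuous_schrodingerSymbol.comp (by fun_prop : Continuous fun ξ : R3 => (τ - t₀, ξ))
    refine (hc.aestronglyMeasurable.mul hint.1).congr (ae_of_all _ fun ξ => ?_)
    simp only [Pi.mul_apply]; ring
  · intro τ
    refine ae_of_all _ fun ξ => le_of_eq ?_
    simp [norm_schrodingerSymbol]
  · exact hint.norm
  · refine ae_of_all _ fun ξ => ?_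
    have hc : Continuous fun τ : ℝ => schrodingerSymbol (τ - t₀) ξ :=
      continuous_schrodingerSymbol.comp (by fun_prop : Continuous fun τ : ℝ => (τ - t₀, ξ))
    fun_prop

/-- The Duhamel formula implies that `∂ₜ u = iΔu - iF` holds weakly, in integrated form. -/
theorem weak_formulation {u F : ℝ → R3 → ℂ} {a b t₀ : ℝ} (ht₀ : t₀ ∈ Set.Icc a b)
    (hF : MemLp (Function.uncurry F) 2 ((volume.restrict (Set.Icc a b)).prod volume))
    {g : R3 → ℂ} (hg : IsFourierTransform (u t₀) g)
    (hD : ∀ t ∈ Set.Icc a b, ∀ φ : 𝓢(R3, ℂ), ∫ x, u t x * φ x =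
      (∫ x, u t₀ x * freeEvolution (t - t₀) φ x) -
        Complex.I * ∫ s in t₀..t, ∫ x, F s x * freeEvolution (t - s) φ x)
    (φ : 𝓢(R3, ℂ)) {t : ℝ} (ht : t ∈ Set.Icc a b) :
    IntervalIntegrable (fun τ => (∫ x, u τ x * schwartzGenerator φ x) -
        Complex.I * ∫ x, F τ x * φ x) volume t₀ t ∧
      ∫ x, u t x * φ x = (∫ x, u t₀ x * φ x) +
        ∫ τ in t₀..t, ((∫ x, u τ x * schwartzGenerator φ x) -
          Complex.I * ∫ x, F τ x * φ x) := by
  set H : ℝ → ℝ → ℂ := fun s τ => ∫ x, F s x * freeEvolution (τ - s) (schwartzGenerator φ) x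
  obtain ⟨hswap, hi1, hi2⟩ := integral_triangle_swap_of_mem ht₀ ht
    (integrable_pairing_freeEvolution hF (schwartzGenerator φ))
  have hsub : Set.uIcc t₀ t ⊆ Set.Icc a b := Set.uIcc_subset_Icc ht₀ ht
  have hsub' : Set.uIoc t₀ t ⊆ Set.Icc a b := Set.uIoc_subset_uIcc.trans hsub
  have hi3 : IntervalIntegrable (fun s => ∫ x, F s x * φ x) volume t₀ t :=
    (intervalIntegrable_iff.2 ((integrable_pairing hF φ).mono_set hsub'))
  have hi4 : IntervalIntegrable (fun τ => ∫ x, u t₀ x *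
      freeEvolution (τ - t₀) (schwartzGenerator φ) x) volume t₀ t :=
    (hg.continuous_pairing t₀ _).intervalIntegrable _ _
  have hu : ∀ τ ∈ Set.uIcc t₀ t, ∫ x, u τ x * schwartzGenerator φ x =
      (∫ x, u t₀ x * freeEvolution (τ - t₀) (schwartzGenerator φ) x) -
        Complex.I * ∫ s in t₀..τ, H s τ := fun τ hτ => hD τ (hsub hτ) _
  have hFs : ∫ s in t₀..t, ∫ x, F s x * freeEvolution (t - s) φ x =
      ∫ s in t₀..t, ((∫ x, F s x * φ x) + ∫ τ in s..t, H s τ) := by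
    apply intervalIntegral.integral_congr_ae_restrict
    filter_upwards [ae_restrict_of_ae_restrict_of_subset hsub' (memLp_two_slice hF)] with s hs
    obtain ⟨gs, -, hgs⟩ := exists_isFourierTransform_of_memLp_two hs
    exact hgs.integral_mul_freeEvolution_eq_add s t φ
  have hall : IntervalIntegrable (fun τ => (∫ x, u τ x * schwartzGenerator φ x) -
        Complex.I * ∫ x, F τ x * φ x) volume t₀ t := by
    refine ((hi4.sub (hi2.const_mul Complex.I)).sub (hi3.const_mul Complex.I)).congr fun τ hτ => ?_
    rw [hu τ (Set.uIoc_subset_uIcc hτ)]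
  refine ⟨hall, ?_⟩
  have e : ∫ τ in t₀..t, ((∫ x, u τ x * schwartzGenerator φ x) -
      Complex.I * ∫ x, F τ x * φ x) = ∫ τ in t₀..t, (((∫ x, u t₀ x *
        freeEvolution (τ - t₀) (schwartzGenerator φ) x) - Complex.I * ∫ s in t₀..τ, H s τ) -
      Complex.I * ∫ x, F τ x * φ x) := by
    apply intervalIntegral.integral_congr
    intro τ hτ
    dsimp only
    rw [hu τ hτ]
  rw [e, intervalIntegral.integral_sub (hi4.sub (hi2.const_mul Complex.I))
    (hi3.const_mul Complex.I), intervalIntegral.integral_sub hi4 (hi2.const_mul Complex.I),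
    intervalIntegral.integral_const_mul, intervalIntegral.integral_const_mul, hD t ht φ, hFs,
    intervalIntegral.integral_add hi3 hi1, hswap,
    hg.integral_mul_freeEvolution_eq_add t₀ t φ]
  ring

/-! ### Convolution with Schwartz functions -/

/-- The convolution of `h` with a Schwartz function. -/
noncomputable def schwartzConv (h : R3 → ℂ) (ψ : 𝓢(R3, ℂ)) (x : R3) : ℂ :=
  ∫ y, h y * ψ (x - y)

/-- The Schwartz function `y ↦ ψ (x - y)`. -/
noncomputable def schwartzReflect (ψ : 𝓢(R3, ℂ)) (x : R3) : 𝓢(R3, ℂ) :=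
  SchwartzMap.compSubConstCLM ℂ x
    (SchwartzMap.compCLMOfContinuousLinearEquiv ℂ (ContinuousLinearEquiv.neg ℝ (M := R3)) ψ)

@[simp]
theorem schwartzReflect_apply (ψ : 𝓢(R3, ℂ)) (x y : R3) : schwartzReflect ψ x y = ψ (x - y) := by
  simp [schwartzReflect]

theorem fourierInv_schwartzReflect (ψ : 𝓢(R3, ℂ)) (x ξ : R3) :
    𝓕⁻ (schwartzReflect ψ x) ξ = Real.fourierChar (inner ℝ ξ x) • 𝓕 ψ ξ := by
  rw [SchwartzMap.fourierInv_coe, SchwartzMap.fourier_coe, Real.fourierInv_eq, Real.fourier_eq,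
    ← integral_sub_left_eq_self _ volume x, Circle.smul_def, ← MeasureTheory.integral_smul]
  congr 1 with y
  simp only [schwartzReflect_apply, sub_sub_cancel]
  rw [← Circle.smul_def, smul_smul, ← AddChar.map_add_eq_mul, inner_sub_left, real_inner_comm ξ x, sub_eq_add_neg]

theorem schwartzGenerator_schwartzReflect (ψ : 𝓢(R3, ℂ)) (x : R3) :
    schwartzGenerator (schwartzReflect ψ x) = schwartzReflect (schwartzGenerator ψ) x := by
  have hinj : ∀ f g : 𝓢(R3, ℂ), (∀ ξ, 𝓕⁻ f ξ = 𝓕⁻ g ξ) → f = g := by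
    intro f g h
    have : (𝓕⁻ f : 𝓢(R3, ℂ)) = 𝓕⁻ g := by ext ξ; exact h ξ
    have h2 := congrArg (fun k : 𝓢(R3, ℂ) => (𝓕 k : 𝓢(R3, ℂ))) this
    simpa only [FourierTransform.fourier_fourierInv_eq] using h2
  apply hinj
  intro ξ
  have h := fourierInv_schwartzGenerator ψ (-ξ)
  simp only [SchwartzMap.fourierInv_coe, Real.fourierInv_eq_fourier_neg, neg_neg, norm_neg] at h
  simp only [← SchwartzMap.fourier_coe] at h
  rw [fourierInv_schwartzGenerator, fourierInv_schwartzReflect, fourierInv_schwartzReflect, h,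
    Circle.smul_def, Circle.smul_def, smul_eq_mul, smul_eq_mul]
  ring

theorem IsFourierTransform.schwartzConv_eq {f g : R3 → ℂ} (hg : IsFourierTransform f g)
    (ψ : 𝓢(R3, ℂ)) :
    Integrable (fun ξ => g ξ * 𝓕 ψ ξ) ∧
      ∀ x, schwartzConv f ψ x = 𝓕⁻ (fun ξ => g ξ * 𝓕 ψ ξ) x := by
  refine ⟨(hg (𝓕 ψ)).2.1, fun x => ?_⟩
  have h := (hg.integral_mul_eq (schwartzReflect ψ x)).2.2
  simp only [schwartzReflect_apply, fourierInv_schwartzReflect] at h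
  rw [schwartzConv, h, Real.fourierInv_eq]
  congr 1 with ξ
  rw [mul_smul_comm]

theorem IsFourierTransform.locallyIntegrable {f g : R3 → ℂ} (hg : IsFourierTransform f g) :
    LocallyIntegrable f := by
  rw [locallyIntegrable_iff]
  intro K hK
  obtain ⟨r, hr, hKr⟩ := hK.isBounded.exists_pos_norm_le
  let b : ContDiffBump (0 : R3) := ⟨r, r + 1, hr, by linarith⟩
  have hbc : HasCompactSupport fun x => (b x : ℂ) :=
    b.hasCompactSupport.comp_left (g := fun r : ℝ => (r : ℂ)) (by simp)
  have hbs : ContDiff ℝ ((⊤ : ℕ∞) : WithTop ℕ∞) fun x => (b x : ℂ) :=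
    Complex.ofRealCLM.contDiff.comp b.contDiff
  have h := (hg.integral_mul_eq (hbc.toSchwartzMap hbs)).1.integrableOn (s := K)
  refine h.congr_fun (fun x hx => ?_) hK.measurableSet
  have : b x = 1 := b.one_of_mem_closedBall (by simpa [b] using hKr x hx)
  change f x * (b x : ℂ) = f x
  simp [this]

/-- The partial derivative in the direction of a coordinate axis. -/
noncomputable def pd {E : Type*} [NormedAddCommGroup E] [NormedSpace ℝ E] (j : Fin 3)
    (f : R3 → E) (x : R3) : E :=
  fderiv ℝ f x (EuclideanSpace.single j 1)

/-- The partial derivative of a Schwartz function. -/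
noncomputable def schwartzPd (j : Fin 3) (ψ : 𝓢(R3, ℂ)) : 𝓢(R3, ℂ) :=
  LineDeriv.lineDerivOp (EuclideanSpace.single j (1 : ℝ) : R3) ψ

theorem schwartzPd_apply (j : Fin 3) (ψ : 𝓢(R3, ℂ)) (x : R3) : schwartzPd j ψ x = pd j ψ x :=
  SchwartzMap.lineDerivOp_apply_eq_fderiv _ _ _

theorem HasCompactSupport.schwartzPd {ψ : 𝓢(R3, ℂ)} (hψ : HasCompactSupport ψ) (j : Fin 3) :
    HasCompactSupport (schwartzPd j ψ) := by
  refine hψ.of_isClosed_subset (isClosed_tsupport _) (SchwartzMap.tsupport_lineDerivOp_subset _ _)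

theorem schwartzConv_eq_convolution (h : R3 → ℂ) (ψ : 𝓢(R3, ℂ)) :
    schwartzConv h ψ = convolution h ψ (ContinuousLinearMap.mul ℝ ℂ) volume := by
  ext x; simp [schwartzConv, convolution]

theorem contDiff_schwartzConv {h : R3 → ℂ} (hh : LocallyIntegrable h) {ψ : 𝓢(R3, ℂ)}
    (hψ : HasCompactSupport ψ) {n : ℕ∞} : ContDiff ℝ n (schwartzConv h ψ) := by
  rw [schwartzConv_eq_convolution]
  exact hψ.contDiff_convolution_right _ hh (ψ.smooth n)

theorem pd_schwartzConv {h : R3 → ℂ} (hh : LocallyIntegrable h) {ψ : 𝓢(R3, ℂ)}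
    (hψ : HasCompactSupport ψ) (j : Fin 3) :
    pd j (schwartzConv h ψ) = schwartzConv h (schwartzPd j ψ) := by
  ext x
  have h1 := hψ.hasFDerivAt_convolution_right (ContinuousLinearMap.mul ℝ ℂ) hh
    (ψ.smooth 1) x
  rw [← schwartzConv_eq_convolution] at h1
  rw [pd, h1.fderiv, convolution_precompR_apply _ hh (hψ.fderiv ℝ)
    ((ψ.smooth 1).continuous_fderiv (by simp)), schwartzConv_eq_convolution]
  congr 1

theorem schwartzGenerator_eq_sum (ψ : 𝓢(R3, ℂ)) (x : R3) :
    schwartzGenerator ψ x = Complex.I * ∑ j, schwartzPd j (schwartzPd j ψ) x := by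
  rw [schwartzGenerator, smul_apply, SchwartzMap.laplacian_eq_sum (EuclideanSpace.basisFun (Fin 3) ℝ)]
  simp [schwartzPd]

theorem integrable_schwartzConv {h : R3 → ℂ} (hh : LocallyIntegrable h) {ψ : 𝓢(R3, ℂ)}
    (hψ : HasCompactSupport ψ) (x : R3) : Integrable fun y => h y * ψ (x - y) :=
  hψ.convolutionExists_right (ContinuousLinearMap.mul ℝ ℂ) hh ψ.continuous x

theorem schwartzConv_generator {h : R3 → ℂ} (hh : LocallyIntegrable h) {ψ : 𝓢(R3, ℂ)}
    (hψ : HasCompactSupport ψ) (x : R3) :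
    schwartzConv h (schwartzGenerator ψ) x = Complex.I * ∑ j, pd j (pd j (schwartzConv h ψ)) x := by
  have hj : ∀ j, HasCompactSupport (schwartzPd j (schwartzPd j ψ)) := fun j =>
    (hψ.schwartzPd j).schwartzPd j
  have e : ∀ j, pd j (pd j (schwartzConv h ψ)) x =
      schwartzConv h (schwartzPd j (schwartzPd j ψ)) x := by
    intro j
    rw [pd_schwartzConv hh hψ, pd_schwartzConv hh (hψ.schwartzPd j)]
  simp_rw [e, schwartzConv, schwartzGenerator_eq_sum]
  rw [← integral_finsetSum _ fun j _ => integrable_schwartzConv hh (hj j) x, ← integral_const_mul]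
  congr 1 with y
  rw [← Finset.mul_sum]; ring

/-! ### The mollifier -/

/-- A sequence of bump functions shrinking to the origin. -/
noncomputable def mollifierBump (n : ℕ) : ContDiffBump (0 : R3) where
  rIn := 1 / (n + 1)
  rOut := 2 / (n + 1)
  rIn_pos := by positivity
  rIn_lt_rOut := by gcongr; norm_num

theorem hasCompactSupport_ofReal_normed (n : ℕ) :
    HasCompactSupport fun x => ((mollifierBump n).normed volume x : ℂ) :=
  (mollifierBump n).hasCompactSupport_normed.comp_left (g := fun r : ℝ => (r : ℂ)) (by simp)

theorem contDiff_ofReal_normed (n : ℕ) :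
    ContDiff ℝ ((⊤ : ℕ∞) : WithTop ℕ∞) fun x => ((mollifierBump n).normed volume x : ℂ) :=
  Complex.ofRealCLM.contDiff.comp (mollifierBump n).contDiff_normed

/-- A sequence of compactly supported Schwartz functions approximating the identity. -/
noncomputable def mollifier (n : ℕ) : 𝓢(R3, ℂ) :=
  (hasCompactSupport_ofReal_normed n).toSchwartzMap (contDiff_ofReal_normed n)

theorem mollifier_apply (n : ℕ) (x : R3) :
    mollifier n x = ((mollifierBump n).normed volume x : ℂ) := rfl

theorem hasCompactSupport_mollifier (n : ℕ) : HasCompactSupport (mollifier n) :=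
  hasCompactSupport_ofReal_normed n

theorem enorm_mollifier (n : ℕ) (x : R3) :
    ‖mollifier n x‖ₑ = ENNReal.ofReal ((mollifierBump n).normed volume x) := by
  rw [mollifier_apply, ← ofReal_norm, Complex.norm_real,
    Real.norm_of_nonneg ((mollifierBump n).nonneg_normed x)]

theorem lintegral_enorm_mollifier (n : ℕ) : ∫⁻ x, ‖mollifier n x‖ₑ = 1 := by
  simp_rw [enorm_mollifier]
  rw [← ofReal_integral_eq_lintegral_ofReal (mollifierBump n).integrable_normed
    (ae_of_all _ fun x => (mollifierBump n).nonneg_normed x), (mollifierBump n).integral_normed]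
  simp

theorem norm_fourier_mollifier_le (n : ℕ) (ξ : R3) : ‖𝓕 (mollifier n) ξ‖ ≤ 1 := by
  rw [SchwartzMap.fourier_coe, ← neg_neg ξ, ← Real.fourierInv_eq_fourier_neg]
  refine (norm_fourierInv_le_integral_norm _ _).trans ?_
  rw [integral_norm_eq_lintegral_enorm (mollifier n).continuous.aestronglyMeasurable,
    lintegral_enorm_mollifier]
  simp

theorem ae_tendsto_schwartzConv_mollifier {h : R3 → ℂ} (hh : LocallyIntegrable h) :
    ∀ᵐ x, Tendsto (fun n => schwartzConv h (mollifier n) x) atTop (𝓝 (h x)) := by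
  have hr : Tendsto (fun n => (mollifierBump n).rOut) atTop (𝓝 0) := by
    have := (tendsto_one_div_add_atTop_nhds_zero_nat (𝕜 := ℝ)).const_mul 2
    simp only [mul_zero] at this
    refine this.congr fun n => ?_
    simp [mollifierBump]; ring
  filter_upwards [ContDiffBump.ae_convolution_tendsto_right_of_locallyIntegrable
    (φ := mollifierBump) (K := 2) hr (Eventually.of_forall fun n => le_of_eq (by
      simp [mollifierBump]; ring)) hh] with x hx
  refine hx.congr fun n => ?_
  rw [convolution_eq_swap, schwartzConv]
  congr 1 with y
  simp [mollifier_apply, mul_comm]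

/-- Convolution with the mollifier does not increase `L^r` norms. -/
theorem lintegral_schwartzConv_mollifier_le {h : R3 → ℂ} (hh : AEStronglyMeasurable h)
    {r : ℝ} (hr : 1 ≤ r) (n : ℕ) :
    ∫⁻ x, ‖schwartzConv h (mollifier n) x‖ₑ ^ r ≤ ∫⁻ x, ‖h x‖ₑ ^ r := by
  have hρm : Measurable fun x => ‖mollifier n x‖ₑ := (mollifier n).continuous.enorm.measurable
  have hpt : ∀ x, ‖schwartzConv h (mollifier n) x‖ₑ ^ r ≤
      ∫⁻ y, ‖mollifier n (x - y)‖ₑ * ‖h y‖ₑ ^ r := by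
    intro x
    have hm : Measurable fun y => ‖mollifier n (x - y)‖ₑ := hρm.comp (measurable_const.sub measurable_id)
    set μ := (volume : Measure R3).withDensity fun y => ‖mollifier n (x - y)‖ₑ
    have hμ : IsProbabilityMeasure μ := ⟨by
      rw [withDensity_apply _ MeasurableSet.univ, Measure.restrict_univ,
        lintegral_sub_left_eq_self (fun y => ‖mollifier n y‖ₑ) x, lintegral_enorm_mollifier]⟩
    have hhμ : AEStronglyMeasurable h μ := hh.mono_ac (withDensity_absolutelyContinuous _ _)
    have hconv : ∀ f : R3 → ℝ≥0∞, ∫⁻ y, f y ∂μ = ∫⁻ y, ‖mollifier n (x - y)‖ₑ * f y :=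
      fun f => lintegral_withDensity_eq_lintegral_mul_non_measurable _ hm
        (ae_of_all _ fun y => by simp) f
    have hj := eLpNorm'_le_eLpNorm'_of_exponent_le one_pos hr μ hhμ
    simp only [eLpNorm', ENNReal.rpow_one, div_one] at hj
    have h1 : ‖schwartzConv h (mollifier n) x‖ₑ ≤ ∫⁻ y, ‖h y‖ₑ ∂μ := by
      rw [hconv]
      refine (enorm_integral_le_lintegral_enorm _).trans (le_of_eq ?_)
      congr 1 with y
      rw [enorm_mul, mul_comm]
    rw [← hconv]
    calc _ ≤ ((∫⁻ y, ‖h y‖ₑ ^ r ∂μ) ^ (1 / r)) ^ r := by gcongr; exact h1.trans hj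
      _ = _ := by
        rw [← ENNReal.rpow_mul, one_div_mul_cancel (by linarith), ENNReal.rpow_one]
  calc _ ≤ ∫⁻ x, ∫⁻ y, ‖mollifier n (x - y)‖ₑ * ‖h y‖ₑ ^ r := lintegral_mono hpt
    _ = ∫⁻ y, ∫⁻ x, ‖mollifier n (x - y)‖ₑ * ‖h y‖ₑ ^ r := by
        apply lintegral_lintegral_swap
        apply AEMeasurable.mul
        · exact (hρm.comp (measurable_fst.sub measurable_snd)).aemeasurable
        · exact (hh.enorm.pow_const r).comp_snd
    _ = ∫⁻ y, ‖h y‖ₑ ^ r := by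
        congr 1 with y
        have hm : Measurable fun x => ‖mollifier n (x - y)‖ₑ :=
          hρm.comp (measurable_id.sub measurable_const)
        rw [lintegral_mul_const _ hm,
          lintegral_sub_right_eq_self (fun x => ‖mollifier n x‖ₑ) y, lintegral_enorm_mollifier,
          one_mul]

/-! ### Sobolev bounds for mollified functions -/

/-- `f` has homogeneous Sobolev norm at most `N`, witnessed by a Fourier transform. -/
def SobolevBound (s : ℝ) (N : ℝ≥0) (f : R3 → ℂ) : Prop :=
  ∃ g : R3 → ℂ, IsFourierTransform f g ∧
    eLpNorm (fun ξ => (((2 * Real.pi * ‖ξ‖) ^ s : ℝ) : ℂ) * g ξ) 2 volume ≤ N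

theorem SobolevBound.of_homSobolevNorm_lt {s : ℝ} {N : ℝ≥0} {f : R3 → ℂ}
    (h : homSobolevNorm s f < N) : SobolevBound s N f := by
  simp only [homSobolevNorm, iInf_lt_iff] at h
  obtain ⟨g, hg, h⟩ := h
  exact ⟨g, hg, h.le⟩

theorem SobolevBound.locallyIntegrable {s : ℝ} {N : ℝ≥0} {f : R3 → ℂ} (h : SobolevBound s N f) :
    LocallyIntegrable f := by
  obtain ⟨g, hg, -⟩ := h
  exact hg.locallyIntegrable

theorem two_pi_rpow_mul_lintegral_le {s : ℝ} {N : ℝ≥0} {g : R3 → ℂ}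
    (h : eLpNorm (fun ξ => (((2 * Real.pi * ‖ξ‖) ^ s : ℝ) : ℂ) * g ξ) 2 volume ≤ N) :
    ENNReal.ofReal ((2 * Real.pi) ^ (2 * s)) *
      ∫⁻ ξ, ENNReal.ofReal (‖ξ‖ ^ (2 * s)) * ‖g ξ‖ₑ ^ 2 ≤ (N : ℝ≥0∞) ^ 2 := by
  have hp : 0 < 2 * Real.pi := by positivity
  calc _ = eLpNorm (fun ξ => (((2 * Real.pi * ‖ξ‖) ^ s : ℝ) : ℂ) * g ξ) 2 volume ^ 2 := by
        rw [eLpNorm_two_eq_lintegral, ← lintegral_const_mul' _ _ ENNReal.ofReal_ne_top]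
        congr 1 with ξ
        rw [← mul_assoc, ← ENNReal.ofReal_mul (by positivity), enorm_mul, mul_pow,
          ← ofReal_norm (((2 * Real.pi * ‖ξ‖) ^ s : ℝ) : ℂ), Complex.norm_real, Real.norm_of_nonneg (by positivity),
          ← ENNReal.ofReal_pow (by positivity), ← Real.mul_rpow hp.le (norm_nonneg _),
          mul_comm 2 s, Real.rpow_mul (by positivity)]
        norm_num
    _ ≤ _ := by gcongr

/-- Mollification preserves the Sobolev inequality for `f` and for its gradient. -/
theorem exists_mollified_sobolev {s : ℝ} (hs₁ : 1 < s) (hs₂ : s < 3 / 2) :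
    ∃ C : ℝ≥0, ∀ (f : R3 → ℂ) (N : ℝ≥0), SobolevBound s N f → ∀ n,
      ∫⁻ x, ‖schwartzConv f (mollifier n) x‖ₑ ^ (6 / (3 - 2 * s)) ≤
        C * (N : ℝ≥0∞) ^ (6 / (3 - 2 * s)) ∧
      ∀ j, ∫⁻ x, ‖schwartzConv f (schwartzPd j (mollifier n)) x‖ₑ ^ (6 / (3 - 2 * (s - 1))) ≤
        C * (N : ℝ≥0∞) ^ (6 / (3 - 2 * (s - 1))) := by
  obtain ⟨C₁, hC₁⟩ := exists_sobolev (by linarith) hs₂ (q := 6 / (3 - 2 * s)) rfl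
  obtain ⟨C₂, hC₂⟩ := exists_sobolev (σ := s - 1) (by linarith) (by linarith)
    (q := 6 / (3 - 2 * (s - 1))) rfl
  have hp : 1 ≤ 2 * Real.pi := by linarith [Real.pi_gt_three]
  refine ⟨max C₁ C₂, fun f N hf n => ?_⟩
  obtain ⟨g, hg, hN⟩ := hf
  have hN' := two_pi_rpow_mul_lintegral_le hN
  set J := ∫⁻ ξ, ENNReal.ofReal (‖ξ‖ ^ (2 * s)) * ‖g ξ‖ₑ ^ 2 with hJ
  have hsq : ∀ r : ℝ, ((N : ℝ≥0∞) ^ 2) ^ (r / 2) = (N : ℝ≥0∞) ^ r := by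
    intro r
    rw [← ENNReal.rpow_natCast, ← ENNReal.rpow_mul]; congr 1; push_cast; ring
  refine ⟨?_, fun j => ?_⟩
  · have hq : 0 < 6 / (3 - 2 * s) := div_pos (by norm_num) (by linarith)
    obtain ⟨hi, he⟩ := hg.schwartzConv_eq (mollifier n)
    simp_rw [he]
    refine (hC₁ _ hi).trans ?_
    rw [← hsq]
    gcongr
    · exact le_max_left _ _
    · calc _ ≤ J := by
            rw [hJ]
            gcongr with ξ
            rw [enorm_mul]
            refine mul_le_of_le_one_right (by simp) ?_
            rw [← ofReal_norm]
            exact ENNReal.ofReal_le_one.2 (norm_fourier_mollifier_le n ξ)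
        _ ≤ ENNReal.ofReal ((2 * Real.pi) ^ (2 * s)) * J := by
            refine le_mul_of_one_le_left (by simp) ?_
            rw [ENNReal.one_le_ofReal]
            exact Real.one_le_rpow hp (by linarith)
        _ ≤ _ := hN'
  · have hq : 0 < 6 / (3 - 2 * (s - 1)) := div_pos (by norm_num) (by linarith)
    obtain ⟨hi, he⟩ := hg.schwartzConv_eq (schwartzPd j (mollifier n))
    simp_rw [he]
    refine (hC₂ _ hi).trans ?_
    rw [← hsq]
    gcongr
    · exact le_max_right _ _
    · have hpt : ∀ ξ : R3, ‖𝓕 (schwartzPd j (mollifier n)) ξ‖ ≤ 2 * Real.pi * ‖ξ‖ := by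
        intro ξ
        rw [schwartzPd, SchwartzMap.fourier_lineDerivOp_eq, smul_apply,
          SchwartzMap.smulLeftCLM_apply_apply (by fun_prop)]
        have h1 : |inner ℝ ξ (EuclideanSpace.single j (1 : ℝ))| ≤ ‖ξ‖ := by
          refine (abs_real_inner_le_norm _ _).trans ?_
          simp
        have h2 := norm_fourier_mollifier_le n ξ
        rw [norm_smul, norm_smul, Real.norm_eq_abs]
        have h3 : ‖(2 * Real.pi * Complex.I : ℂ)‖ = 2 * Real.pi := by
          simp [abs_of_pos Real.pi_pos]
        rw [h3]
        have h4 : |inner ℝ ξ (EuclideanSpace.single j (1 : ℝ))| * ‖𝓕 (mollifier n) ξ‖ ≤ ‖ξ‖ * 1 :=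
          mul_le_mul h1 h2 (norm_nonneg _) (norm_nonneg _)
        have := Real.pi_pos
        nlinarith
      calc _ ≤ ∫⁻ ξ, ENNReal.ofReal ((2 * Real.pi) ^ 2) *
              (ENNReal.ofReal (‖ξ‖ ^ (2 * s)) * ‖g ξ‖ₑ ^ 2) := by
            apply lintegral_mono_ae
            filter_upwards [Measure.ae_ne volume (0 : R3)] with ξ hξ
            rw [enorm_mul, mul_pow]
            have h5 : ‖𝓕 (schwartzPd j (mollifier n)) ξ‖ₑ ^ 2 ≤
                ENNReal.ofReal ((2 * Real.pi * ‖ξ‖) ^ 2) := by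
              rw [← ofReal_norm, ← ENNReal.ofReal_pow (norm_nonneg _)]
              apply ENNReal.ofReal_le_ofReal
              exact pow_le_pow_left₀ (norm_nonneg _) (hpt ξ) 2
            calc _ ≤ ENNReal.ofReal (‖ξ‖ ^ (2 * (s - 1))) *
                  (‖g ξ‖ₑ ^ 2 * ENNReal.ofReal ((2 * Real.pi * ‖ξ‖) ^ 2)) := by gcongr
              _ = ENNReal.ofReal (‖ξ‖ ^ (2 * (s - 1))) * ENNReal.ofReal ((2 * Real.pi * ‖ξ‖) ^ 2) *
                  ‖g ξ‖ₑ ^ 2 := by ring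
              _ = _ := by
                rw [← mul_assoc, ← ENNReal.ofReal_mul (by positivity),
                  ← ENNReal.ofReal_mul (by positivity)]
                congr 2
                have : ‖ξ‖ ^ (2 * s) = ‖ξ‖ ^ (2 * (s - 1)) * ‖ξ‖ ^ 2 := by
                  rw [← Real.rpow_natCast ‖ξ‖ 2, ← Real.rpow_add (norm_pos_iff.2 hξ)]
                  congr 1; push_cast; ring
                rw [this]; ring
        _ = ENNReal.ofReal ((2 * Real.pi) ^ 2) * J := by
            rw [lintegral_const_mul' _ _ ENNReal.ofReal_ne_top]
        _ ≤ ENNReal.ofReal ((2 * Real.pi) ^ (2 * s)) * J := by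
            gcongr
            rw [← Real.rpow_natCast]
            exact Real.rpow_le_rpow_of_exponent_le hp (by push_cast; linarith)
        _ ≤ _ := hN'

theorem lintegral_rpow_le_of_mollified {f : R3 → ℂ} (hf : LocallyIntegrable f) {r : ℝ}
    {B : ℝ≥0∞} (h : ∀ n, ∫⁻ x, ‖schwartzConv f (mollifier n) x‖ₑ ^ r ≤ B) :
    ∫⁻ x, ‖f x‖ₑ ^ r ≤ B := by
  have hc : ∀ n, Continuous (schwartzConv f (mollifier n)) := fun n =>
    (contDiff_schwartzConv hf (hasCompactSupport_mollifier n) (n := 0)).continuous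
  calc ∫⁻ x, ‖f x‖ₑ ^ r = ∫⁻ x, liminf (fun n => ‖schwartzConv f (mollifier n) x‖ₑ ^ r) atTop := by
        apply lintegral_congr_ae
        filter_upwards [ae_tendsto_schwartzConv_mollifier hf] with x hx
        exact ((ENNReal.continuous_rpow_const.tendsto _).comp hx.enorm).liminf_eq.symm
    _ ≤ liminf (fun n => ∫⁻ x, ‖schwartzConv f (mollifier n) x‖ₑ ^ r) atTop :=
        lintegral_liminf_le fun n => (hc n).enorm.measurable.pow_const r
    _ ≤ B := by
        refine liminf_le_of_le (by isBoundedDefault) fun b hb => ?_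
        obtain ⟨n, hn⟩ := hb.exists
        exact hn.trans (h n)

/-! ### The commutator of mollification and nonlinearity -/

theorem continuous_nlsNonlinearity {p : ℝ} (hp : 0 ≤ p) : Continuous (nlsNonlinearity p) := by
  unfold nlsNonlinearity
  have : Continuous fun z : ℂ => ‖z‖ ^ p := continuous_norm.rpow_const fun _ => Or.inr hp
  exact (Complex.continuous_ofReal.comp this).mul continuous_id

theorem norm_nlsNonlinearity {p : ℝ} (hp : 0 ≤ p) (z : ℂ) : ‖nlsNonlinearity p z‖ = ‖z‖ ^ (p + 1) := by
  rw [nlsNonlinearity, norm_mul, Complex.norm_real, Real.norm_of_nonneg (by positivity),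
    Real.rpow_add_one' (norm_nonneg _) (by linarith)]

theorem enorm_nlsNonlinearity_sq {p : ℝ} (hp : 0 ≤ p) (z : ℂ) :
    ‖nlsNonlinearity p z‖ₑ ^ 2 = ‖z‖ₑ ^ (2 * (p + 1)) := by
  rw [← ofReal_norm, norm_nlsNonlinearity hp, ← ofReal_norm,
    ENNReal.ofReal_rpow_of_nonneg (norm_nonneg _) (by linarith),
    ← ENNReal.ofReal_pow (by positivity), ← Real.rpow_natCast, ← Real.rpow_mul (norm_nonneg _)]
  congr 2; push_cast; ring

/-- The difference between the mollified nonlinearity and the nonlinearity of the mollification. -/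
noncomputable def nlsCommutator (p : ℝ) (h : R3 → ℂ) (n : ℕ) (x : R3) : ℂ :=
  schwartzConv (fun y => nlsNonlinearity p (h y)) (mollifier n) x -
    nlsNonlinearity p (schwartzConv h (mollifier n) x)

theorem enorm_sub_sq_le (z w : ℂ) : ‖z - w‖ₑ ^ 2 ≤ 2 * ‖z‖ₑ ^ 2 + 2 * ‖w‖ₑ ^ 2 := by
  have h1 : ‖z - w‖ ^ 2 ≤ 2 * ‖z‖ ^ 2 + 2 * ‖w‖ ^ 2 := by
    have := norm_sub_le z w
    have h0 := norm_nonneg (z - w)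
    nlinarith [sq_nonneg (‖z‖ - ‖w‖)]
  have e : ∀ v : ℂ, ‖v‖ₑ ^ 2 = ENNReal.ofReal (‖v‖ ^ 2) := fun v => by
    rw [← ofReal_norm, ENNReal.ofReal_pow (norm_nonneg _)]
  rw [e, e, e, show (2 : ℝ≥0∞) = ENNReal.ofReal 2 by simp, ← ENNReal.ofReal_mul (by norm_num),
    ← ENNReal.ofReal_mul (by norm_num), ← ENNReal.ofReal_add (by positivity) (by positivity)]
  exact ENNReal.ofReal_le_ofReal h1

theorem lintegral_dominating_le {p : ℝ} (hp : 0 ≤ p) {h : R3 → ℂ} (hh : LocallyIntegrable h)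
    (n : ℕ) :
    ∫⁻ x, (2 * ‖schwartzConv (fun y => nlsNonlinearity p (h y)) (mollifier n) x‖ₑ ^ 2 +
      2 * ‖nlsNonlinearity p (schwartzConv h (mollifier n) x)‖ₑ ^ 2) ≤
      4 * ∫⁻ x, ‖h x‖ₑ ^ (2 * (p + 1)) := by
  have hc : Continuous (schwartzConv h (mollifier n)) :=
    (contDiff_schwartzConv hh (hasCompactSupport_mollifier n) (n := 0)).continuous
  have hFm : AEStronglyMeasurable (fun y => nlsNonlinearity p (h y)) volume :=
    (continuous_nlsNonlinearity hp).comp_aestronglyMeasurable hh.aestronglyMeasurable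
  have hm : Measurable fun x => 2 * ‖nlsNonlinearity p (schwartzConv h (mollifier n) x)‖ₑ ^ 2 :=
    (((continuous_nlsNonlinearity hp).comp hc).enorm.measurable.pow_const 2).const_mul 2
  rw [lintegral_add_right _ hm, lintegral_const_mul' _ _ (by simp),
    lintegral_const_mul' _ _ (by simp)]
  have h1 := lintegral_schwartzConv_mollifier_le hFm (r := 2) (by norm_num) n
  have h2 := lintegral_schwartzConv_mollifier_le hh.aestronglyMeasurable (r := 2 * (p + 1))
    (by linarith) n
  simp only [enorm_nlsNonlinearity_sq hp, ENNReal.rpow_ofNat] at h1 ⊢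
  calc _ ≤ 2 * (∫⁻ x, ‖h x‖ₑ ^ (2 * (p + 1))) + 2 * ∫⁻ x, ‖h x‖ₑ ^ (2 * (p + 1)) := by gcongr
    _ = _ := by ring

theorem lintegral_nlsCommutator_le {p : ℝ} (hp : 0 ≤ p) {h : R3 → ℂ} (hh : LocallyIntegrable h)
    (n : ℕ) :
    ∫⁻ x, ‖nlsCommutator p h n x‖ₑ ^ 2 ≤ 4 * ∫⁻ x, ‖h x‖ₑ ^ (2 * (p + 1)) :=
  (lintegral_mono fun _ => enorm_sub_sq_le _ _).trans (lintegral_dominating_le hp hh n)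

theorem locallyIntegrable_nlsNonlinearity {p : ℝ} (hp : 0 ≤ p) {h : R3 → ℂ}
    (hh : LocallyIntegrable h) (hfin : ∫⁻ x, ‖h x‖ₑ ^ (2 * (p + 1)) < ∞) :
    LocallyIntegrable fun y => nlsNonlinearity p (h y) := by
  have hFm : AEStronglyMeasurable (fun y => nlsNonlinearity p (h y)) volume :=
    (continuous_nlsNonlinearity hp).comp_aestronglyMeasurable hh.aestronglyMeasurable
  refine MemLp.locallyIntegrable (p := 2) ((memLp_two_iff_lintegral hFm).2 ?_) (by norm_num)
  simpa only [enorm_nlsNonlinearity_sq hp] using hfin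

theorem continuous_nlsCommutator {p : ℝ} (hp : 0 ≤ p) {h : R3 → ℂ} (hh : LocallyIntegrable h)
    (hfin : ∫⁻ x, ‖h x‖ₑ ^ (2 * (p + 1)) < ∞) (n : ℕ) : Continuous (nlsCommutator p h n) :=
  (contDiff_schwartzConv (locallyIntegrable_nlsNonlinearity hp hh hfin)
    (hasCompactSupport_mollifier n) (n := 0)).continuous.sub
    ((continuous_nlsNonlinearity hp).comp
      (contDiff_schwartzConv hh (hasCompactSupport_mollifier n) (n := 0)).continuous)

theorem tendsto_lintegral_nlsCommutator {p : ℝ} (hp : 0 ≤ p) {h : R3 → ℂ}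
    (hh : LocallyIntegrable h) (hfin : ∫⁻ x, ‖h x‖ₑ ^ (2 * (p + 1)) < ∞) :
    Tendsto (fun n => ∫⁻ x, ‖nlsCommutator p h n x‖ₑ ^ 2) atTop (𝓝 0) := by
  have hF := locallyIntegrable_nlsNonlinearity hp hh hfin
  set Φ := ∫⁻ x, ‖h x‖ₑ ^ (2 * (p + 1)) with hΦ
  set D : ℕ → R3 → ℝ≥0∞ := fun n x =>
    2 * ‖schwartzConv (fun y => nlsNonlinearity p (h y)) (mollifier n) x‖ₑ ^ 2 +
      2 * ‖nlsNonlinearity p (schwartzConv h (mollifier n) x)‖ₑ ^ 2 with hD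
  have hEc := continuous_nlsCommutator hp hh hfin
  have hEm : ∀ n, Measurable fun x => ‖nlsCommutator p h n x‖ₑ ^ 2 := fun n =>
    (hEc n).enorm.measurable.pow_const 2
  have hDm : ∀ n, Measurable (D n) := fun n =>
    (((contDiff_schwartzConv hF (hasCompactSupport_mollifier n)
      (n := 0)).continuous.enorm.measurable.pow_const 2).const_mul 2).add
    ((((continuous_nlsNonlinearity hp).comp (contDiff_schwartzConv hh
      (hasCompactSupport_mollifier n) (n := 0)).continuous).enorm.measurable.pow_const 2).const_mul 2)
  have hE4 : ∀ n, ∫⁻ x, ‖nlsCommutator p h n x‖ₑ ^ 2 ≤ 4 * Φ := lintegral_nlsCommutator_le hp hh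
  have h4 : 4 * Φ ≠ ∞ := ENNReal.mul_ne_top (by simp) hfin.ne
  have hlim : ∀ᵐ x, Tendsto (fun n => D n x - ‖nlsCommutator p h n x‖ₑ ^ 2) atTop
      (𝓝 (4 * ‖h x‖ₑ ^ (2 * (p + 1)))) := by
    filter_upwards [ae_tendsto_schwartzConv_mollifier hh,
      ae_tendsto_schwartzConv_mollifier hF] with x h1 h2
    have h3 := ((continuous_nlsNonlinearity hp).tendsto _).comp h1
    have h5 : Tendsto (fun n => ‖nlsCommutator p h n x‖ₑ ^ 2) atTop (𝓝 0) := by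
      have : Tendsto (fun n => nlsCommutator p h n x) atTop (𝓝 0) := by
        simpa [nlsCommutator] using h2.sub h3
      simpa using ENNReal.Tendsto.pow this.enorm (n := 2)
    have h6 : Tendsto (fun n => D n x) atTop (𝓝 (2 * ‖nlsNonlinearity p (h x)‖ₑ ^ 2 +
        2 * ‖nlsNonlinearity p (h x)‖ₑ ^ 2)) :=
      (ENNReal.Tendsto.const_mul (ENNReal.Tendsto.pow h2.enorm) (Or.inr (by simp))).add
        (ENNReal.Tendsto.const_mul (ENNReal.Tendsto.pow h3.enorm) (Or.inr (by simp)))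
    have h7 := ENNReal.Tendsto.sub h6 h5 (Or.inr (by simp))
    convert h7 using 2
    rw [tsub_zero, enorm_nlsNonlinearity_sq hp]; ring
  have hfatou : 4 * Φ ≤ liminf (fun n => 4 * Φ - ∫⁻ x, ‖nlsCommutator p h n x‖ₑ ^ 2) atTop := by
    calc 4 * Φ = ∫⁻ x, 4 * ‖h x‖ₑ ^ (2 * (p + 1)) := by
          rw [lintegral_const_mul' _ _ (by simp)]
      _ = ∫⁻ x, liminf (fun n => D n x - ‖nlsCommutator p h n x‖ₑ ^ 2) atTop := by
          apply lintegral_congr_ae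
          filter_upwards [hlim] with x hx
          exact hx.liminf_eq.symm
      _ ≤ liminf (fun n => ∫⁻ x, (D n x - ‖nlsCommutator p h n x‖ₑ ^ 2)) atTop :=
          lintegral_liminf_le fun n => (hDm n).sub (hEm n)
      _ ≤ _ := by
          refine liminf_le_liminf (Eventually.of_forall fun n => ?_)
          rw [lintegral_sub (hEm n) (ne_top_of_le_ne_top h4 (hE4 n))
            (ae_of_all _ fun x => enorm_sub_sq_le _ _)]
          gcongr
          exact lintegral_dominating_le hp hh n
  rw [ENNReal.tendsto_nhds_zero]
  intro ε hε
  rcases eq_or_ne (4 * Φ) 0 with h0 | h0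
  · exact Eventually.of_forall fun n => ((hE4 n).trans h0.le).trans hε.le
  have hlt : 4 * Φ - ε < 4 * Φ := ENNReal.sub_lt_self h4 h0 hε.ne'
  filter_upwards [eventually_lt_of_lt_liminf (hlt.trans_le hfatou)] with n hn
  by_contra hcon
  rw [not_le] at hcon
  exact absurd hn (not_lt.2 (tsub_le_tsub_left hcon.le _))

/-! ### Calculus of partial derivatives -/

theorem pd_add {j : Fin 3} {f g : R3 → ℝ} (hf : Differentiable ℝ f) (hg : Differentiable ℝ g)
    (x : R3) : pd j (fun x => f x + g x) x = pd j f x + pd j g x := by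
  simp only [pd]
  rw [fderiv_fun_add (hf x) (hg x)]; rfl

theorem pd_sub {j : Fin 3} {f g : R3 → ℝ} (hf : Differentiable ℝ f) (hg : Differentiable ℝ g)
    (x : R3) : pd j (fun x => f x - g x) x = pd j f x - pd j g x := by
  simp only [pd]
  rw [fderiv_fun_sub (hf x) (hg x)]; rfl

theorem pd_mul {j : Fin 3} {f g : R3 → ℝ} (hf : Differentiable ℝ f) (hg : Differentiable ℝ g)
    (x : R3) : pd j (fun x => f x * g x) x = f x * pd j g x + pd j f x * g x := by
  simp only [pd]
  rw [fderiv_fun_mul (hf x) (hg x)]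
  simp [mul_comm]

theorem pd_const_mul {j : Fin 3} {f : R3 → ℝ} (hf : Differentiable ℝ f) (c : ℝ)
    (x : R3) : pd j (fun x => c * f x) x = c * pd j f x := by
  simp only [pd]
  rw [fderiv_const_mul (hf x)]
  rfl

theorem pd_comp_smul {E : Type*} [NormedAddCommGroup E] [NormedSpace ℝ E] {f : R3 → E}
    (hf : Differentiable ℝ f) (a : ℝ) (j : Fin 3) (x : R3) :
    pd j (fun x => f (a • x)) x = a • pd j f (a • x) := by
  have h : HasFDerivAt (fun x : R3 => a • x) (a • ContinuousLinearMap.id ℝ R3) x :=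
    (hasFDerivAt_id x).const_smul a
  have := ((hf (a • x)).hasFDerivAt.comp x h).fderiv
  simp only [pd]
  rw [show (fun x => f (a • x)) = f ∘ (fun x : R3 => a • x) from rfl, this]
  simp

theorem contDiff_pd {E : Type*} [NormedAddCommGroup E] [NormedSpace ℝ E] {f : R3 → E} {n : ℕ}
    (hf : ContDiff ℝ (n + 1 : ℕ) f) (j : Fin 3) : ContDiff ℝ n (pd j f) := by
  have h : ContDiff ℝ n (fderiv ℝ f) := hf.fderiv_right (by norm_cast)
  exact h.clm_apply contDiff_const

theorem HasCompactSupport.pd {E : Type*} [NormedAddCommGroup E] [NormedSpace ℝ E] {f : R3 → E}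
    (hf : HasCompactSupport f) (j : Fin 3) : HasCompactSupport (pd j f) := by
  have h := (hf.fderiv ℝ).comp_left (g := fun L : R3 →L[ℝ] E => L (EuclideanSpace.single j 1))
    (by simp)
  exact h

theorem pd_apply_coord (j k : Fin 3) (x : R3) :
    pd j (fun x : R3 => x k) x = if k = j then 1 else 0 := by
  have h : HasFDerivAt (fun x : R3 => x k) (EuclideanSpace.proj (𝕜 := ℝ) k) x :=
    (EuclideanSpace.proj (𝕜 := ℝ) k : R3 →L[ℝ] ℝ).hasFDerivAt
  rw [pd, h.fderiv]
  simp

theorem hasFDerivAt_comp_norm_sq {f : ℝ → ℝ} {f' : ℝ} {x : R3} (hf : HasDerivAt f f' (‖x‖ ^ 2)) :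
    HasFDerivAt (fun x : R3 => f (‖x‖ ^ 2)) (f' • (2 • innerSL ℝ x)) x :=
  hf.comp_hasFDerivAt x (hasStrictFDerivAt_norm_sq x).hasFDerivAt

theorem pd_comp_norm_sq {f f' : ℝ → ℝ} (hf : ∀ s, 0 ≤ s → HasDerivAt f (f' s) s) (j : Fin 3)
    (x : R3) : pd j (fun x : R3 => f (‖x‖ ^ 2)) x = 2 * x j * f' (‖x‖ ^ 2) := by
  rw [pd, (hasFDerivAt_comp_norm_sq (hf _ (by positivity))).fderiv]
  simp [EuclideanSpace.inner_single_right]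
  ring

theorem differentiable_comp_norm_sq {f f' : ℝ → ℝ} (hf : ∀ s, 0 ≤ s → HasDerivAt f (f' s) s) :
    Differentiable ℝ fun x : R3 => f (‖x‖ ^ 2) := fun x =>
  (hasFDerivAt_comp_norm_sq (hf _ (by positivity))).differentiableAt

theorem differentiable_coord (k : Fin 3) : Differentiable ℝ fun x : R3 => x k :=
  (EuclideanSpace.proj (𝕜 := ℝ) k : R3 →L[ℝ] ℝ).differentiable

theorem pd_comp_norm_sq_mul_coord {f f' : ℝ → ℝ} (hf : ∀ s, 0 ≤ s → HasDerivAt f (f' s) s)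
    (j k : Fin 3) (x : R3) :
    pd j (fun x : R3 => f (‖x‖ ^ 2) * x k) x =
      f (‖x‖ ^ 2) * (if k = j then 1 else 0) + 2 * x j * f' (‖x‖ ^ 2) * x k := by
  rw [pd_mul (differentiable_comp_norm_sq hf) (differentiable_coord k), pd_apply_coord,
    pd_comp_norm_sq hf]

theorem norm_sq_eq_sum_coord (x : R3) : ‖x‖ ^ 2 = x 0 ^ 2 + x 1 ^ 2 + x 2 ^ 2 := by
  rw [EuclideanSpace.norm_sq_eq]
  simp [Fin.sum_univ_three]

/-! ### The cutoff -/

/-- A smooth cutoff that equals `1` on `(-∞, 1]` and `0` on `[4, ∞)`. -/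
noncomputable def cutoff (s : ℝ) : ℝ := Real.smoothTransition ((4 - s) / 3)

theorem contDiff_cutoff {n : ℕ∞} : ContDiff ℝ n cutoff :=
  Real.smoothTransition.contDiff.comp ((contDiff_const.sub contDiff_id).div_const 3)

theorem cutoff_of_le {s : ℝ} (hs : s ≤ 1) : cutoff s = 1 :=
  Real.smoothTransition.one_of_one_le (by linarith)

theorem cutoff_of_ge {s : ℝ} (hs : 4 ≤ s) : cutoff s = 0 :=
  Real.smoothTransition.zero_of_nonpos (by linarith)

theorem cutoff_nonneg (s : ℝ) : 0 ≤ cutoff s := Real.smoothTransition.nonneg _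

theorem cutoff_le_one (s : ℝ) : cutoff s ≤ 1 := Real.smoothTransition.le_one _

theorem iteratedDeriv_cutoff_eq_zero {n : ℕ} (hn : n ≠ 0) {s : ℝ} (hs : s < 1 ∨ 4 < s) :
    iteratedDeriv n cutoff s = 0 := by
  rcases hs with hs | hs
  · have h : cutoff =ᶠ[𝓝 s] fun _ => 1 := by
      filter_upwards [Iio_mem_nhds hs] with y hy
      exact cutoff_of_le (le_of_lt hy)
    rw [h.iteratedDeriv_eq n]
    simp [iteratedDeriv_const, hn]
  · have h : cutoff =ᶠ[𝓝 s] fun _ => 0 := by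
      filter_upwards [Ioi_mem_nhds hs] with y hy
      exact cutoff_of_ge (le_of_lt hy)
    rw [h.iteratedDeriv_eq n]
    simp

theorem hasDerivAt_iteratedDeriv_cutoff (n : ℕ) (s : ℝ) :
    HasDerivAt (iteratedDeriv n cutoff) (iteratedDeriv (n + 1) cutoff s) s := by
  have h : Differentiable ℝ (iteratedDeriv n cutoff) :=
    (contDiff_cutoff (n := ((n + 1 : ℕ) : ℕ∞))).differentiable_iteratedDeriv n (by norm_cast; simp)
  rw [iteratedDeriv_succ]
  exact (h s).hasDerivAt

theorem exists_bound_iteratedDeriv_cutoff :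
    ∃ B : ℝ, 0 < B ∧ ∀ n : ℕ, n = 1 ∨ n = 2 ∨ n = 3 → ∀ s, |iteratedDeriv n cutoff s| ≤ B := by
  have h : ∀ n : ℕ, n ≠ 0 → ∃ B : ℝ, ∀ s, |iteratedDeriv n cutoff s| ≤ B := by
    intro n hn
    have hc : Continuous (iteratedDeriv n cutoff) :=
      (contDiff_cutoff (n := (n : ℕ∞))).continuous_iteratedDeriv n (by norm_cast)
    obtain ⟨B, hB⟩ := (isCompact_Icc (a := (1 : ℝ)) (b := 4)).exists_bound_of_continuousOn
      hc.continuousOn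
    refine ⟨max B 0, fun s => ?_⟩
    by_cases hs : s ∈ Set.Icc (1 : ℝ) 4
    · exact (hB s hs).trans (le_max_left _ _)
    · rw [iteratedDeriv_cutoff_eq_zero hn]
      · simp
      · by_contra hcon
        push Not at hcon
        exact hs ⟨hcon.1, hcon.2⟩
  obtain ⟨B₁, h₁⟩ := h 1 (by simp)
  obtain ⟨B₂, h₂⟩ := h 2 (by simp)
  obtain ⟨B₃, h₃⟩ := h 3 (by simp)
  refine ⟨max 1 (max B₁ (max B₂ B₃)), by positivity, ?_⟩
  rintro n (rfl | rfl | rfl) s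
  · exact (h₁ s).trans (by simp)
  · exact (h₂ s).trans (by simp)
  · exact (h₃ s).trans (by simp)

/-! ### The truncated Morawetz multiplier -/

/-- The regularised inverse distance `(s + e)^{-1/2}`, as a function of the squared distance. -/
noncomputable def invDist (e s : ℝ) : ℝ := (s + e) ^ (-(1 / 2) : ℝ)

theorem invDist_pos {e s : ℝ} (he : 0 < e) (hs : 0 ≤ s) : 0 < invDist e s :=
  Real.rpow_pos_of_pos (by linarith) _

theorem invDist_sq_mul {e s : ℝ} (he : 0 < e) (hs : 0 ≤ s) : invDist e s ^ 2 * (s + e) = 1 := by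
  have h : 0 < s + e := by linarith
  rw [invDist, ← Real.rpow_natCast, ← Real.rpow_mul h.le]
  norm_num
  rw [Real.rpow_neg_one, inv_mul_cancel₀ h.ne']

theorem hasDerivAt_invDist {e s : ℝ} (he : 0 < e) (hs : 0 ≤ s) :
    HasDerivAt (invDist e) (-(1 / 2) * invDist e s ^ 3) s := by
  have h : 0 < s + e := by linarith
  have h1 : HasDerivAt (fun s => s + e) 1 s := (hasDerivAt_id s).add_const e
  have h2 := h1.rpow_const (p := (-(1 / 2) : ℝ)) (Or.inl h.ne')
  have h3 : HasDerivAt (invDist e) _ s := h2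
  refine h3.congr_deriv ?_
  simp only [invDist]
  rw [← Real.rpow_natCast, ← Real.rpow_mul h.le]
  norm_num

theorem invDist_le_one {e s : ℝ} (he : 0 < e) (hs : 1 ≤ s) : invDist e s ≤ 1 :=
  Real.rpow_le_one_of_one_le_of_nonpos (by linarith) (by norm_num)

/-- The radial profile of the multiplier. -/
noncomputable def multProfile (e s : ℝ) : ℝ := invDist e s * cutoff s

/-- The derivative of `multProfile`. -/
noncomputable def multProfileDeriv (e s : ℝ) : ℝ :=
  invDist e s * iteratedDeriv 1 cutoff s - 1 / 2 * invDist e s ^ 3 * cutoff s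

theorem hasDerivAt_cutoff (s : ℝ) : HasDerivAt cutoff (iteratedDeriv 1 cutoff s) s := by
  simpa using hasDerivAt_iteratedDeriv_cutoff 0 s

theorem hasDerivAt_multProfile {e s : ℝ} (he : 0 < e) (hs : 0 ≤ s) :
    HasDerivAt (multProfile e) (multProfileDeriv e s) s := by
  refine ((hasDerivAt_invDist he hs).mul (hasDerivAt_cutoff s)).congr_deriv ?_
  rw [multProfileDeriv]; ring

/-- The divergence of the multiplier, as a function of the squared distance. -/
noncomputable def multDiv (e s : ℝ) : ℝ :=
  cutoff s * (2 * invDist e s + e * invDist e s ^ 3) +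
    2 * s * iteratedDeriv 1 cutoff s * invDist e s

/-- The first derivative of `multDiv`. -/
noncomputable def multDivDeriv (e s : ℝ) : ℝ :=
  iteratedDeriv 1 cutoff s * (4 * invDist e s + e * invDist e s ^ 3 - s * invDist e s ^ 3) +
    2 * s * iteratedDeriv 2 cutoff s * invDist e s -
    cutoff s * (invDist e s ^ 3 + 3 / 2 * e * invDist e s ^ 5)

/-- The second derivative of `multDiv`. -/
noncomputable def multDivDerivDeriv (e s : ℝ) : ℝ :=
  iteratedDeriv 2 cutoff s * (4 * invDist e s + e * invDist e s ^ 3 - s * invDist e s ^ 3) +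
    iteratedDeriv 1 cutoff s * (4 * (-(1 / 2) * invDist e s ^ 3) +
      e * (3 * invDist e s ^ 2 * (-(1 / 2) * invDist e s ^ 3)) -
      (invDist e s ^ 3 + s * (3 * invDist e s ^ 2 * (-(1 / 2) * invDist e s ^ 3)))) +
    (2 * iteratedDeriv 2 cutoff s * invDist e s + 2 * s * iteratedDeriv 3 cutoff s * invDist e s +
      2 * s * iteratedDeriv 2 cutoff s * (-(1 / 2) * invDist e s ^ 3)) -
    (iteratedDeriv 1 cutoff s * (invDist e s ^ 3 + 3 / 2 * e * invDist e s ^ 5) +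
      cutoff s * (3 * invDist e s ^ 2 * (-(1 / 2) * invDist e s ^ 3) +
        3 / 2 * e * (5 * invDist e s ^ 4 * (-(1 / 2) * invDist e s ^ 3))))

theorem hasDerivAt_multDiv {e s : ℝ} (he : 0 < e) (hs : 0 ≤ s) :
    HasDerivAt (multDiv e) (multDivDeriv e s) s := by
  have hm := hasDerivAt_invDist he hs
  have h0 := hasDerivAt_cutoff s
  have h1 := hasDerivAt_iteratedDeriv_cutoff 1 s
  have := (h0.mul ((hm.const_mul 2).add ((hm.pow 3).const_mul e))).add
    ((((hasDerivAt_id s).const_mul 2).mul h1).mul hm)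
  refine this.congr_deriv ?_
  simp only [multDivDeriv, id, Pi.add_apply, Pi.pow_apply, Pi.mul_apply]
  norm_num
  ring

theorem hasDerivAt_multDivDeriv {e s : ℝ} (he : 0 < e) (hs : 0 ≤ s) :
    HasDerivAt (multDivDeriv e) (multDivDerivDeriv e s) s := by
  have hm := hasDerivAt_invDist he hs
  have h0 := hasDerivAt_cutoff s
  have h1 := hasDerivAt_iteratedDeriv_cutoff 1 s
  have h2 := hasDerivAt_iteratedDeriv_cutoff 2 s
  have := ((h1.mul (((hm.const_mul 4).add ((hm.pow 3).const_mul e)).sub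
      ((hasDerivAt_id s).mul (hm.pow 3)))).add
    ((((hasDerivAt_id s).const_mul 2).mul h2).mul hm)).sub
    (h0.mul ((hm.pow 3).add ((hm.pow 5).const_mul (3 / 2 * e))))
  refine this.congr_deriv ?_
  simp only [multDivDerivDeriv, id, Pi.add_apply, Pi.pow_apply, Pi.mul_apply, Pi.sub_apply]
  norm_num
  ring

theorem multDiv_eq {e s : ℝ} (he : 0 < e) (hs : 0 ≤ s) :
    3 * multProfile e s + 2 * s * multProfileDeriv e s = multDiv e s := by
  have h := invDist_sq_mul he hs
  simp only [multProfile, multProfileDeriv, multDiv]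
  linear_combination (-(invDist e s * cutoff s)) * h

theorem multDiv_lower {e s B : ℝ} (he : 0 < e) (hs : 0 ≤ s)
    (hB : ∀ s, |iteratedDeriv 1 cutoff s| ≤ B) : -(8 * B) ≤ multDiv e s := by
  have hm := invDist_pos he hs
  have hc := cutoff_nonneg s
  have hB0 : 0 ≤ B := (abs_nonneg _).trans (hB 0)
  have h1 : 0 ≤ cutoff s * (2 * invDist e s + e * invDist e s ^ 3) := by positivity
  rw [multDiv]
  by_cases h : s < 1 ∨ 4 < s
  · rw [iteratedDeriv_cutoff_eq_zero one_ne_zero h]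
    linarith
  · push Not at h
    have h2 : |2 * s * iteratedDeriv 1 cutoff s * invDist e s| ≤ 2 * 4 * B * 1 := by
      rw [abs_mul, abs_mul, abs_mul, abs_of_pos hm, abs_of_nonneg hs, abs_two]
      gcongr
      · exact h.2
      · exact hB s
      · exact invDist_le_one he h.1
    have := neg_abs_le (2 * s * iteratedDeriv 1 cutoff s * invDist e s)
    linarith

theorem multDiv_lower_of_le_one {e s : ℝ} (he : 0 < e) (hs : 0 ≤ s) (hs1 : s < 1) :
    2 * invDist e s ≤ multDiv e s := by
  have hm := invDist_pos he hs
  rw [multDiv, iteratedDeriv_cutoff_eq_zero one_ne_zero (Or.inl hs1), cutoff_of_le hs1.le]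
  have : 0 ≤ e * invDist e s ^ 3 := by positivity
  linarith

theorem multDiv_laplacian_le {e s B : ℝ} (he : 0 < e) (hs : 0 ≤ s)
    (hB : ∀ n : ℕ, n = 1 ∨ n = 2 ∨ n = 3 → ∀ s, |iteratedDeriv n cutoff s| ≤ B) :
    6 * multDivDeriv e s + 4 * s * multDivDerivDeriv e s ≤ 500 * B := by
  have hm := invDist_pos he hs
  have hc := cutoff_nonneg s
  have hB0 : 0 ≤ B := (abs_nonneg _).trans (hB 1 (by simp) 0)
  have hid := invDist_sq_mul he hs
  set m := invDist e s with hmdef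
  set y := e * m ^ 2 with hy
  have hy0 : 0 ≤ y := by positivity
  have hsm : s * m ^ 2 = 1 - y := by rw [hy]; linarith
  have hy1 : y ≤ 1 := by nlinarith [mul_nonneg hs (sq_nonneg m)]
  have key : 6 * multDivDeriv e s + 4 * s * multDivDerivDeriv e s =
      -(15 * y ^ 2 * m ^ 3 * cutoff s) +
      iteratedDeriv 1 cutoff s * (6 * m * (3 + 2 * y) - 4 * s * m ^ 3 * (5 / 2 + 9 / 2 * y)) +
      iteratedDeriv 2 cutoff s * (12 * s * m + 4 * s * m * (5 + 2 * y) - 4 * s ^ 2 * m ^ 3) +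
      iteratedDeriv 3 cutoff s * (8 * s ^ 2 * m) := by
    simp only [multDivDeriv, multDivDerivDeriv, ← hmdef]
    rw [hy]
    linear_combination (cutoff s * (15 * e * m ^ 5 + 6 * m ^ 3) +
      iteratedDeriv 1 cutoff s * (6 * s * m ^ 3 - 6 * m) -
      iteratedDeriv 2 cutoff s * (4 * s * m)) * hid
  rw [key]
  have h15 : 0 ≤ 15 * y ^ 2 * m ^ 3 * cutoff s := by positivity
  by_cases h : s < 1 ∨ 4 < s
  · rw [iteratedDeriv_cutoff_eq_zero (by simp) h, iteratedDeriv_cutoff_eq_zero (by simp) h,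
      iteratedDeriv_cutoff_eq_zero (by simp) h]
    linarith
  push Not at h
  have hm1 : m ≤ 1 := invDist_le_one he h.1
  have hm3 : m ^ 3 ≤ 1 := pow_le_one₀ hm.le hm1
  have hs2 : s ^ 2 ≤ 16 := by nlinarith [h.1, h.2]
  have hbound : ∀ n : ℕ, n = 1 ∨ n = 2 ∨ n = 3 → ∀ a A : ℝ, |a| ≤ A →
      iteratedDeriv n cutoff s * a ≤ B * A := by
    intro n hn a A ha
    calc _ ≤ |iteratedDeriv n cutoff s * a| := le_abs_self _
      _ = |iteratedDeriv n cutoff s| * |a| := abs_mul _ _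
      _ ≤ B * A := mul_le_mul (hB n hn s) ha (abs_nonneg _) hB0
  have e1 : 0 ≤ 6 * m * (3 + 2 * y) ∧ 6 * m * (3 + 2 * y) ≤ 6 * 1 * (3 + 2 * 1) :=
    ⟨by positivity, by gcongr⟩
  have e2 : 0 ≤ 4 * s * m ^ 3 * (5 / 2 + 9 / 2 * y) ∧
      4 * s * m ^ 3 * (5 / 2 + 9 / 2 * y) ≤ 4 * 4 * 1 * (5 / 2 + 9 / 2 * 1) :=
    ⟨by positivity, by gcongr; exact h.2⟩
  have e3 : 0 ≤ 12 * s * m ∧ 12 * s * m ≤ 12 * 4 * 1 := ⟨by positivity, by gcongr; exact h.2⟩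
  have e4 : 0 ≤ 4 * s * m * (5 + 2 * y) ∧ 4 * s * m * (5 + 2 * y) ≤ 4 * 4 * 1 * (5 + 2 * 1) :=
    ⟨by positivity, by gcongr; exact h.2⟩
  have e5 : 0 ≤ 4 * s ^ 2 * m ^ 3 ∧ 4 * s ^ 2 * m ^ 3 ≤ 4 * 16 * 1 :=
    ⟨by positivity, by gcongr⟩
  have e6 : 0 ≤ 8 * s ^ 2 * m ∧ 8 * s ^ 2 * m ≤ 8 * 16 * 1 := ⟨by positivity, by gcongr⟩
  have b1 := hbound 1 (by simp) (6 * m * (3 + 2 * y) - 4 * s * m ^ 3 * (5 / 2 + 9 / 2 * y)) 112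
    (abs_le.2 ⟨by linarith [e1.1, e2.2], by linarith [e1.2, e2.1]⟩)
  have b2 := hbound 2 (by simp) (12 * s * m + 4 * s * m * (5 + 2 * y) - 4 * s ^ 2 * m ^ 3) 160
    (abs_le.2 ⟨by linarith [e3.1, e4.1, e5.2], by linarith [e3.2, e4.2, e5.1]⟩)
  have b3 := hbound 3 (by simp) (8 * s ^ 2 * m) 128
    (abs_le.2 ⟨by linarith [e6.1], by linarith [e6.2]⟩)
  linarith

theorem multProfile_quadratic_lower {e B : ℝ} (he : 0 < e) (hB : ∀ s, |iteratedDeriv 1 cutoff s| ≤ B)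
    (x : R3) (a : Fin 3 → ℝ) :
    -(8 * B) * (a 0 ^ 2 + a 1 ^ 2 + a 2 ^ 2) ≤
      multProfile e (‖x‖ ^ 2) * (a 0 ^ 2 + a 1 ^ 2 + a 2 ^ 2) +
        2 * multProfileDeriv e (‖x‖ ^ 2) * (x 0 * a 0 + x 1 * a 1 + x 2 * a 2) ^ 2 := by
  have hB0 : 0 ≤ B := (abs_nonneg _).trans (hB 0)
  have hcs : (x 0 * a 0 + x 1 * a 1 + x 2 * a 2) ^ 2 ≤ ‖x‖ ^ 2 * (a 0 ^ 2 + a 1 ^ 2 + a 2 ^ 2) := by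
    rw [norm_sq_eq_sum_coord]
    nlinarith [sq_nonneg (x 0 * a 1 - x 1 * a 0), sq_nonneg (x 0 * a 2 - x 2 * a 0),
      sq_nonneg (x 1 * a 2 - x 2 * a 1)]
  have hs : 0 ≤ ‖x‖ ^ 2 := by positivity
  set s := ‖x‖ ^ 2
  set q := (x 0 * a 0 + x 1 * a 1 + x 2 * a 2) ^ 2
  set A := a 0 ^ 2 + a 1 ^ 2 + a 2 ^ 2
  have hq : 0 ≤ q := sq_nonneg _
  have hA : 0 ≤ A := by positivity
  have hm := invDist_pos he hs
  have hid := invDist_sq_mul he hs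
  have hc := cutoff_nonneg s
  set m := invDist e s with hmdef
  have h1 : 0 ≤ cutoff s * (m * A - m ^ 3 * q) := by
    refine mul_nonneg hc ?_
    have h2 : m ^ 2 * q ≤ A := by
      calc m ^ 2 * q ≤ m ^ 2 * (s * A) := by gcongr
        _ = (1 - m ^ 2 * e) * A := by rw [← hid]; ring
        _ ≤ 1 * A := by gcongr; linarith [mul_nonneg (sq_nonneg m) he.le]
        _ = A := one_mul A
    nlinarith [mul_le_mul_of_nonneg_left h2 hm.le]
  have h3 : -(8 * B) * A ≤ 2 * iteratedDeriv 1 cutoff s * m * q := by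
    by_cases h : s < 1 ∨ 4 < s
    · rw [iteratedDeriv_cutoff_eq_zero one_ne_zero h]
      nlinarith [mul_nonneg hB0 hA]
    · push Not at h
      have h2 : |2 * iteratedDeriv 1 cutoff s * m * q| ≤ 2 * B * 1 * (4 * A) := by
        rw [abs_mul, abs_mul, abs_mul, abs_of_pos hm, abs_of_nonneg hq, abs_two]
        gcongr
        · exact hB s
        · exact invDist_le_one he h.1
        · exact hcs.trans (by gcongr; exact h.2)
      have := neg_abs_le (2 * iteratedDeriv 1 cutoff s * m * q)
      linarith
  have : multProfile e s * A + 2 * multProfileDeriv e s * q =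
      cutoff s * (m * A - m ^ 3 * q) + 2 * iteratedDeriv 1 cutoff s * m * q := by
    simp only [multProfile, multProfileDeriv, ← hmdef]; ring
  rw [this]
  linarith

/-- The divergence of a vector field. -/
noncomputable def vdiv (X : Fin 3 → R3 → ℝ) (x : R3) : ℝ := ∑ k, pd k (X k) x

/-- The properties of the vector field `X` that the localised Morawetz inequality uses: it is a
bounded smooth regularisation (at scale `δ`) of `x / |x|`, cut off at distance `2 R`. -/
structure IsMorawetzMultiplier (c R δ : ℝ) (X : Fin 3 → R3 → ℝ) : Prop where
  contDiff : ∀ k, ContDiff ℝ ((⊤ : ℕ∞) : WithTop ℕ∞) (X k)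
  eq_zero : ∀ k x, 2 * R ≤ ‖x‖ → X k x = 0
  abs_le : ∀ k x, |X k x| ≤ c
  quadratic_lower : ∀ (x : R3) (v : Fin 3 → ℂ), -(c / R) * ∑ j, ‖v j‖ ^ 2 ≤
    ∑ j, ∑ k, pd j (X k) x * ((v k).re * (v j).re + (v k).im * (v j).im)
  laplacian_vdiv_le : ∀ x, ∑ j, pd j (pd j (vdiv X)) x ≤ c / R ^ 3
  vdiv_lower : ∀ x, -(c / R) ≤ vdiv X x
  vdiv_lower_of_lt : ∀ x, ‖x‖ < R → 2 * (‖x‖ ^ 2 + δ ^ 2) ^ (-(1 / 2) : ℝ) ≤ vdiv X x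

theorem contDiff_invDist_norm_sq {e : ℝ} (he : 0 < e) {n : ℕ∞} :
    ContDiff ℝ n fun x : R3 => invDist e (‖x‖ ^ 2) := by
  have h : ContDiff ℝ n fun x : R3 => ‖x‖ ^ 2 + e := (contDiff_norm_sq ℝ).add contDiff_const
  exact h.rpow_const_of_ne fun x => by positivity

theorem isMorawetzMultiplier_unit {B δ : ℝ} (hδ : 0 < δ)
    (hB : ∀ n : ℕ, n = 1 ∨ n = 2 ∨ n = 3 → ∀ s, |iteratedDeriv n cutoff s| ≤ B) :
    IsMorawetzMultiplier (500 * B + 1) 1 δ fun k x => multProfile (δ ^ 2) (‖x‖ ^ 2) * x k := by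
  have he : 0 < δ ^ 2 := by positivity
  have hB0 : 0 ≤ B := (abs_nonneg _).trans (hB 1 (by simp) 0)
  have hB1 := hB 1 (by simp)
  have hP : ∀ s, 0 ≤ s → HasDerivAt (multProfile (δ ^ 2)) (multProfileDeriv (δ ^ 2) s) s :=
    fun s hs => hasDerivAt_multProfile he hs
  have hD : ∀ s, 0 ≤ s → HasDerivAt (multDiv (δ ^ 2)) (multDivDeriv (δ ^ 2) s) s :=
    fun s hs => hasDerivAt_multDiv he hs
  have hD' : ∀ s, 0 ≤ s → HasDerivAt (multDivDeriv (δ ^ 2)) (multDivDerivDeriv (δ ^ 2) s) s :=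
    fun s hs => hasDerivAt_multDivDeriv he hs
  have hdiv : (vdiv fun k x => multProfile (δ ^ 2) (‖x‖ ^ 2) * x k) =
      fun x => multDiv (δ ^ 2) (‖x‖ ^ 2) := by
    funext x
    rw [← multDiv_eq he (by positivity), vdiv]
    simp only [pd_comp_norm_sq_mul_coord hP, Fin.sum_univ_three]
    simp
    linear_combination (-2 * multProfileDeriv (δ ^ 2) (‖x‖ ^ 2)) * norm_sq_eq_sum_coord x
  have hpd : ∀ j, (pd j fun x : R3 => multDiv (δ ^ 2) (‖x‖ ^ 2)) =
      fun x => 2 * (multDivDeriv (δ ^ 2) (‖x‖ ^ 2) * x j) := by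
    intro j
    funext x
    rw [pd_comp_norm_sq hD]; ring
  refine ⟨fun k => ?_, fun k x hx => ?_, fun k x => ?_, fun x v => ?_, fun x => ?_, fun x => ?_,
    fun x hx => ?_⟩
  · exact ((contDiff_invDist_norm_sq he).mul (contDiff_cutoff.comp (contDiff_norm_sq ℝ))).mul
      (EuclideanSpace.proj (𝕜 := ℝ) k : R3 →L[ℝ] ℝ).contDiff
  · rw [multProfile, cutoff_of_ge (by nlinarith)]; simp
  · have hs : 0 ≤ ‖x‖ ^ 2 := by positivity
    have hm := invDist_pos he hs
    have hid := invDist_sq_mul he hs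
    have h1 : invDist (δ ^ 2) (‖x‖ ^ 2) * |x k| ≤ 1 := by
      have h2 : |x k| ≤ ‖x‖ := PiLp.norm_apply_le x k
      have h3 : (invDist (δ ^ 2) (‖x‖ ^ 2) * ‖x‖) ^ 2 ≤ 1 := by
        rw [mul_pow]; nlinarith [mul_nonneg (sq_nonneg (invDist (δ ^ 2) (‖x‖ ^ 2))) he.le]
      have h4 := (sq_le_one_iff₀ (by positivity)).1 h3
      exact (by gcongr : _ ≤ invDist (δ ^ 2) (‖x‖ ^ 2) * ‖x‖).trans h4
    rw [multProfile, abs_mul, abs_mul, abs_of_pos hm, abs_of_nonneg (cutoff_nonneg _)]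
    calc _ = cutoff (‖x‖ ^ 2) * (invDist (δ ^ 2) (‖x‖ ^ 2) * |x k|) := by ring
      _ ≤ 1 * 1 := by
        gcongr
        exact cutoff_le_one _
      _ ≤ _ := by linarith
  · have h1 := multProfile_quadratic_lower he hB1 x fun j => (v j).re
    have h2 := multProfile_quadratic_lower he hB1 x fun j => (v j).im
    simp only [pd_comp_norm_sq_mul_coord hP, Fin.sum_univ_three, Complex.sq_norm,
      Complex.normSq_apply]
    simp
    have h3 : 0 ≤ (492 * B + 1) * ((v 0).re * (v 0).re + (v 0).im * (v 0).im +
      ((v 1).re * (v 1).re + (v 1).im * (v 1).im) +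
      ((v 2).re * (v 2).re + (v 2).im * (v 2).im)) := by
      refine mul_nonneg (by linarith) ?_
      nlinarith [sq_nonneg (v 0).re, sq_nonneg (v 0).im, sq_nonneg (v 1).re, sq_nonneg (v 1).im,
        sq_nonneg (v 2).re, sq_nonneg (v 2).im]
    linarith
  · simp only [hdiv, hpd]
    have hd : Differentiable ℝ fun x : R3 => multDivDeriv (δ ^ 2) (‖x‖ ^ 2) :=
      differentiable_comp_norm_sq hD'
    have : ∀ j : Fin 3, pd j (fun x : R3 => 2 * (multDivDeriv (δ ^ 2) (‖x‖ ^ 2) * x j)) x =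
        2 * (multDivDeriv (δ ^ 2) (‖x‖ ^ 2) +
          2 * x j * multDivDerivDeriv (δ ^ 2) (‖x‖ ^ 2) * x j) := by
      intro j
      rw [pd_const_mul (f := fun x : R3 => multDivDeriv (δ ^ 2) (‖x‖ ^ 2) * x j)
        (hd.mul (differentiable_coord j)), pd_comp_norm_sq_mul_coord hD']
      simp
    simp only [this, Fin.sum_univ_three]
    have h1 := multDiv_laplacian_le he (by positivity : 0 ≤ ‖x‖ ^ 2) hB
    have h2 : ∀ d : ℝ, 4 * ‖x‖ ^ 2 * d = 4 * (x 0 ^ 2 + x 1 ^ 2 + x 2 ^ 2) * d := by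
      intro d; rw [norm_sq_eq_sum_coord]
    rw [h2] at h1
    norm_num
    linarith
  · rw [hdiv]
    have := multDiv_lower he (by positivity : 0 ≤ ‖x‖ ^ 2) hB1
    norm_num
    linarith
  · rw [hdiv]
    exact multDiv_lower_of_le_one he (by positivity) (by nlinarith [norm_nonneg x])

theorem IsMorawetzMultiplier.scale {c δ R : ℝ} {X : Fin 3 → R3 → ℝ} (hR : 0 < R) (hδ : 0 < δ)
    (h : IsMorawetzMultiplier c 1 (δ / R) X) :
    IsMorawetzMultiplier c R δ fun k x => X k (R⁻¹ • x) := by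
  have hX : ∀ k, ContDiff ℝ (3 : ℕ) (X k) := fun k => contDiff_infty.1 (h.contDiff k) 3
  have hpd : ∀ j k, (pd j fun x => X k (R⁻¹ • x)) = fun x => R⁻¹ * pd j (X k) (R⁻¹ • x) := by
    intro j k; funext x
    exact pd_comp_smul ((hX k).differentiable (by norm_num)) _ _ _
  have hd1 : ∀ k j, ContDiff ℝ (2 : ℕ) (pd j (X k)) := fun k j => contDiff_pd (hX k) j
  have hdv : ContDiff ℝ (2 : ℕ) (vdiv X) := by
    unfold vdiv
    exact ContDiff.sum fun k _ => hd1 k k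
  have hdiv : (vdiv fun k x => X k (R⁻¹ • x)) = fun x => R⁻¹ * vdiv X (R⁻¹ • x) := by
    funext x
    simp only [vdiv, hpd, Finset.mul_sum]
  have hsm : Differentiable ℝ fun x : R3 => R⁻¹ • x := differentiable_id.const_smul R⁻¹
  have hpdiv : ∀ j, (pd j fun x => R⁻¹ * vdiv X (R⁻¹ • x)) =
      fun x => R⁻¹ * (R⁻¹ * pd j (vdiv X) (R⁻¹ • x)) := by
    intro j; funext x
    have hv : Differentiable ℝ (vdiv X) := hdv.differentiable (by norm_num)
    rw [pd_const_mul (f := fun x => vdiv X (R⁻¹ • x)) (hv.comp hsm), pd_comp_smul hv]; rfl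
  have hppdiv : ∀ j x, pd j (fun x => R⁻¹ * (R⁻¹ * pd j (vdiv X) (R⁻¹ • x))) x =
      R⁻¹ * (R⁻¹ * (R⁻¹ * pd j (pd j (vdiv X)) (R⁻¹ • x))) := by
    intro j x
    have hv : Differentiable ℝ (pd j (vdiv X)) := (contDiff_pd hdv j).differentiable (by norm_num)
    rw [pd_const_mul (f := fun x => R⁻¹ * pd j (vdiv X) (R⁻¹ • x)) ((hv.comp hsm).const_mul R⁻¹),
      pd_const_mul (f := fun x => pd j (vdiv X) (R⁻¹ • x)) (hv.comp hsm), pd_comp_smul hv]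
    rfl
  have hnorm : ∀ x : R3, ‖R⁻¹ • x‖ = ‖x‖ / R := by
    intro x; rw [norm_smul, Real.norm_of_nonneg (by positivity)]; field_simp
  refine ⟨fun k => ?_, fun k x hx => ?_, fun k x => h.abs_le k _, fun x v => ?_, fun x => ?_,
    fun x => ?_, fun x hx => ?_⟩
  · exact (h.contDiff k).comp (contDiff_id.const_smul R⁻¹)
  · exact h.eq_zero k _ (by rw [hnorm, le_div_iff₀ hR]; linarith)
  · simp only [hpd]
    have h1 := mul_le_mul_of_nonneg_left (h.quadratic_lower (R⁻¹ • x) v) (inv_nonneg.2 hR.le)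
    simp only [Finset.mul_sum] at h1 ⊢
    calc _ = ∑ i, R⁻¹ * (-(c / 1) * ‖v i‖ ^ 2) := by
          refine Finset.sum_congr rfl fun i _ => ?_
          field_simp
      _ ≤ _ := h1
      _ = _ := by simp only [mul_assoc]
  · simp only [hdiv, hpdiv, hppdiv, ← Finset.mul_sum]
    have h1 := h.laplacian_vdiv_le (R⁻¹ • x)
    calc _ ≤ R⁻¹ * (R⁻¹ * (R⁻¹ * (c / 1 ^ 3))) := by gcongr
      _ = _ := by field_simp
  · simp only [hdiv]
    calc -(c / R) = R⁻¹ * -(c / 1) := by field_simp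
      _ ≤ _ := by gcongr; exact h.vdiv_lower _
  · simp only [hdiv]
    have h1 := h.vdiv_lower_of_lt (R⁻¹ • x) (by rw [hnorm, div_lt_one hR]; exact hx)
    calc 2 * (‖x‖ ^ 2 + δ ^ 2) ^ (-(1 / 2) : ℝ) =
          R⁻¹ * (2 * (‖R⁻¹ • x‖ ^ 2 + (δ / R) ^ 2) ^ (-(1 / 2) : ℝ)) := by
          rw [hnorm, show (‖x‖ / R) ^ 2 + (δ / R) ^ 2 = (‖x‖ ^ 2 + δ ^ 2) * (R⁻¹) ^ 2 by
            field_simp, Real.mul_rpow (by positivity) (by positivity), ← Real.rpow_natCast R⁻¹,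
            ← Real.rpow_mul (by positivity)]
          norm_num
          rw [Real.rpow_neg_one, inv_inv]
          field_simp
      _ ≤ _ := by gcongr

theorem exists_morawetz_multiplier :
    ∃ c : ℝ, 0 < c ∧ ∀ R δ : ℝ, 0 < R → 0 < δ → ∃ X, IsMorawetzMultiplier c R δ X := by
  obtain ⟨B, hB0, hB⟩ := exists_bound_iteratedDeriv_cutoff
  exact ⟨500 * B + 1, by positivity, fun R δ hR hδ =>
    ⟨_, (isMorawetzMultiplier_unit (div_pos hδ hR) hB).scale hR hδ⟩⟩

/-! ### The fixed-time Morawetz identity -/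

theorem pd_pd_comm {f : R3 → ℝ} (hf : ContDiff ℝ (2 : ℕ) f) (j k : Fin 3) (x : R3) :
    pd j (pd k f) x = pd k (pd j f) x := by
  have h : ∀ i l : Fin 3, pd i (pd l f) x =
      fderiv ℝ (fderiv ℝ f) x (EuclideanSpace.single i 1) (EuclideanSpace.single l 1) := by
    intro i l
    have hd : DifferentiableAt ℝ (fderiv ℝ f) x :=
      (hf.fderiv_right (m := 1) (by norm_num)).differentiable (by norm_num) x
    have := (hd.hasFDerivAt.clm_apply (hasFDerivAt_const (EuclideanSpace.single l (1 : ℝ)) x)).fderiv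
    rw [pd, show pd l f = fun y => fderiv ℝ f y (EuclideanSpace.single l 1) from rfl, this]
    simp
  rw [h, h]
  exact (hf.contDiffAt.isSymmSndFDerivAt (by simp)) _ _

theorem integral_pd_eq_zero {f : R3 → ℝ} (hf : ContDiff ℝ (1 : ℕ) f) (hc : HasCompactSupport f)
    (j : Fin 3) : ∫ x, pd j f x = 0 := by
  have h := integral_mul_fderiv_eq_neg_fderiv_mul_of_integrable (μ := (volume : Measure R3))
    (f := fun _ : R3 => (1 : ℝ)) (g := f) (v := EuclideanSpace.single j 1)
    (by simp)
    (by
      simp only [one_mul]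
      exact (contDiff_pd (n := 0) hf j).continuous.integrable_of_hasCompactSupport (hc.pd j))
    (by simpa using hf.continuous.integrable_of_hasCompactSupport hc)
    (fun x _ => differentiableAt_const _) (fun x _ => hf.differentiable (by norm_num) x)
  simp only [one_mul, fderiv_const_apply, zero_apply, zero_mul,
    integral_zero, neg_zero] at h
  exact h

theorem pd_const (j : Fin 3) (c : ℝ) (x : R3) : pd j (fun _ => c) x = 0 := by
  simp [pd]

/-- The momentum flux whose divergence appears in the Morawetz identity. -/
noncomputable def morawetzFlux (p : ℝ) (X : Fin 3 → R3 → ℝ) (d : R3 → ℝ) (d' : Fin 3 → R3 → ℝ)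
    (a b h₁ h₂ G : R3 → ℝ) (a' b' : Fin 3 → R3 → ℝ) (j : Fin 3) (x : R3) : ℝ :=
  X j x * (a x * h₁ x + b x * h₂ x) - d x * (a x * a' j x + b x * b' j x) +
    1 / 2 * (d' j x * (a x * a x + b x * b x)) -
    2 * (X 0 x * (a' 0 x * a' j x + b' 0 x * b' j x) + X 1 x * (a' 1 x * a' j x + b' 1 x * b' j x) +
      X 2 x * (a' 2 x * a' j x + b' 2 x * b' j x)) +
    X j x * (a' 0 x * a' 0 x + b' 0 x * b' 0 x + (a' 1 x * a' 1 x + b' 1 x * b' 1 x) +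
      (a' 2 x * a' 2 x + b' 2 x * b' 2 x)) +
    2 / (p + 2) * (X j x * G x)

theorem sum_pd_morawetzFlux {p : ℝ} (hp : p + 2 ≠ 0) {X d' a' b' : Fin 3 → R3 → ℝ}
    {d a b h₁ h₂ G : R3 → ℝ} (hX : ∀ k, Differentiable ℝ (X k)) (hd : Differentiable ℝ d)
    (hd' : ∀ k, Differentiable ℝ (d' k)) (ha : Differentiable ℝ a) (hb : Differentiable ℝ b)
    (hh₁ : Differentiable ℝ h₁) (hh₂ : Differentiable ℝ h₂) (hG : Differentiable ℝ G)
    (ha' : ∀ k, Differentiable ℝ (a' k)) (hb' : ∀ k, Differentiable ℝ (b' k))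
    (hpd : ∀ j, pd j d = d' j) (hpa : ∀ j, pd j a = a' j) (hpb : ∀ j, pd j b = b' j) (x : R3)
    (hsa : ∀ j k, pd j (a' k) x = pd k (a' j) x) (hsb : ∀ j k, pd j (b' k) x = pd k (b' j) x)
    (hdX : d x = ∑ k, pd k (X k) x) {P : ℝ} (hGP : G x = P * (a x * a x + b x * b x))
    (hpG : ∀ j, pd j G x = (p + 2) * P * (a x * a' j x + b x * b' j x)) :
    ∑ j, pd j (morawetzFlux p X d d' a b h₁ h₂ G a' b' j) x =
      (∑ k, X k x * (a x * pd k h₁ x + b x * pd k h₂ x - h₁ x * a' k x - h₂ x * b' k x)) -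
      (2 * (∑ j, ∑ k, pd j (X k) x * (a' k x * a' j x + b' k x * b' j x)) -
        1 / 2 * (∑ j, pd j (d' j) x) * (a x * a x + b x * b x) + p / (p + 2) * d x * G x +
        d x * (a x * ((∑ j, pd j (a' j) x) - P * a x - h₁ x) +
          b x * ((∑ j, pd j (b' j) x) - P * b x - h₂ x)) +
        2 * ∑ k, X k x * (a' k x * ((∑ j, pd j (a' j) x) - P * a x - h₁ x) +
          b' k x * ((∑ j, pd j (b' j) x) - P * b x - h₂ x))) := by
  have key : ∀ j, pd j (morawetzFlux p X d d' a b h₁ h₂ G a' b' j) x =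
      X j x * (a x * pd j h₁ x + a' j x * h₁ x + (b x * pd j h₂ x + b' j x * h₂ x)) +
      pd j (X j) x * (a x * h₁ x + b x * h₂ x) -
      (d x * (a x * pd j (a' j) x + a' j x * a' j x + (b x * pd j (b' j) x + b' j x * b' j x)) +
        d' j x * (a x * a' j x + b x * b' j x)) +
      1 / 2 * (d' j x * (a x * a' j x + a' j x * a x + (b x * b' j x + b' j x * b x)) +
        pd j (d' j) x * (a x * a x + b x * b x)) -
      2 * (∑ k, (X k x * (a' k x * pd j (a' j) x + pd j (a' k) x * a' j x +
        (b' k x * pd j (b' j) x + pd j (b' k) x * b' j x)) +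
        pd j (X k) x * (a' k x * a' j x + b' k x * b' j x))) +
      (X j x * (∑ k, (a' k x * pd j (a' k) x + pd j (a' k) x * a' k x +
        (b' k x * pd j (b' k) x + pd j (b' k) x * b' k x))) +
       pd j (X j) x * (∑ k, (a' k x * a' k x + b' k x * b' k x))) +
      2 / (p + 2) * (X j x * ((p + 2) * P * (a x * a' j x + b x * b' j x)) +
        pd j (X j) x * G x) := by
    intro j
    unfold morawetzFlux
    simp (disch := fun_prop) only [pd_add, pd_sub, pd_mul, pd_const, hpd, hpa, hpb, hpG,
      Fin.sum_univ_three, zero_mul, add_zero]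
  simp only [key, Fin.sum_univ_three] at hdX ⊢
  rw [hsa 1 0, hsa 2 0, hsa 2 1, hsb 1 0, hsb 2 0, hsb 2 1, hGP, hdX]
  field_simp
  ring

theorem pd_re {f : R3 → ℂ} (hf : Differentiable ℝ f) (j : Fin 3) :
    (pd j fun x => (f x).re) = fun x => (pd j f x).re := by
  funext x
  have := (Complex.reCLM.hasFDerivAt.comp x (hf x).hasFDerivAt).fderiv
  rw [pd, show (fun x => (f x).re) = Complex.reCLM ∘ f from rfl, this]
  rfl

theorem pd_im {f : R3 → ℂ} (hf : Differentiable ℝ f) (j : Fin 3) :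
    (pd j fun x => (f x).im) = fun x => (pd j f x).im := by
  funext x
  have := (Complex.imCLM.hasFDerivAt.comp x (hf x).hasFDerivAt).fderiv
  rw [pd, show (fun x => (f x).im) = Complex.imCLM ∘ f from rfl, this]
  rfl

theorem rpow_norm_eq_rpow_re_im (z : ℂ) (r : ℝ) :
    ‖z‖ ^ r = (z.re * z.re + z.im * z.im) ^ (r / 2) := by
  rw [← Complex.normSq_apply, Complex.normSq_eq_norm_sq, ← Real.rpow_natCast,
    ← Real.rpow_mul (norm_nonneg _)]
  congr 1
  push_cast
  ring

/-- The left-hand side of the fixed-time Morawetz identity. -/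
noncomputable def morawetzDensity (X : Fin 3 → R3 → ℝ) (w H : R3 → ℂ) (x : R3) : ℝ :=
  ∑ k, X k x * ((w x).re * (pd k H x).re + (w x).im * (pd k H x).im -
    (H x).re * (pd k w x).re - (H x).im * (pd k w x).im)

/-- The right-hand side of the fixed-time Morawetz identity. -/
noncomputable def morawetzBulk (p : ℝ) (X : Fin 3 → R3 → ℝ) (w E : R3 → ℂ) (x : R3) : ℝ :=
  2 * (∑ j, ∑ k, pd j (X k) x *
      ((pd k w x).re * (pd j w x).re + (pd k w x).im * (pd j w x).im)) -
    1 / 2 * (∑ j, pd j (pd j (vdiv X)) x) * ‖w x‖ ^ 2 + p / (p + 2) * vdiv X x * ‖w x‖ ^ (p + 2) +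
    vdiv X x * ((w x).re * (E x).re + (w x).im * (E x).im) +
    2 * ∑ k, X k x * ((pd k w x).re * (E x).re + (pd k w x).im * (E x).im)

theorem morawetz_identity {p : ℝ} (hp : 0 < p) {X : Fin 3 → R3 → ℝ}
    (hX : ∀ k, ContDiff ℝ ((⊤ : ℕ∞) : WithTop ℕ∞) (X k)) (hXc : ∀ k, HasCompactSupport (X k))
    {w H : R3 → ℂ} (hw : ContDiff ℝ (2 : ℕ) w) (hH : ContDiff ℝ (1 : ℕ) H) {E : R3 → ℂ}
    (hE : ∀ x, E x = (∑ j, pd j (pd j w) x) - nlsNonlinearity p (w x) - H x) :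
    Integrable (morawetzBulk p X w E) ∧
      ∫ x, morawetzDensity X w H x = ∫ x, morawetzBulk p X w E x := by
  have hX' : ∀ k, ContDiff ℝ (3 : ℕ) (X k) := fun k => contDiff_infty.1 (hX k) 3
  have hd : ContDiff ℝ (2 : ℕ) (vdiv X) := ContDiff.sum fun k _ => contDiff_pd (hX' k) k
  have hdc : HasCompactSupport (vdiv X) := by
    have : vdiv X = fun x => pd 0 (X 0) x + pd 1 (X 1) x + pd 2 (X 2) x := by
      funext x; rw [vdiv, Fin.sum_univ_three]
    rw [this]
    exact (((hXc 0).pd 0).add ((hXc 1).pd 1)).add ((hXc 2).pd 2)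
  have hd' : ∀ j, ContDiff ℝ (1 : ℕ) (pd j (vdiv X)) := fun j => contDiff_pd hd j
  have ha : ContDiff ℝ (2 : ℕ) fun x => (w x).re := Complex.reCLM.contDiff.comp hw
  have hb : ContDiff ℝ (2 : ℕ) fun x => (w x).im := Complex.imCLM.contDiff.comp hw
  have hh₁ : ContDiff ℝ (1 : ℕ) fun x => (H x).re := Complex.reCLM.contDiff.comp hH
  have hh₂ : ContDiff ℝ (1 : ℕ) fun x => (H x).im := Complex.imCLM.contDiff.comp hH
  have hwd : Differentiable ℝ w := hw.differentiable (by norm_num)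
  have hHd : Differentiable ℝ H := hH.differentiable (by norm_num)
  have hw' : ∀ j, ContDiff ℝ (1 : ℕ) (pd j w) := fun j => contDiff_pd hw j
  have ha' : ∀ j, ContDiff ℝ (1 : ℕ) fun x => (pd j w x).re := fun j =>
    Complex.reCLM.contDiff.comp (hw' j)
  have hb' : ∀ j, ContDiff ℝ (1 : ℕ) fun x => (pd j w x).im := fun j =>
    Complex.imCLM.contDiff.comp (hw' j)
  have hQ : ContDiff ℝ (1 : ℕ) fun x => (w x).re * (w x).re + (w x).im * (w x).im :=
    ((ha.mul ha).add (hb.mul hb)).of_le (by norm_num)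
  have hG : ContDiff ℝ (1 : ℕ) fun x => ((w x).re * (w x).re + (w x).im * (w x).im) ^
      ((p + 2) / 2) :=
    (Real.contDiff_rpow_const_of_le (by push_cast; linarith)).comp hQ
  have hX1 : ∀ k, ContDiff ℝ (1 : ℕ) (X k) := fun k => (hX' k).of_le (by norm_num)
  have hd1 : ContDiff ℝ (1 : ℕ) (vdiv X) := hd.of_le (by norm_num)
  have ha1 : ContDiff ℝ (1 : ℕ) fun x => (w x).re := ha.of_le (by norm_num)
  have hb1 : ContDiff ℝ (1 : ℕ) fun x => (w x).im := hb.of_le (by norm_num)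
  set Θ := morawetzFlux p X (vdiv X) (fun j => pd j (vdiv X)) (fun x => (w x).re)
    (fun x => (w x).im) (fun x => (H x).re) (fun x => (H x).im)
    (fun x => ((w x).re * (w x).re + (w x).im * (w x).im) ^ ((p + 2) / 2))
    (fun j x => (pd j w x).re) (fun j x => (pd j w x).im) with hΘ
  have hΘ1 : ∀ j, ContDiff ℝ (1 : ℕ) (Θ j) := by
    intro j
    rw [hΘ]
    unfold morawetzFlux
    have := hX1 0
    have := hX1 1
    have := hX1 2
    have := hX1 j
    have := hd' j
    have := ha' 0
    have := ha' 1
    have := ha' 2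
    have := hb' 0
    have := hb' 1
    have := hb' 2
    have := ha' j
    have := hb' j
    fun_prop
  have hΘc : ∀ j, HasCompactSupport (Θ j) := by
    intro j
    rw [hΘ]
    unfold morawetzFlux
    exact ((((((hXc j).mul_right).sub (hdc.mul_right)).add ((hdc.pd j).mul_right).mul_left).sub
      ((((hXc 0).mul_right).add ((hXc 1).mul_right)).add ((hXc 2).mul_right)).mul_left).add
      ((hXc j).mul_right)).add ((hXc j).mul_right).mul_left
  have hid : ∀ x, ∑ j, pd j (Θ j) x = morawetzDensity X w H x - morawetzBulk p X w E x := by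
    intro x
    have h0 : 0 ≤ (w x).re * (w x).re + (w x).im * (w x).im := by nlinarith
    have h := sum_pd_morawetzFlux (p := p) (by linarith : p + 2 ≠ 0) (X := X) (d := vdiv X)
      (d' := fun j => pd j (vdiv X)) (a := fun x => (w x).re) (b := fun x => (w x).im)
      (h₁ := fun x => (H x).re) (h₂ := fun x => (H x).im)
      (G := fun x => ((w x).re * (w x).re + (w x).im * (w x).im) ^ ((p + 2) / 2))
      (a' := fun j x => (pd j w x).re) (b' := fun j x => (pd j w x).im)
      (fun k => (hX1 k).differentiable (by norm_num)) (hd.differentiable (by norm_num))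
      (fun k => (hd' k).differentiable (by norm_num)) (ha.differentiable (by norm_num))
      (hb.differentiable (by norm_num)) (hh₁.differentiable (by norm_num))
      (hh₂.differentiable (by norm_num)) (hG.differentiable (by norm_num))
      (fun k => (ha' k).differentiable (by norm_num))
      (fun k => (hb' k).differentiable (by norm_num)) (fun j => rfl) (pd_re hwd) (pd_im hwd) x
      (fun j k => by rw [← pd_re hwd, ← pd_re hwd]; exact pd_pd_comm ha j k x)
      (fun j k => by rw [← pd_im hwd, ← pd_im hwd]; exact pd_pd_comm hb j k x) rfl
      (P := ((w x).re * (w x).re + (w x).im * (w x).im) ^ (p / 2))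
      (by
        have hpp : (p + 2) / 2 = p / 2 + 1 := by ring
        rw [hpp, Real.rpow_add' h0 (by positivity), Real.rpow_one])
      (fun j => by
        have hq : HasFDerivAt (fun x => (w x).re * (w x).re + (w x).im * (w x).im)
          (fderiv ℝ (fun x => (w x).re * (w x).re + (w x).im * (w x).im) x) x :=
          (hQ.differentiable (by norm_num) x).hasFDerivAt
        have h1 := (hq.rpow_const (p := (p + 2) / 2) (Or.inr (by linarith))).fderiv
        rw [pd, h1, show (p + 2) / 2 - 1 = p / 2 by ring]
        have h2 : fderiv ℝ (fun x => (w x).re * (w x).re + (w x).im * (w x).im) x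
            (EuclideanSpace.single j 1) =
            2 * ((w x).re * (pd j w x).re + (w x).im * (pd j w x).im) := by
          change pd j (fun x => (w x).re * (w x).re + (w x).im * (w x).im) x = _
          have d1 := ha.differentiable (by norm_num)
          have d2 := hb.differentiable (by norm_num)
          rw [pd_add (f := fun x => (w x).re * (w x).re) (g := fun x => (w x).im * (w x).im)
            (d1.mul d1) (d2.mul d2), pd_mul d1 d1, pd_mul d2 d2, pd_re hwd, pd_im hwd]
          ring
        rw [smul_apply, h2, smul_eq_mul]
        ring)
    rw [hΘ, h, morawetzDensity, morawetzBulk]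
    have e1 : (E x).re = (∑ j, pd j (fun x => (pd j w x).re) x) -
        ((w x).re * (w x).re + (w x).im * (w x).im) ^ (p / 2) * (w x).re - (H x).re := by
      rw [hE, nlsNonlinearity, rpow_norm_eq_rpow_re_im]
      simp [pd_re ((hw' _).differentiable (by norm_num))]
    have e2 : (E x).im = (∑ j, pd j (fun x => (pd j w x).im) x) -
        ((w x).re * (w x).re + (w x).im * (w x).im) ^ (p / 2) * (w x).im - (H x).im := by
      rw [hE, nlsNonlinearity, rpow_norm_eq_rpow_re_im]
      simp [pd_im ((hw' _).differentiable (by norm_num))]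
    rw [e1, e2, rpow_norm_eq_rpow_re_im, Complex.sq_norm, Complex.normSq_apply]
    simp only [pd_re hHd, pd_im hHd]
  have hL : Integrable (morawetzDensity X w H) := by
    refine Continuous.integrable_of_hasCompactSupport ?_ ?_
    · unfold morawetzDensity
      refine continuous_finsetSum _ fun k _ => ?_
      have := (contDiff_pd (n := 0) hH k).continuous
      have := (hw' k).continuous
      have := (hX1 k).continuous
      have := hw.continuous
      have := hH.continuous
      fun_prop
    · unfold morawetzDensity
      simp only [Fin.sum_univ_three]
      exact (((hXc 0).mul_right).add ((hXc 1).mul_right)).add ((hXc 2).mul_right)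
  have hΘi : ∀ j, Integrable (pd j (Θ j)) := fun j =>
    (contDiff_pd (n := 0) (hΘ1 j) j).continuous.integrable_of_hasCompactSupport ((hΘc j).pd j)
  have hB : morawetzBulk p X w E =
      fun x => morawetzDensity X w H x - ∑ j, pd j (Θ j) x := by
    funext x; rw [hid]; ring
  have hs : Integrable fun x => ∑ j, pd j (Θ j) x := integrable_finsetSum _ fun j _ => hΘi j
  refine ⟨hB ▸ hL.sub hs, ?_⟩
  rw [hB, integral_sub hL hs, integral_finsetSum _ fun j _ => hΘi j]
  simp [integral_pd_eq_zero (hΘ1 _) (hΘc _)]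

/-! ### Evolution of the localised momentum of the mollified solution -/

theorem weak_formulation_of_subset {u F : ℝ → R3 → ℂ} {A B t₀ : ℝ} (ht₀ : t₀ ∈ Set.Icc A B)
    (hF : MemLp (Function.uncurry F) 2 ((volume.restrict (Set.Icc A B)).prod volume))
    {g : R3 → ℂ} (hg : IsFourierTransform (u t₀) g)
    (hD : ∀ t ∈ Set.Icc A B, ∀ φ : 𝓢(R3, ℂ), ∫ x, u t x * φ x =
      (∫ x, u t₀ x * freeEvolution (t - t₀) φ x) -
        Complex.I * ∫ s in t₀..t, ∫ x, F s x * freeEvolution (t - s) φ x)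
    (φ : 𝓢(R3, ℂ)) {a t : ℝ} (ha : a ∈ Set.Icc A B) (ht : t ∈ Set.Icc A B) :
    IntervalIntegrable (fun τ => (∫ x, u τ x * schwartzGenerator φ x) -
        Complex.I * ∫ x, F τ x * φ x) volume a t ∧
      ∫ x, u t x * φ x = (∫ x, u a x * φ x) +
        ∫ τ in a..t, ((∫ x, u τ x * schwartzGenerator φ x) -
          Complex.I * ∫ x, F τ x * φ x) := by
  obtain ⟨i1, e1⟩ := weak_formulation ht₀ hF hg hD φ ha
  obtain ⟨i2, e2⟩ := weak_formulation ht₀ hF hg hD φ ht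
  refine ⟨i1.symm.trans i2, ?_⟩
  rw [e1, e2, ← intervalIntegral.integral_interval_sub_left i2 i1]
  ring

/-- The time derivative (divided by `i`) of the convolution with `ψ` of a solution of
`i∂ₜh + Δh = f`. -/
noncomputable def convRate (h f : R3 → ℂ) (ψ : 𝓢(R3, ℂ)) (x : R3) : ℂ :=
  -(Complex.I * schwartzConv h (schwartzGenerator ψ) x) - schwartzConv f ψ x

theorem contDiff_pd_top {f : R3 → ℂ} (hf : ContDiff ℝ ((⊤ : ℕ∞) : WithTop ℕ∞) f) (j : Fin 3) :
    ContDiff ℝ ((⊤ : ℕ∞) : WithTop ℕ∞) (pd j f) :=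
  contDiff_infty.2 fun n => contDiff_pd (contDiff_infty.1 hf (n + 1)) j

theorem convRate_eq {h f : R3 → ℂ} (hh : LocallyIntegrable h) {ψ : 𝓢(R3, ℂ)}
    (hψ : HasCompactSupport ψ) (x : R3) :
    convRate h f ψ x = (∑ j, pd j (pd j (schwartzConv h ψ)) x) - schwartzConv f ψ x := by
  rw [convRate, schwartzConv_generator hh hψ, ← mul_assoc, Complex.I_mul_I]
  ring

theorem contDiff_convRate {h f : R3 → ℂ} (hh : LocallyIntegrable h) (hf : LocallyIntegrable f)
    {ψ : 𝓢(R3, ℂ)} (hψ : HasCompactSupport ψ) :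
    ContDiff ℝ ((⊤ : ℕ∞) : WithTop ℕ∞) (convRate h f ψ) := by
  have : convRate h f ψ =
      fun x => (∑ j, pd j (pd j (schwartzConv h ψ)) x) - schwartzConv f ψ x :=
    funext (convRate_eq hh hψ)
  rw [this]
  exact (ContDiff.sum fun j _ => contDiff_pd_top (contDiff_pd_top
    (contDiff_schwartzConv hh hψ) j) j).sub (contDiff_schwartzConv hf hψ)

theorem pd_pd_comm_complex {f : R3 → ℂ} (hf : ContDiff ℝ (2 : ℕ) f) (j k : Fin 3) (x : R3) :
    pd j (pd k f) x = pd k (pd j f) x := by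
  have hd : Differentiable ℝ f := hf.differentiable (by norm_num)
  have hd' : ∀ l, Differentiable ℝ (pd l f) := fun l =>
    (contDiff_pd (n := 1) hf l).differentiable (by norm_num)
  have hr : ContDiff ℝ (2 : ℕ) fun x => (f x).re := Complex.reCLM.contDiff.comp hf
  have hi : ContDiff ℝ (2 : ℕ) fun x => (f x).im := Complex.imCLM.contDiff.comp hf
  apply Complex.ext
  · have := pd_pd_comm hr j k x
    rw [pd_re hd, pd_re hd, pd_re (hd' _), pd_re (hd' _)] at this
    exact this
  · have := pd_pd_comm hi j k x
    rw [pd_im hd, pd_im hd, pd_im (hd' _), pd_im (hd' _)] at this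
    exact this

theorem schwartzGenerator_schwartzPd (k : Fin 3) (ψ : 𝓢(R3, ℂ)) :
    schwartzGenerator (schwartzPd k ψ) = schwartzPd k (schwartzGenerator ψ) := by
  have hc : ∀ (j l : Fin 3) (φ : 𝓢(R3, ℂ)),
      schwartzPd j (schwartzPd l φ) = schwartzPd l (schwartzPd j φ) := by
    intro j l φ
    ext x
    rw [schwartzPd_apply, schwartzPd_apply,
      show (schwartzPd l φ : R3 → ℂ) = pd l φ from funext (schwartzPd_apply l φ),
      show (schwartzPd j φ : R3 → ℂ) = pd j φ from funext (schwartzPd_apply j φ)]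
    exact pd_pd_comm_complex (φ.smooth 2) j l x
  have hsum : ∀ φ : 𝓢(R3, ℂ),
      schwartzGenerator φ = Complex.I • ∑ j, schwartzPd j (schwartzPd j φ) := by
    intro φ
    ext x
    rw [schwartzGenerator_eq_sum]
    simp
  rw [hsum, hsum]
  have hlin : schwartzPd k (Complex.I • ∑ j, schwartzPd j (schwartzPd j ψ)) =
      Complex.I • ∑ j, schwartzPd k (schwartzPd j (schwartzPd j ψ)) := by
    simp only [schwartzPd, LineDeriv.lineDerivOp_smul, LineDeriv.lineDerivOp_sum]
  rw [hlin]
  congr 1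
  refine Finset.sum_congr rfl fun j _ => ?_
  rw [hc j k ψ, hc j k]

theorem hasCompactSupport_schwartzGenerator {ψ : 𝓢(R3, ℂ)} (hψ : HasCompactSupport ψ) :
    HasCompactSupport (schwartzGenerator ψ) := by
  have : (schwartzGenerator ψ : R3 → ℂ) = fun x => Complex.I * (schwartzPd 0 (schwartzPd 0 ψ) x +
      schwartzPd 1 (schwartzPd 1 ψ) x + schwartzPd 2 (schwartzPd 2 ψ) x) := by
    funext x
    rw [schwartzGenerator_eq_sum, Fin.sum_univ_three]
  rw [this]
  exact ((((hψ.schwartzPd 0).schwartzPd 0).add ((hψ.schwartzPd 1).schwartzPd 1)).add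
    ((hψ.schwartzPd 2).schwartzPd 2)).mul_left

theorem pd_convRate {h f : R3 → ℂ} (hh : LocallyIntegrable h) (hf : LocallyIntegrable f)
    {ψ : 𝓢(R3, ℂ)} (hψ : HasCompactSupport ψ) (k : Fin 3) :
    pd k (convRate h f ψ) = convRate h f (schwartzPd k ψ) := by
  funext x
  have h1 : Differentiable ℝ (schwartzConv h (schwartzGenerator ψ)) :=
    (contDiff_schwartzConv hh (hasCompactSupport_schwartzGenerator hψ) (n := 1)).differentiable (by norm_num)
  have h2 : Differentiable ℝ (schwartzConv f ψ) :=
    (contDiff_schwartzConv hf hψ (n := 1)).differentiable (by norm_num)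
  have e1 : pd k (convRate h f ψ) x =
      -(Complex.I * pd k (schwartzConv h (schwartzGenerator ψ)) x) - pd k (schwartzConv f ψ) x := by
    have := (((h1 x).hasFDerivAt.const_mul Complex.I).neg.sub (h2 x).hasFDerivAt).fderiv
    rw [pd, show convRate h f ψ = fun x => -(Complex.I * schwartzConv h (schwartzGenerator ψ) x) -
      schwartzConv f ψ x from rfl]
    erw [this]
    rfl
  rw [e1, pd_schwartzConv hh (hasCompactSupport_schwartzGenerator hψ), pd_schwartzConv hf hψ, convRate,
    schwartzGenerator_schwartzPd]

theorem intervalIntegrable_product_rule {α β α' β' : ℝ → ℂ} {a b : ℝ} (hab : a ≤ b)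
    (hα' : IntervalIntegrable α' volume a b) (hβ' : IntervalIntegrable β' volume a b)
    (hα : ∀ t ∈ Set.Icc a b, α t = α a + ∫ s in a..t, α' s)
    (hβ : ∀ t ∈ Set.Icc a b, β t = β a + ∫ s in a..t, β' s) :
    IntervalIntegrable (fun s => α' s * β s + α s * β' s) volume a b := by
  have hc : ∀ {γ γ' : ℝ → ℂ}, IntervalIntegrable γ' volume a b →
      (∀ t ∈ Set.Icc a b, γ t = γ a + ∫ s in a..t, γ' s) → ContinuousOn γ (Set.uIcc a b) := by
    intro γ γ' hi he
    have h1 : ContinuousOn (fun t => γ a + ∫ s in a..t, γ' s) (Set.uIcc a b) :=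
      continuousOn_const.add (intervalIntegral.continuousOn_primitive_interval' hi
        Set.left_mem_uIcc)
    refine h1.congr fun t ht => ?_
    rw [Set.uIcc_of_le hab] at ht
    exact he t ht
  exact (hα'.mul_continuousOn (hc hβ' hβ)).add (hβ'.continuousOn_mul (hc hα' hα))

/-- The density of the momentum of the mollification of `h` along the vector field `X`. -/
noncomputable def momentumDensity (X : Fin 3 → R3 → ℝ) (h : R3 → ℂ) (ρ : 𝓢(R3, ℂ)) (x : R3) : ℝ :=
  ∑ k, X k x * ((schwartzConv h ρ x).re * (schwartzConv h (schwartzPd k ρ) x).im -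
    (schwartzConv h ρ x).im * (schwartzConv h (schwartzPd k ρ) x).re)

/-- The time derivative of `momentumDensity`. -/
noncomputable def momentumRate (X : Fin 3 → R3 → ℝ) (h f : R3 → ℂ) (ρ : 𝓢(R3, ℂ)) (x : R3) : ℝ :=
  ∑ k, X k x * ((schwartzConv h ρ x).re * (convRate h f (schwartzPd k ρ) x).re +
    (schwartzConv h ρ x).im * (convRate h f (schwartzPd k ρ) x).im -
    (convRate h f ρ x).re * (schwartzConv h (schwartzPd k ρ) x).re -
    (convRate h f ρ x).im * (schwartzConv h (schwartzPd k ρ) x).im)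

theorem momentumRate_eq {X : Fin 3 → R3 → ℝ} {h f : R3 → ℂ} (hh : LocallyIntegrable h)
    (hf : LocallyIntegrable f) {ρ : 𝓢(R3, ℂ)} (hρ : HasCompactSupport ρ) :
    momentumRate X h f ρ = morawetzDensity X (schwartzConv h ρ) (convRate h f ρ) := by
  funext x
  simp only [momentumRate, morawetzDensity, pd_convRate hh hf hρ, pd_schwartzConv hh hρ]

theorem momentumDensity_sub {u F : ℝ → R3 → ℂ} {a b : ℝ} (hab : a ≤ b)
    (hw : ∀ (φ : 𝓢(R3, ℂ)), ∀ t ∈ Set.Icc a b,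
      IntervalIntegrable (fun τ => (∫ x, u τ x * schwartzGenerator φ x) -
        Complex.I * ∫ x, F τ x * φ x) volume a t ∧
      ∫ x, u t x * φ x = (∫ x, u a x * φ x) +
        ∫ τ in a..t, ((∫ x, u τ x * schwartzGenerator φ x) - Complex.I * ∫ x, F τ x * φ x))
    (X : Fin 3 → R3 → ℝ) (ρ : 𝓢(R3, ℂ)) (x : R3) :
    momentumDensity X (u b) ρ x - momentumDensity X (u a) ρ x =
      ∫ s in a..b, momentumRate X (u s) (F s) ρ x := by
  have hconv : ∀ ψ : 𝓢(R3, ℂ), ∀ t ∈ Set.Icc a b,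
      IntervalIntegrable (fun s => Complex.I * convRate (u s) (F s) ψ x) volume a t ∧
      schwartzConv (u t) ψ x = schwartzConv (u a) ψ x +
        ∫ s in a..t, Complex.I * convRate (u s) (F s) ψ x := by
    intro ψ t ht
    have h := hw (schwartzReflect ψ x) t ht
    simp only [schwartzGenerator_schwartzReflect, schwartzReflect_apply] at h
    have e : ∀ s, Complex.I * convRate (u s) (F s) ψ x =
        (∫ y, u s y * schwartzGenerator ψ (x - y)) - Complex.I * ∫ y, F s y * ψ (x - y) := by
      intro s
      rw [convRate, schwartzConv, schwartzConv]
      linear_combination (-∫ y, u s y * schwartzGenerator ψ (x - y)) * Complex.I_mul_I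
    simp only [e]
    exact h
  have hb : b ∈ Set.Icc a b := ⟨hab, le_rfl⟩
  have hconj : ∀ {γ : ℝ → ℂ} {t : ℝ}, IntervalIntegrable γ volume a t →
      IntervalIntegrable (fun s => (starRingEnd ℂ) (γ s)) volume a t ∧
      (starRingEnd ℂ) (∫ s in a..t, γ s) = ∫ s in a..t, (starRingEnd ℂ) (γ s) := by
    intro γ t hγ
    have h := (Complex.conjCLE : ℂ →L[ℝ] ℂ).intervalIntegral_comp_comm hγ
    refine ⟨?_, by simpa using h.symm⟩
    exact ⟨(Complex.conjCLE : ℂ →L[ℝ] ℂ).integrable_comp hγ.1,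
      (Complex.conjCLE : ℂ →L[ℝ] ℂ).integrable_comp hγ.2⟩
  have hpr : ∀ k : Fin 3, IntervalIntegrable (fun s =>
        (starRingEnd ℂ) (Complex.I * convRate (u s) (F s) ρ x) *
          schwartzConv (u s) (schwartzPd k ρ) x +
        (starRingEnd ℂ) (schwartzConv (u s) ρ x) *
          (Complex.I * convRate (u s) (F s) (schwartzPd k ρ) x)) volume a b ∧
      ∫ s in a..b, ((starRingEnd ℂ) (Complex.I * convRate (u s) (F s) ρ x) *
          schwartzConv (u s) (schwartzPd k ρ) x +
        (starRingEnd ℂ) (schwartzConv (u s) ρ x) *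
          (Complex.I * convRate (u s) (F s) (schwartzPd k ρ) x)) =
      (starRingEnd ℂ) (schwartzConv (u b) ρ x) * schwartzConv (u b) (schwartzPd k ρ) x -
      (starRingEnd ℂ) (schwartzConv (u a) ρ x) * schwartzConv (u a) (schwartzPd k ρ) x := by
    intro k
    have hα : ∀ t ∈ Set.Icc a b, (starRingEnd ℂ) (schwartzConv (u t) ρ x) =
        (starRingEnd ℂ) (schwartzConv (u a) ρ x) +
          ∫ s in a..t, (starRingEnd ℂ) (Complex.I * convRate (u s) (F s) ρ x) := by
      intro t ht
      rw [(hconv ρ t ht).2, map_add, (hconj (hconv ρ t ht).1).2]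
    have hα' := (hconj (hconv ρ b hb).1).1
    have hβ := fun t ht => (hconv (schwartzPd k ρ) t ht).2
    have hβ' := (hconv (schwartzPd k ρ) b hb).1
    exact ⟨intervalIntegrable_product_rule hab hα' hβ' hα hβ,
      integral_product_rule hab hα' hβ' hα hβ⟩
  have him : ∀ k : Fin 3, IntervalIntegrable (fun s => X k x *
      ((schwartzConv (u s) ρ x).re * (convRate (u s) (F s) (schwartzPd k ρ) x).re +
      (schwartzConv (u s) ρ x).im * (convRate (u s) (F s) (schwartzPd k ρ) x).im -
      (convRate (u s) (F s) ρ x).re * (schwartzConv (u s) (schwartzPd k ρ) x).re -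
      (convRate (u s) (F s) ρ x).im * (schwartzConv (u s) (schwartzPd k ρ) x).im)) volume a b ∧
      ∫ s in a..b, X k x *
      ((schwartzConv (u s) ρ x).re * (convRate (u s) (F s) (schwartzPd k ρ) x).re +
      (schwartzConv (u s) ρ x).im * (convRate (u s) (F s) (schwartzPd k ρ) x).im -
      (convRate (u s) (F s) ρ x).re * (schwartzConv (u s) (schwartzPd k ρ) x).re -
      (convRate (u s) (F s) ρ x).im * (schwartzConv (u s) (schwartzPd k ρ) x).im) =
      X k x * ((schwartzConv (u b) ρ x).re * (schwartzConv (u b) (schwartzPd k ρ) x).im -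
        (schwartzConv (u b) ρ x).im * (schwartzConv (u b) (schwartzPd k ρ) x).re) -
      X k x * ((schwartzConv (u a) ρ x).re * (schwartzConv (u a) (schwartzPd k ρ) x).im -
        (schwartzConv (u a) ρ x).im * (schwartzConv (u a) (schwartzPd k ρ) x).re) := by
    intro k
    obtain ⟨hi, he⟩ := hpr k
    have h1 := Complex.imCLM.intervalIntegral_comp_comm hi
    have h2 : IntervalIntegrable (fun s => Complex.imCLM
        ((starRingEnd ℂ) (Complex.I * convRate (u s) (F s) ρ x) *
          schwartzConv (u s) (schwartzPd k ρ) x +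
        (starRingEnd ℂ) (schwartzConv (u s) ρ x) *
          (Complex.I * convRate (u s) (F s) (schwartzPd k ρ) x))) volume a b :=
      ⟨Complex.imCLM.integrable_comp hi.1, Complex.imCLM.integrable_comp hi.2⟩
    rw [he] at h1
    have e : ∀ s, Complex.imCLM ((starRingEnd ℂ) (Complex.I * convRate (u s) (F s) ρ x) *
          schwartzConv (u s) (schwartzPd k ρ) x +
        (starRingEnd ℂ) (schwartzConv (u s) ρ x) *
          (Complex.I * convRate (u s) (F s) (schwartzPd k ρ) x)) =
      (schwartzConv (u s) ρ x).re * (convRate (u s) (F s) (schwartzPd k ρ) x).re +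
      (schwartzConv (u s) ρ x).im * (convRate (u s) (F s) (schwartzPd k ρ) x).im -
      (convRate (u s) (F s) ρ x).re * (schwartzConv (u s) (schwartzPd k ρ) x).re -
      (convRate (u s) (F s) ρ x).im * (schwartzConv (u s) (schwartzPd k ρ) x).im := by
      intro s
      simp
      ring
    simp only [e] at h1 h2
    refine ⟨h2.const_mul _, ?_⟩
    rw [intervalIntegral.integral_const_mul, h1, ← mul_sub]
    simp
    left
    ring
  simp only [momentumDensity, momentumRate]
  rw [intervalIntegral.integral_finsetSum fun k _ => (him k).1, ← Finset.sum_sub_distrib]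
  exact Finset.sum_congr rfl fun k _ => (him k).2.symm

/-! ### Integration of the momentum balance in space -/

theorem enorm_schwartzConv_le {q q' : ℝ} (hq : q.HolderConjugate q') {h : R3 → ℂ}
    (hh : AEStronglyMeasurable h) (ψ : 𝓢(R3, ℂ)) (x : R3) :
    ‖schwartzConv h ψ x‖ₑ ≤
      (∫⁻ y, ‖h y‖ₑ ^ q) ^ (1 / q) * (∫⁻ y, ‖ψ y‖ₑ ^ q') ^ (1 / q') := by
  have hm : AEMeasurable (fun y => ‖ψ (x - y)‖ₑ) :=
    (ψ.continuous.comp (continuous_const.sub continuous_id)).enorm.measurable.aemeasurable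
  calc ‖schwartzConv h ψ x‖ₑ ≤ ∫⁻ y, ‖h y * ψ (x - y)‖ₑ := enorm_integral_le_lintegral_enorm _
    _ = ∫⁻ y, ((fun y => ‖h y‖ₑ) * fun y => ‖ψ (x - y)‖ₑ) y := by simp [enorm_mul]
    _ ≤ (∫⁻ y, ‖h y‖ₑ ^ q) ^ (1 / q) * (∫⁻ y, ‖ψ (x - y)‖ₑ ^ q') ^ (1 / q') :=
      ENNReal.lintegral_mul_le_Lp_mul_Lq _ hq hh.enorm hm
    _ = _ := by rw [lintegral_sub_left_eq_self (fun y => ‖ψ y‖ₑ ^ q') x]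

theorem lintegral_rpow_schwartz_lt_top {q : ℝ} (hq : 0 < q) (ψ : 𝓢(R3, ℂ)) :
    ∫⁻ y, ‖ψ y‖ₑ ^ q < ∞ := by
  have h := lintegral_rpow_enorm_lt_top_of_eLpNorm_lt_top (p := ENNReal.ofReal q) (f := ψ)
    (μ := (volume : Measure R3)) (by simpa using hq) ENNReal.ofReal_ne_top
    (ψ.memLp _ _).eLpNorm_lt_top
  rwa [ENNReal.toReal_ofReal hq.le] at h

theorem exists_norm_schwartzConv_le {q : ℝ} (hq : 1 < q) {B : ℝ≥0∞} (hB : B ≠ ∞) (ψ : 𝓢(R3, ℂ)) :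
    ∃ K : ℝ, 0 ≤ K ∧ ∀ h : R3 → ℂ, AEStronglyMeasurable h → ∫⁻ y, ‖h y‖ₑ ^ q ≤ B →
      ∀ x, ‖schwartzConv h ψ x‖ ≤ K := by
  have hc := Real.HolderConjugate.conjExponent hq
  set K := B ^ (1 / q) * (∫⁻ y, ‖ψ y‖ₑ ^ q.conjExponent) ^ (1 / q.conjExponent) with hK
  have hKt : K ≠ ∞ := ENNReal.mul_ne_top (ENNReal.rpow_ne_top_of_nonneg (by positivity) hB)
    (ENNReal.rpow_ne_top_of_nonneg (one_div_nonneg.2 hc.symm.nonneg)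
      (lintegral_rpow_schwartz_lt_top hc.symm.pos ψ).ne)
  refine ⟨K.toReal, ENNReal.toReal_nonneg, fun h hh hle x => ?_⟩
  rw [← toReal_enorm]
  refine ENNReal.toReal_mono hKt ((enorm_schwartzConv_le hc hh ψ x).trans ?_)
  rw [hK]
  gcongr

theorem exists_norm_schwartzConv_le_of_memLp_two (ψ : 𝓢(R3, ℂ)) :
    ∃ K : ℝ, 0 ≤ K ∧ ∀ f : R3 → ℂ, MemLp f 2 volume →
      ∀ x, ‖schwartzConv f ψ x‖ ≤ K * (1 + (∫⁻ y, ‖f y‖ₑ ^ 2).toReal) := by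
  set K := (∫⁻ y, ‖ψ y‖ₑ ^ (2 : ℝ)) ^ (1 / 2 : ℝ) with hK
  have hKt : K ≠ ∞ := ENNReal.rpow_ne_top_of_nonneg (by norm_num)
    (lintegral_rpow_schwartz_lt_top two_pos ψ).ne
  refine ⟨K.toReal, ENNReal.toReal_nonneg, fun f hf x => ?_⟩
  have h2 := (memLp_two_iff_lintegral hf.1).1 hf
  have h := enorm_schwartzConv_le (by constructor <;> norm_num : (2 : ℝ).HolderConjugate 2) hf.1 ψ x
  simp only [ENNReal.rpow_two] at h hK
  rw [← hK] at h
  set y := ∫⁻ y, ‖f y‖ₑ ^ 2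
  have h3 : y ^ (1 / 2 : ℝ) ≤ 1 + y := by
    calc y ^ (1 / 2 : ℝ) ≤ (1 + y) ^ (1 / 2 : ℝ) := by gcongr; exact le_add_self
      _ ≤ (1 + y) ^ (1 : ℝ) := ENNReal.rpow_le_rpow_of_exponent_le le_self_add (by norm_num)
      _ = 1 + y := ENNReal.rpow_one _
  rw [← toReal_enorm]
  have h4 : K.toReal * (1 + y.toReal) = ((1 + y) * K).toReal := by
    rw [ENNReal.toReal_mul, ENNReal.toReal_add ENNReal.one_ne_top h2.ne, ENNReal.toReal_one,
      mul_comm]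
  rw [h4]
  exact ENNReal.toReal_mono (ENNReal.mul_ne_top (ENNReal.add_ne_top.2 ⟨ENNReal.one_ne_top, h2.ne⟩)
    hKt) (h.trans (by gcongr))

theorem aestronglyMeasurable_schwartzConv {μ : Measure ℝ} [SFinite μ] {h : ℝ → R3 → ℂ}
    (hh : AEStronglyMeasurable (Function.uncurry h) (μ.prod volume)) (ψ : 𝓢(R3, ℂ)) :
    AEStronglyMeasurable (fun z : ℝ × R3 => schwartzConv (h z.1) ψ z.2) (μ.prod volume) := by
  have h1 := aestronglyMeasurable_comp_fst_fst (Y := R3) (ν := volume) hh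
  have h2 : AEStronglyMeasurable (fun z : (ℝ × R3) × R3 => ψ (z.1.2 - z.2))
      ((μ.prod volume).prod volume) :=
    (ψ.continuous.comp (by fun_prop : Continuous fun z : (ℝ × R3) × R3 =>
      z.1.2 - z.2)).aestronglyMeasurable
  exact (h1.mul h2).integral_prod_right'

theorem abs_re_mul_add_im_mul_le (z w : ℂ) : |z.re * w.re + z.im * w.im| ≤ ‖z‖ * ‖w‖ := by
  have : z.re * w.re + z.im * w.im = ((starRingEnd ℂ) z * w).re := by simp
  rw [this]
  refine (Complex.abs_re_le_norm _).trans ?_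
  rw [norm_mul, RCLike.norm_conj]

theorem integrable_mul_re_add_im {μ : Measure ℝ} [IsFiniteMeasure μ] {X : R3 → ℝ} (hX : Integrable X)
    {P Q : ℝ × R3 → ℂ} (hP : AEStronglyMeasurable P (μ.prod volume))
    (hQ : AEStronglyMeasurable Q (μ.prod volume)) {K : ℝ} {f : ℝ → ℝ} (hf : Integrable f μ)
    (hK : 0 ≤ K) (hPK : ∀ᵐ z ∂μ.prod volume, ‖P z‖ ≤ K) (hQf : ∀ᵐ z ∂μ.prod volume, ‖Q z‖ ≤ f z.1) :
    Integrable (fun z => X z.2 * ((P z).re * (Q z).re + (P z).im * (Q z).im)) (μ.prod volume) := by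
  have hb : Integrable (fun z : ℝ × R3 => f z.1 * X z.2) (μ.prod volume) := hf.mul_prod hX
  have hm : AEStronglyMeasurable (fun z => (P z).re * (Q z).re + (P z).im * (Q z).im)
      (μ.prod volume) :=
    ((Complex.continuous_re.comp_aestronglyMeasurable hP).mul
      (Complex.continuous_re.comp_aestronglyMeasurable hQ)).add
      ((Complex.continuous_im.comp_aestronglyMeasurable hP).mul
      (Complex.continuous_im.comp_aestronglyMeasurable hQ))
  refine (hb.const_mul K).mono (hX.1.comp_snd.mul hm) ?_
  filter_upwards [hPK, hQf] with z h1 h2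
  have h3 := abs_re_mul_add_im_mul_le (P z) (Q z)
  have h4 : 0 ≤ f z.1 := (norm_nonneg _).trans h2
  rw [norm_mul, norm_mul, norm_mul, Real.norm_of_nonneg hK, Real.norm_of_nonneg h4]
  calc ‖X z.2‖ * ‖(P z).re * (Q z).re + (P z).im * (Q z).im‖ ≤ ‖X z.2‖ * (K * f z.1) := by
        gcongr
        exact h3.trans (mul_le_mul h1 h2 (norm_nonneg _) hK)
    _ = _ := by ring

theorem integral_momentumDensity_sub {u F : ℝ → R3 → ℂ} {a b : ℝ} (hab : a ≤ b)
    (hum : AEStronglyMeasurable (Function.uncurry u) ((volume.restrict (Set.Icc a b)).prod volume))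
    (hF : MemLp (Function.uncurry F) 2 ((volume.restrict (Set.Icc a b)).prod volume))
    {q : ℝ} (hq : 1 < q) {B : ℝ≥0∞} (hB : B ≠ ∞)
    (huq : ∀ᵐ s ∂volume.restrict (Set.Icc a b), ∫⁻ y, ‖u s y‖ₑ ^ q ≤ B)
    (hw : ∀ (φ : 𝓢(R3, ℂ)), ∀ t ∈ Set.Icc a b,
      IntervalIntegrable (fun τ => (∫ x, u τ x * schwartzGenerator φ x) -
        Complex.I * ∫ x, F τ x * φ x) volume a t ∧
      ∫ x, u t x * φ x = (∫ x, u a x * φ x) +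
        ∫ τ in a..t, ((∫ x, u τ x * schwartzGenerator φ x) - Complex.I * ∫ x, F τ x * φ x))
    {X : Fin 3 → R3 → ℝ} (hX : ∀ k, Integrable (X k)) (ρ : 𝓢(R3, ℂ)) :
    IntegrableOn (fun s => ∫ x, momentumRate X (u s) (F s) ρ x) (Set.Icc a b) ∧
      ∫ x, (momentumDensity X (u b) ρ x - momentumDensity X (u a) ρ x) =
        ∫ s in Set.Icc a b, ∫ x, momentumRate X (u s) (F s) ρ x := by
  set μ := (volume : Measure ℝ).restrict (Set.Icc a b) with hμ
  set Φ : ℝ → ℝ := fun s => (∫⁻ y, ‖F s y‖ₑ ^ 2).toReal with hΦ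
  have hF2 := (memLp_two_iff_lintegral hF.1).1 hF
  rw [lintegral_prod _ (hF.1.enorm.pow_const 2)] at hF2
  have hΦi : Integrable Φ μ := integrable_toReal_of_lintegral_ne_top
    (hF.1.enorm.pow_const 2).lintegral_prod_right' hF2.ne
  have hu_bound : ∀ ψ : 𝓢(R3, ℂ), ∃ K : ℝ, 0 ≤ K ∧
      ∀ᵐ z ∂μ.prod (volume : Measure R3), ‖schwartzConv (u z.1) ψ z.2‖ ≤ K := by
    intro ψ
    obtain ⟨K, hK0, hK⟩ := exists_norm_schwartzConv_le hq hB ψ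
    refine ⟨K, hK0, ?_⟩
    have : ∀ᵐ s ∂μ, ∀ x, ‖schwartzConv (u s) ψ x‖ ≤ K := by
      filter_upwards [huq, hum.prodMk_left] with s h1 h2 x
      exact hK _ h2 h1 x
    filter_upwards [Measure.quasiMeasurePreserving_fst.ae this] with z hz
    exact hz z.2
  have hr_bound : ∀ ψ : 𝓢(R3, ℂ), ∃ f : ℝ → ℝ, Integrable f μ ∧
      ∀ᵐ z ∂μ.prod (volume : Measure R3), ‖convRate (u z.1) (F z.1) ψ z.2‖ ≤ f z.1 := by
    intro ψ
    obtain ⟨K, hK0, hK⟩ := hu_bound (schwartzGenerator ψ)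
    obtain ⟨K', hK0', hK'⟩ := exists_norm_schwartzConv_le_of_memLp_two ψ
    refine ⟨fun s => K + K' * (1 + Φ s),
      (integrable_const _).add (((integrable_const _).add hΦi).const_mul _), ?_⟩
    have : ∀ᵐ s ∂μ, ∀ x, ‖schwartzConv (F s) ψ x‖ ≤ K' * (1 + Φ s) := by
      filter_upwards [memLp_two_slice hF] with s h1 x
      exact hK' _ h1 x
    filter_upwards [Measure.quasiMeasurePreserving_fst.ae this, hK] with z h1 h2
    rw [convRate]
    refine (norm_sub_le _ _).trans (add_le_add ?_ (h1 z.2))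
    simpa using h2
  have hcm := aestronglyMeasurable_schwartzConv hum
  have hrm : ∀ ψ : 𝓢(R3, ℂ), AEStronglyMeasurable
      (fun z : ℝ × R3 => convRate (u z.1) (F z.1) ψ z.2) (μ.prod volume) := fun ψ =>
    ((hcm (schwartzGenerator ψ)).const_mul Complex.I).neg.sub
      (aestronglyMeasurable_schwartzConv hF.1 ψ)
  have hint : Integrable (Function.uncurry fun s x => momentumRate X (u s) (F s) ρ x)
      (μ.prod volume) := by
    simp only [momentumRate, Function.uncurry_def]
    refine integrable_finsetSum _ fun k _ => ?_
    obtain ⟨K₁, hK₁0, hK₁⟩ := hu_bound ρ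
    obtain ⟨K₂, hK₂0, hK₂⟩ := hu_bound (schwartzPd k ρ)
    obtain ⟨f₁, hf₁i, hf₁⟩ := hr_bound ρ
    obtain ⟨f₂, hf₂i, hf₂⟩ := hr_bound (schwartzPd k ρ)
    have h1 := integrable_mul_re_add_im (hX k) (hcm ρ) (hrm (schwartzPd k ρ)) hf₂i hK₁0 hK₁ hf₂
    have h2 := integrable_mul_re_add_im (hX k) (hcm (schwartzPd k ρ)) (hrm ρ) hf₁i hK₂0 hK₂ hf₁
    refine (h1.sub h2).congr (ae_of_all _ fun z => ?_)
    simp only [Pi.sub_apply]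
    ring
  refine ⟨hint.integral_prod_left, ?_⟩
  simp_rw [momentumDensity_sub hab hw X ρ, intervalIntegral.integral_of_le hab,
    ← integral_Icc_eq_integral_Ioc]
  exact (integral_integral_swap hint).symm

/-! ### Local bounds for the mollified solution -/

theorem setLIntegral_rpow_le {α : Type*} [MeasurableSpace α] {μ : Measure α} {f : α → ℝ≥0∞}
    (hf : AEMeasurable f μ) {r q : ℝ} (hr : 0 < r) (hrq : r < q) (S : Set α) :
    ∫⁻ x in S, f x ^ r ∂μ ≤ (∫⁻ x, f x ^ q ∂μ) ^ (r / q) * μ S ^ (1 - r / q) := by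
  have hq : 0 < q := hr.trans hrq
  have hc := Real.HolderConjugate.conjExponent (p := q / r) (by rwa [one_lt_div hr])
  have h := ENNReal.lintegral_mul_le_Lp_mul_Lq (μ.restrict S) hc
    (hf.restrict.pow_const r) (aemeasurable_const (b := (1 : ℝ≥0∞)))
  have e1 : 1 / (q / r) = r / q := by field_simp
  have e2 : 1 / (q / r).conjExponent = 1 - r / q := by
    have := hc.one_div_add_one_div
    rw [e1] at this
    linarith
  simp only [Pi.mul_apply, mul_one, ENNReal.one_rpow, lintegral_const, one_mul,
    Measure.restrict_apply_univ, ← ENNReal.rpow_mul, e1, e2,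
    show r * (q / r) = q by field_simp] at h
  refine h.trans ?_
  gcongr
  exact Measure.restrict_le_self

theorem exists_setLIntegral_closedBall_le {r q : ℝ} (hr : 0 < r) (hrq : r < q) (C₀ : ℝ≥0) :
    ∃ C : ℝ≥0, ∀ (f : R3 → ℝ≥0∞) (N : ℝ≥0) (R : ℝ), AEMeasurable f → 0 < R →
      ∫⁻ x, f x ^ q ≤ C₀ * (N : ℝ≥0∞) ^ q →
      ∫⁻ x in Metric.closedBall 0 (2 * R), f x ^ r ≤
        C * ENNReal.ofReal R ^ (3 * (1 - r / q)) * (N : ℝ≥0∞) ^ r := by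
  have hq : 0 < q := hr.trans hrq
  have hrq1 : r / q < 1 := by rwa [div_lt_one hq]
  set V := volume (Metric.ball (0 : R3) 1)
  have hV : V ≠ ∞ := measure_ball_lt_top.ne
  set C := (C₀ : ℝ≥0∞) ^ (r / q) * (ENNReal.ofReal (2 ^ 3) * V) ^ (1 - r / q) with hC
  have hCt : C ≠ ∞ := ENNReal.mul_ne_top
    (ENNReal.rpow_ne_top_of_nonneg (by positivity) ENNReal.coe_ne_top)
    (ENNReal.rpow_ne_top_of_nonneg (by linarith) (ENNReal.mul_ne_top ENNReal.ofReal_ne_top hV))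
  refine ⟨C.toNNReal, fun f N R hf hR hfq => ?_⟩
  rw [ENNReal.coe_toNNReal hCt]
  refine (setLIntegral_rpow_le hf hr hrq _).trans ?_
  have e : volume (Metric.closedBall (0 : R3) (2 * R)) =
      ENNReal.ofReal (2 ^ 3) * V * ENNReal.ofReal R ^ (3 : ℝ) := by
    rw [Measure.addHaar_closedBall _ _ (by positivity)]
    simp only [finrank_euclideanSpace, Fintype.card_fin]
    rw [mul_pow, ENNReal.ofReal_mul (by norm_num), ENNReal.ofReal_pow hR.le, ← ENNReal.rpow_natCast]
    push_cast
    ring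
  rw [e, ENNReal.mul_rpow_of_nonneg _ _ (by linarith : 0 ≤ 1 - r / q), ← ENNReal.rpow_mul]
  calc _ ≤ (C₀ * (N : ℝ≥0∞) ^ q) ^ (r / q) * ((ENNReal.ofReal (2 ^ 3) * V) ^ (1 - r / q) *
        ENNReal.ofReal R ^ (3 * (1 - r / q))) := by gcongr
    _ = _ := by
      rw [ENNReal.mul_rpow_of_nonneg _ _ (by positivity), ← ENNReal.rpow_mul,
        show q * (r / q) = r by field_simp, hC]
      ring

theorem exists_mollified_local_bounds {p : ℝ} (hp : 4 < p) :
    ∃ C : ℝ≥0, ∀ (f : R3 → ℂ) (N : ℝ≥0) (R : ℝ) (n : ℕ), 0 < R →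
      SobolevBound (criticalRegularity p) N f →
      ∫⁻ x in Metric.closedBall 0 (2 * R), ‖schwartzConv f (mollifier n) x‖ₑ ^ 2 ≤
        C * ENNReal.ofReal R ^ (2 * criticalRegularity p) * (N : ℝ≥0∞) ^ 2 ∧
      (∀ j, ∫⁻ x in Metric.closedBall 0 (2 * R),
          ‖schwartzConv f (schwartzPd j (mollifier n)) x‖ₑ ^ 2 ≤
        C * ENNReal.ofReal R ^ (2 * criticalRegularity p - 2) * (N : ℝ≥0∞) ^ 2) ∧
      ∫⁻ x in Metric.closedBall 0 (2 * R), ‖schwartzConv f (mollifier n) x‖ₑ ^ (p + 2) ≤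
        C * ENNReal.ofReal R ^ (2 * criticalRegularity p - 2) * (N : ℝ≥0∞) ^ (p + 2) := by
  have hp0 : 0 < p := by linarith
  have hs : criticalRegularity p = 3 / 2 - 2 / p := rfl
  have hdiv : 2 / p < 1 / 2 := by rw [div_lt_div_iff₀ hp0 (by norm_num)]; linarith
  have hdiv0 : 0 < 2 / p := by positivity
  have e1 : 6 / (3 - 2 * criticalRegularity p) = 3 * p / 2 := by
    rw [hs]; field_simp; norm_num
  have hs1 : 1 < criticalRegularity p := by rw [hs]; linarith
  have hs2 : criticalRegularity p < 3 / 2 := by rw [hs]; linarith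
  obtain ⟨C₀, hC₀⟩ := exists_mollified_sobolev hs1 hs2
  obtain ⟨C₁, hC₁⟩ := exists_setLIntegral_closedBall_le (r := 2)
    (q := 6 / (3 - 2 * criticalRegularity p)) two_pos (by rw [e1]; linarith) C₀
  obtain ⟨C₂, hC₂⟩ := exists_setLIntegral_closedBall_le (r := 2)
    (q := 6 / (3 - 2 * (criticalRegularity p - 1))) two_pos
    (by rw [lt_div_iff₀ (by linarith)]; linarith) C₀
  obtain ⟨C₃, hC₃⟩ := exists_setLIntegral_closedBall_le (r := p + 2)
    (q := 6 / (3 - 2 * criticalRegularity p)) (by linarith) (by rw [e1]; linarith) C₀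
  have x1 : 3 * (1 - 2 / (6 / (3 - 2 * criticalRegularity p))) = 2 * criticalRegularity p := by
    have : 3 - 2 * criticalRegularity p ≠ 0 := by linarith
    field_simp; ring
  have x2 : 3 * (1 - 2 / (6 / (3 - 2 * (criticalRegularity p - 1)))) =
      2 * criticalRegularity p - 2 := by
    have : 3 - 2 * (criticalRegularity p - 1) ≠ 0 := by linarith
    field_simp; ring
  have x3 : 3 * (1 - (p + 2) / (6 / (3 - 2 * criticalRegularity p))) =
      2 * criticalRegularity p - 2 := by
    rw [e1, hs]; field_simp; ring
  rw [x1] at hC₁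
  rw [x2] at hC₂
  rw [x3] at hC₃
  simp only [ENNReal.rpow_two] at hC₁ hC₂
  refine ⟨C₁ + C₂ + C₃, fun f N R n hR hf => ?_⟩
  obtain ⟨h1, h2⟩ := hC₀ f N hf n
  have hl := hf.locallyIntegrable
  have hm : ∀ ψ : 𝓢(R3, ℂ), HasCompactSupport ψ → AEMeasurable fun x => ‖schwartzConv f ψ x‖ₑ :=
    fun ψ hψ => (contDiff_schwartzConv hl hψ (n := 0)).continuous.enorm.measurable.aemeasurable
  have hρ := hasCompactSupport_mollifier n
  push_cast
  refine ⟨(hC₁ _ N R (hm _ hρ) hR h1).trans ?_, fun j =>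
    (hC₂ _ N R (hm _ (hρ.schwartzPd j)) hR (h2 j)).trans ?_,
    (hC₃ _ N R (hm _ hρ) hR h1).trans ?_⟩
  · gcongr
    exact le_add_right le_self_add
  · gcongr
    exact le_add_right le_add_self
  · gcongr
    exact le_add_self

/-! ### The lower bound for the bulk term -/

theorem pd_eq_zero_of_far {f : R3 → ℝ} {r : ℝ} (hf : ∀ x, r < ‖x‖ → f x = 0) (j : Fin 3) :
    ∀ x, r < ‖x‖ → pd j f x = 0 := by
  intro x hx
  have h : f =ᶠ[𝓝 x] fun _ => 0 := by
    filter_upwards [(isOpen_lt continuous_const continuous_norm).mem_nhds hx] with y hy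
    exact hf y hy
  rw [pd, h.fderiv_eq]
  simp

theorem IsMorawetzMultiplier.bulk_eq_zero {c R δ : ℝ} {X : Fin 3 → R3 → ℝ}
    (h : IsMorawetzMultiplier c R δ X) (p : ℝ) (w E : R3 → ℂ) {x : R3} (hx : 2 * R < ‖x‖) :
    morawetzBulk p X w E x = 0 := by
  have h0 : ∀ k x, 2 * R < ‖x‖ → X k x = 0 := fun k x hx => h.eq_zero k x hx.le
  have h1 : ∀ j k x, 2 * R < ‖x‖ → pd j (X k) x = 0 := fun j k => pd_eq_zero_of_far (h0 k) j
  have h2 : ∀ x, 2 * R < ‖x‖ → vdiv X x = 0 := by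
    intro x hx
    simp [vdiv, h1 _ _ x hx]
  have h3 : ∀ j x, 2 * R < ‖x‖ → pd j (pd j (vdiv X)) x = 0 := fun j =>
    pd_eq_zero_of_far (pd_eq_zero_of_far h2 j) j
  simp [morawetzBulk, h0 _ x hx, h1 _ _ x hx, h2 x hx, h3 _ x hx]

theorem IsMorawetzMultiplier.bulk_lower {c R δ : ℝ} (hc : 0 < c) (hR : 0 < R)
    {X : Fin 3 → R3 → ℝ} (h : IsMorawetzMultiplier c R δ X) {p : ℝ} (w E : R3 → ℂ)
    {D : ℝ} {x : R3} (hD : |vdiv X x| ≤ D) :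
    p / (p + 2) * vdiv X x * ‖w x‖ ^ (p + 2) ≤ morawetzBulk p X w E x +
      (3 * c / R * (∑ j, ‖pd j w x‖ ^ 2) + 2 * c / R ^ 3 * ‖w x‖ ^ 2) +
      (D ^ 2 * R ^ 3 / (4 * c) + 3 * c * R) * ‖E x‖ ^ 2 := by
  have hD0 : 0 ≤ D := (abs_nonneg _).trans hD
  have q1 := h.quadratic_lower x fun j => pd j w x
  have q2 : 1 / 2 * (∑ j, pd j (pd j (vdiv X)) x) * ‖w x‖ ^ 2 ≤ 1 / 2 * (c / R ^ 3) * ‖w x‖ ^ 2 := by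
    gcongr
    exact h.laplacian_vdiv_le x
  have q3 : -(c / R ^ 3 * ‖w x‖ ^ 2 + D ^ 2 * R ^ 3 / (4 * c) * ‖E x‖ ^ 2) ≤
      vdiv X x * ((w x).re * (E x).re + (w x).im * (E x).im) := by
    have a1 : |vdiv X x * ((w x).re * (E x).re + (w x).im * (E x).im)| ≤ D * (‖w x‖ * ‖E x‖) := by
      rw [abs_mul]
      exact mul_le_mul hD (abs_re_mul_add_im_mul_le _ _) (abs_nonneg _) hD0
    have a2 : D * (‖w x‖ * ‖E x‖) ≤
        c / R ^ 3 * ‖w x‖ ^ 2 + D ^ 2 * R ^ 3 / (4 * c) * ‖E x‖ ^ 2 := by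
      have : c / R ^ 3 * ‖w x‖ ^ 2 + D ^ 2 * R ^ 3 / (4 * c) * ‖E x‖ ^ 2 - D * (‖w x‖ * ‖E x‖) =
          c / R ^ 3 * (‖w x‖ - D * R ^ 3 / (2 * c) * ‖E x‖) ^ 2 := by
        field_simp; ring
      nlinarith [show 0 ≤ c / R ^ 3 * (‖w x‖ - D * R ^ 3 / (2 * c) * ‖E x‖) ^ 2 by positivity]
    linarith [neg_abs_le (vdiv X x * ((w x).re * (E x).re + (w x).im * (E x).im))]
  have q4 : ∀ k, -(c / R * ‖pd k w x‖ ^ 2 + c * R * ‖E x‖ ^ 2) ≤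
      2 * (X k x * ((pd k w x).re * (E x).re + (pd k w x).im * (E x).im)) := by
    intro k
    have a1 : |X k x * ((pd k w x).re * (E x).re + (pd k w x).im * (E x).im)| ≤
        c * (‖pd k w x‖ * ‖E x‖) := by
      rw [abs_mul]
      exact mul_le_mul (h.abs_le k x) (abs_re_mul_add_im_mul_le _ _) (abs_nonneg _) hc.le
    have a2 : 2 * (c * (‖pd k w x‖ * ‖E x‖)) ≤ c / R * ‖pd k w x‖ ^ 2 + c * R * ‖E x‖ ^ 2 := by
      have : c / R * ‖pd k w x‖ ^ 2 + c * R * ‖E x‖ ^ 2 - 2 * (c * (‖pd k w x‖ * ‖E x‖)) =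
          c / R * (‖pd k w x‖ - R * ‖E x‖) ^ 2 := by
        field_simp; ring
      nlinarith [show 0 ≤ c / R * (‖pd k w x‖ - R * ‖E x‖) ^ 2 by positivity]
    linarith [neg_abs_le (X k x * ((pd k w x).re * (E x).re + (pd k w x).im * (E x).im))]
  have q5 : -(c / R * (∑ k, ‖pd k w x‖ ^ 2) + 3 * (c * R) * ‖E x‖ ^ 2) ≤
      2 * ∑ k, X k x * ((pd k w x).re * (E x).re + (pd k w x).im * (E x).im) := by
    simp only [Fin.sum_univ_three]
    linarith [q4 0, q4 1, q4 2]
  have z0 : 0 ≤ c / R ^ 3 * ‖w x‖ ^ 2 := by positivity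
  rw [morawetzBulk]
  have t1 : 3 * c / R = 3 * (c / R) := by ring
  have t2 : 2 * c / R ^ 3 = 2 * (c / R ^ 3) := by ring
  rw [t1, t2]
  linarith

theorem lintegral_le_ofReal_add {α : Type*} [MeasurableSpace α] {μ : Measure α} {b : α → ℝ}
    (hb : Integrable b μ) {r : α → ℝ≥0∞} (hr : AEMeasurable r μ) (hri : ∫⁻ x, r x ∂μ ≠ ∞)
    {G : α → ℝ≥0∞}
    (h : ∀ᵐ x ∂μ, G x ≤ ENNReal.ofReal (b x + (r x).toReal) ∧ 0 ≤ b x + (r x).toReal) :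
    ∫⁻ x, G x ∂μ ≤ ENNReal.ofReal (∫ x, b x ∂μ + (∫⁻ x, r x ∂μ).toReal) ∧
      0 ≤ ∫ x, b x ∂μ + (∫⁻ x, r x ∂μ).toReal := by
  have hi : Integrable (fun x => (r x).toReal) μ := integrable_toReal_of_lintegral_ne_top hr hri
  have hnn : 0 ≤ᵐ[μ] fun x => b x + (r x).toReal := h.mono fun x hx => hx.2
  rw [← integral_toReal hr (ae_lt_top' hr hri), ← integral_add hb hi]
  refine ⟨?_, integral_nonneg_of_ae hnn⟩
  have hbi : Integrable (fun x => b x + (r x).toReal) μ := hb.add hi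
  rw [ofReal_integral_eq_lintegral_ofReal hbi hnn]
  exact lintegral_mono_ae (h.mono fun x hx => hx.1)

/-! ### The Morawetz inequality for the mollified solution -/

theorem ofReal_mul_norm_rpow {c : ℝ} (hc : 0 ≤ c) (z : ℂ) {r : ℝ} (hr : 0 ≤ r) :
    ENNReal.ofReal (c * ‖z‖ ^ r) = ENNReal.ofReal c * ‖z‖ₑ ^ r := by
  rw [ENNReal.ofReal_mul hc, ← ofReal_norm, ENNReal.ofReal_rpow_of_nonneg (norm_nonneg _) hr]

theorem ofReal_mul_norm_sq {c : ℝ} (hc : 0 ≤ c) (z : ℂ) :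
    ENNReal.ofReal (c * ‖z‖ ^ 2) = ENNReal.ofReal c * ‖z‖ₑ ^ 2 := by
  rw [ENNReal.ofReal_mul hc, ← ofReal_norm, ENNReal.ofReal_pow (norm_nonneg _)]

/-- The part of the remainder that is controlled by local Sobolev norms. -/
noncomputable def localRemainder (p c R : ℝ) (w : R3 → ℂ) (x : R3) : ℝ :=
  3 * c / R * (∑ j, ‖pd j w x‖ ^ 2) + 2 * c / R ^ 3 * ‖w x‖ ^ 2 + c / R * ‖w x‖ ^ (p + 2)

theorem localRemainder_nonneg {p c R : ℝ} (hc : 0 < c) (hR : 0 < R) (w : R3 → ℂ) (x : R3) :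
    0 ≤ localRemainder p c R w x := by
  unfold localRemainder; positivity

theorem fixed_time_lower {p c R δ D : ℝ} (hp : 2 ≤ p) (hc : 0 < c) (hR : 0 < R) (hδ : 0 < δ)
    {X : Fin 3 → R3 → ℝ} (hX : IsMorawetzMultiplier c R δ X) (hD : ∀ x, |vdiv X x| ≤ D)
    {h : R3 → ℂ} (hh : LocallyIntegrable h)
    (hfin : ∫⁻ x, ‖h x‖ₑ ^ (2 * (p + 1)) < ∞) (n : ℕ) {Γ₀ : ℝ≥0∞} (hΓ₀ : Γ₀ ≠ ∞)
    (hΓ : ∫⁻ x in Metric.closedBall 0 (2 * R), ENNReal.ofReal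
      (localRemainder p c R (schwartzConv h (mollifier n)) x) ≤ Γ₀) :
    ∫⁻ x in Metric.ball 0 R, ENNReal.ofReal ((‖x‖ ^ 2 + δ ^ 2) ^ (-(1 / 2) : ℝ)) *
        ‖schwartzConv h (mollifier n) x‖ₑ ^ (p + 2) ≤
      ENNReal.ofReal ((∫ x, momentumRate X h (fun y => nlsNonlinearity p (h y)) (mollifier n) x) +
        (Γ₀ + ENNReal.ofReal (D ^ 2 * R ^ 3 / (4 * c) + 3 * c * R) *
          ∫⁻ x, ‖nlsCommutator p h n x‖ₑ ^ 2).toReal) ∧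
    0 ≤ (∫ x, momentumRate X h (fun y => nlsNonlinearity p (h y)) (mollifier n) x) +
        (Γ₀ + ENNReal.ofReal (D ^ 2 * R ^ 3 / (4 * c) + 3 * c * R) *
          ∫⁻ x, ‖nlsCommutator p h n x‖ₑ ^ 2).toReal := by
  have hp0 : 0 < p := by linarith
  have hρ := hasCompactSupport_mollifier n
  have hf := locallyIntegrable_nlsNonlinearity hp0.le hh hfin
  set K := D ^ 2 * R ^ 3 / (4 * c) + 3 * c * R with hK
  have hK0 : 0 ≤ K := by positivity
  set w := schwartzConv h (mollifier n) with hwdef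
  set E := nlsCommutator p h n with hEdef
  have hw : ContDiff ℝ ((⊤ : ℕ∞) : WithTop ℕ∞) w := contDiff_schwartzConv hh hρ
  have hH := contDiff_convRate hh hf hρ
  have hEeq : ∀ x, E x = (∑ j, pd j (pd j w) x) - nlsNonlinearity p (w x) -
      convRate h (fun y => nlsNonlinearity p (h y)) (mollifier n) x := by
    intro x
    rw [convRate_eq hh hρ, hEdef, nlsCommutator]
    ring
  have hXc : ∀ k, HasCompactSupport (X k) := fun k =>
    HasCompactSupport.intro (isCompact_closedBall (0 : R3) (2 * R)) fun x hx =>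
      hX.eq_zero k x (by simpa using (not_le.1 (by simpa using hx) : 2 * R < ‖x‖).le)
  obtain ⟨hbi, hbe⟩ := morawetz_identity hp0 hX.contDiff hXc (contDiff_infty.1 hw 2)
    (contDiff_infty.1 hH 1) hEeq
  rw [momentumRate_eq hh hf hρ, hbe]
  have hwc : Continuous w := hw.continuous
  have hpc : ∀ j, Continuous (pd j w) := fun j => (contDiff_pd_top hw j).continuous
  have hEc : Continuous E := continuous_nlsCommutator hp0.le hh hfin n
  have hLc : Continuous (localRemainder p c R w) := by
    have : Continuous fun x => ‖w x‖ ^ (p + 2) :=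
      hwc.norm.rpow_const fun _ => Or.inr (by linarith)
    unfold localRemainder
    fun_prop
  have hLm : Measurable fun x => ENNReal.ofReal (localRemainder p c R w x) :=
    hLc.measurable.ennreal_ofReal
  set S := Metric.closedBall (0 : R3) (2 * R) with hS
  have hSm : MeasurableSet S := Metric.isClosed_closedBall.measurableSet
  set r : R3 → ℝ≥0∞ := fun x => S.indicator (fun x => ENNReal.ofReal (localRemainder p c R w x)) x +
    ENNReal.ofReal K * ‖E x‖ₑ ^ 2 with hr
  have hEm : Measurable fun x => ENNReal.ofReal K * ‖E x‖ₑ ^ 2 :=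
    (hEc.enorm.measurable.pow_const 2).const_mul _
  have hrm : Measurable r := (hLm.indicator hSm).add hEm
  have hEfin : ∫⁻ x, ‖E x‖ₑ ^ 2 ≠ ∞ := ((lintegral_nlsCommutator_le hp0.le hh n).trans_lt
    (ENNReal.mul_lt_top (by simp) hfin)).ne
  have hrle : ∫⁻ x, r x ≤ Γ₀ + ENNReal.ofReal K * ∫⁻ x, ‖E x‖ₑ ^ 2 := by
    rw [hr, lintegral_add_right _ hEm, lintegral_indicator hSm,
      lintegral_const_mul _ (hEc.enorm.measurable.pow_const 2)]
    gcongr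
  have hΓt : Γ₀ + ENNReal.ofReal K * ∫⁻ x, ‖E x‖ₑ ^ 2 ≠ ∞ :=
    ENNReal.add_ne_top.2 ⟨hΓ₀, ENNReal.mul_ne_top ENNReal.ofReal_ne_top hEfin⟩
  have hrt : ∀ x, (r x).toReal =
      S.indicator (fun x => localRemainder p c R w x) x + K * ‖E x‖ ^ 2 := by
    intro x
    rw [hr]
    dsimp only
    rw [← ofReal_mul_norm_sq hK0]
    by_cases hx : x ∈ S
    · rw [Set.indicator_of_mem hx, Set.indicator_of_mem hx,
        ← ENNReal.ofReal_add (localRemainder_nonneg hc hR _ _) (by positivity),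
        ENNReal.toReal_ofReal (add_nonneg (localRemainder_nonneg hc hR _ _) (by positivity))]
    · rw [Set.indicator_of_notMem hx, Set.indicator_of_notMem hx, zero_add, zero_add,
        ENNReal.toReal_ofReal (by positivity)]
  have hpt : ∀ x, 0 ≤ morawetzBulk p X w E x + (r x).toReal ∧ (x ∈ Metric.ball (0 : R3) R →
      (‖x‖ ^ 2 + δ ^ 2) ^ (-(1 / 2) : ℝ) * ‖w x‖ ^ (p + 2) ≤
        morawetzBulk p X w E x + (r x).toReal) := by
    intro x
    rw [hrt]
    by_cases hx : x ∈ S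
    · rw [Set.indicator_of_mem hx, localRemainder]
      have h1 := hX.bulk_lower hc hR (p := p) w E (hD x)
      have h2 := hX.vdiv_lower x
      have hw0 : 0 ≤ ‖w x‖ ^ (p + 2) := by positivity
      have hpp : 0 ≤ p / (p + 2) := by positivity
      have hpp1 : p / (p + 2) ≤ 1 := by rw [div_le_one (by linarith)]; linarith
      have hpp2 : 1 ≤ p / (p + 2) * 2 := by
        rw [div_mul_eq_mul_div, le_div_iff₀ (by linarith)]; linarith
      have hcR : 0 ≤ c / R := by positivity
      constructor
      · have h3 : -(c / R) * ‖w x‖ ^ (p + 2) ≤ p / (p + 2) * vdiv X x * ‖w x‖ ^ (p + 2) := by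
          gcongr
          nlinarith [mul_le_mul_of_nonneg_left h2 hpp]
        linarith
      · intro hxR
        have h3 := hX.vdiv_lower_of_lt x (by simpa using hxR)
        have hW : 0 ≤ (‖x‖ ^ 2 + δ ^ 2) ^ (-(1 / 2) : ℝ) := by positivity
        have h4 : (‖x‖ ^ 2 + δ ^ 2) ^ (-(1 / 2) : ℝ) * ‖w x‖ ^ (p + 2) ≤
            p / (p + 2) * vdiv X x * ‖w x‖ ^ (p + 2) := by
          gcongr
          calc (‖x‖ ^ 2 + δ ^ 2) ^ (-(1 / 2) : ℝ) ≤
              p / (p + 2) * 2 * (‖x‖ ^ 2 + δ ^ 2) ^ (-(1 / 2) : ℝ) :=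
                le_mul_of_one_le_left hW hpp2
            _ = p / (p + 2) * (2 * (‖x‖ ^ 2 + δ ^ 2) ^ (-(1 / 2) : ℝ)) := by ring
            _ ≤ _ := by gcongr
        have h5 : 0 ≤ c / R * ‖w x‖ ^ (p + 2) := by positivity
        linarith
    · have hx' : 2 * R < ‖x‖ := by simpa [hS] using hx
      rw [hX.bulk_eq_zero p w E hx', Set.indicator_of_notMem hx]
      refine ⟨by positivity, fun hxR => ?_⟩
      have : ‖x‖ < R := by simpa using hxR
      linarith
  have hfinal := lintegral_le_ofReal_add hbi hrm.aemeasurable (hrle.trans_lt hΓt.lt_top).ne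
    (G := (Metric.ball (0 : R3) R).indicator fun x =>
      ENNReal.ofReal ((‖x‖ ^ 2 + δ ^ 2) ^ (-(1 / 2) : ℝ)) * ‖w x‖ₑ ^ (p + 2))
    (ae_of_all _ fun x => ⟨by
      by_cases hx : x ∈ Metric.ball (0 : R3) R
      · rw [Set.indicator_of_mem hx, ← ofReal_mul_norm_rpow (by positivity) _ (by linarith)]
        exact ENNReal.ofReal_le_ofReal ((hpt x).2 hx)
      · rw [Set.indicator_of_notMem hx]
        exact zero_le, (hpt x).1⟩)
  rw [lintegral_indicator Metric.isOpen_ball.measurableSet] at hfinal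
  have hmono : (∫⁻ x, r x).toReal ≤ (Γ₀ + ENNReal.ofReal K * ∫⁻ x, ‖E x‖ₑ ^ 2).toReal :=
    ENNReal.toReal_mono hΓt hrle
  refine ⟨hfinal.1.trans (ENNReal.ofReal_le_ofReal (by linarith)), by linarith [hfinal.2]⟩

theorem setLIntegral_localRemainder_le {p c R : ℝ} (hp : 0 < p) (hc : 0 < c) (hR : 0 < R)
    {h : R3 → ℂ} (hh : LocallyIntegrable h) (n : ℕ) {C N : ℝ≥0} {σ : ℝ}
    (h1 : ∫⁻ x in Metric.closedBall 0 (2 * R), ‖schwartzConv h (mollifier n) x‖ₑ ^ 2 ≤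
        C * ENNReal.ofReal R ^ (2 * σ) * (N : ℝ≥0∞) ^ 2)
    (h2 : ∀ j, ∫⁻ x in Metric.closedBall 0 (2 * R),
          ‖schwartzConv h (schwartzPd j (mollifier n)) x‖ₑ ^ 2 ≤
        C * ENNReal.ofReal R ^ (2 * σ - 2) * (N : ℝ≥0∞) ^ 2)
    (h3 : ∫⁻ x in Metric.closedBall 0 (2 * R), ‖schwartzConv h (mollifier n) x‖ₑ ^ (p + 2) ≤
        C * ENNReal.ofReal R ^ (2 * σ - 2) * (N : ℝ≥0∞) ^ (p + 2)) :
    ∫⁻ x in Metric.closedBall 0 (2 * R), ENNReal.ofReal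
      (localRemainder p c R (schwartzConv h (mollifier n)) x) ≤
      ENNReal.ofReal (11 * c) * C * ENNReal.ofReal R ^ (2 * σ - 3) *
        ((N : ℝ≥0∞) ^ 2 + (N : ℝ≥0∞) ^ (p + 2)) := by
  have hρ := hasCompactSupport_mollifier n
  have hm : ∀ ψ : 𝓢(R3, ℂ), HasCompactSupport ψ → Measurable fun x => ‖schwartzConv h ψ x‖ₑ :=
    fun ψ hψ => (contDiff_schwartzConv hh hψ (n := 0)).continuous.enorm.measurable
  have hR0 : ENNReal.ofReal R ≠ 0 := by simpa using hR
  have hpow : ∀ k l : ℝ, ENNReal.ofReal (R ^ (-k)) * ENNReal.ofReal R ^ l =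
      ENNReal.ofReal R ^ (l - k) := by
    intro k l
    rw [← ENNReal.ofReal_rpow_of_pos hR, ← ENNReal.rpow_add _ _ hR0 ENNReal.ofReal_ne_top]
    congr 1; ring
  have hd1 : ∀ a : ℝ, 0 ≤ a → ENNReal.ofReal (a / R) = ENNReal.ofReal a * ENNReal.ofReal (R ^ (-1 : ℝ)) := by
    intro a ha
    rw [← ENNReal.ofReal_mul ha, Real.rpow_neg_one]; rfl
  have hd3 : ∀ a : ℝ, 0 ≤ a →
      ENNReal.ofReal (a / R ^ 3) = ENNReal.ofReal a * ENNReal.ofReal (R ^ (-3 : ℝ)) := by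
    intro a ha
    rw [← ENNReal.ofReal_mul ha, Real.rpow_neg hR.le]
    norm_num
    rfl
  have e : ∀ x, ENNReal.ofReal (localRemainder p c R (schwartzConv h (mollifier n)) x) =
      ENNReal.ofReal (3 * c / R) *
        (∑ j, ‖schwartzConv h (schwartzPd j (mollifier n)) x‖ₑ ^ 2) +
      ENNReal.ofReal (2 * c / R ^ 3) * ‖schwartzConv h (mollifier n) x‖ₑ ^ 2 +
      ENNReal.ofReal (c / R) * ‖schwartzConv h (mollifier n) x‖ₑ ^ (p + 2) := by
    intro x
    rw [localRemainder, ENNReal.ofReal_add (by positivity) (by positivity),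
      ENNReal.ofReal_add (by positivity) (by positivity), ofReal_mul_norm_sq (by positivity),
      ofReal_mul_norm_rpow (by positivity) _ (by linarith), ENNReal.ofReal_mul (by positivity),
      ENNReal.ofReal_sum_of_nonneg fun j _ => by positivity]
    simp only [pd_schwartzConv hh hρ, ENNReal.ofReal_pow (norm_nonneg _), ofReal_norm]
  simp only [e]
  rw [lintegral_add_right _ (((hm _ hρ).pow_const _).const_mul _),
    lintegral_add_right _ (((hm _ hρ).pow_const _).const_mul _),
    lintegral_const_mul _ ((hm _ hρ).pow_const _), lintegral_const_mul _ ((hm _ hρ).pow_const _),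
    lintegral_const_mul _ (Finset.measurable_fun_sum _ fun j _ =>
      (hm _ (hρ.schwartzPd j)).pow_const _),
    lintegral_finsetSum _ fun j _ => (hm _ (hρ.schwartzPd j)).pow_const _]
  calc _ ≤ ENNReal.ofReal (3 * c / R) *
        (∑ _j : Fin 3, C * ENNReal.ofReal R ^ (2 * σ - 2) * (N : ℝ≥0∞) ^ 2) +
      ENNReal.ofReal (2 * c / R ^ 3) * (C * ENNReal.ofReal R ^ (2 * σ) * (N : ℝ≥0∞) ^ 2) +
      ENNReal.ofReal (c / R) * (C * ENNReal.ofReal R ^ (2 * σ - 2) * (N : ℝ≥0∞) ^ (p + 2)) := by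
        gcongr
        exact h2 _
    _ = C * ENNReal.ofReal R ^ (2 * σ - 3) * (ENNReal.ofReal (9 * c) * (N : ℝ≥0∞) ^ 2 +
        ENNReal.ofReal (2 * c) * (N : ℝ≥0∞) ^ 2 + ENNReal.ofReal c * (N : ℝ≥0∞) ^ (p + 2)) := by
        rw [hd1 _ (by positivity), hd1 _ hc.le, hd3 _ (by positivity)]
        have p1 := hpow 1 (2 * σ - 2)
        have p3 := hpow 3 (2 * σ)
        rw [show 2 * σ - 2 - 1 = 2 * σ - 3 by ring] at p1
        have h9 : ENNReal.ofReal (9 * c) = ENNReal.ofReal (3 * c) * 3 := by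
          rw [show (3 : ℝ≥0∞) = ENNReal.ofReal 3 by simp, ← ENNReal.ofReal_mul (by positivity)]
          congr 1; ring
        rw [h9]
        simp only [Finset.sum_const, Finset.card_univ, Fintype.card_fin, nsmul_eq_mul]
        push_cast
        calc _ = ENNReal.ofReal (3 * c) * 3 * C * (N : ℝ≥0∞) ^ 2 *
              (ENNReal.ofReal (R ^ (-1 : ℝ)) * ENNReal.ofReal R ^ (2 * σ - 2)) +
            ENNReal.ofReal (2 * c) * C * (N : ℝ≥0∞) ^ 2 *
              (ENNReal.ofReal (R ^ (-3 : ℝ)) * ENNReal.ofReal R ^ (2 * σ)) +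
            ENNReal.ofReal c * C * (N : ℝ≥0∞) ^ (p + 2) *
              (ENNReal.ofReal (R ^ (-1 : ℝ)) * ENNReal.ofReal R ^ (2 * σ - 2)) := by ring
          _ = _ := by rw [p1, p3]; ring
    _ ≤ C * ENNReal.ofReal R ^ (2 * σ - 3) * (ENNReal.ofReal (11 * c) * (N : ℝ≥0∞) ^ 2 +
        ENNReal.ofReal (11 * c) * (N : ℝ≥0∞) ^ (p + 2)) := by
        have h11 : ENNReal.ofReal (11 * c) = ENNReal.ofReal (9 * c) + ENNReal.ofReal (2 * c) := by
          rw [← ENNReal.ofReal_add (by positivity) (by positivity)]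
          congr 1; ring
        have hle : ENNReal.ofReal c ≤ ENNReal.ofReal (11 * c) :=
          ENNReal.ofReal_le_ofReal (by linarith)
        rw [← add_mul, ← h11]
        gcongr
    _ = _ := by ring

theorem IsMorawetzMultiplier.lintegral_momentumDensity_le {c R δ : ℝ} (hc : 0 < c) (hR : 0 < R)
    {X : Fin 3 → R3 → ℝ} (hX : IsMorawetzMultiplier c R δ X)
    {h : R3 → ℂ} (hh : LocallyIntegrable h) (n : ℕ) {C N : ℝ≥0} {σ : ℝ}
    (h1 : ∫⁻ x in Metric.closedBall 0 (2 * R), ‖schwartzConv h (mollifier n) x‖ₑ ^ 2 ≤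
        C * ENNReal.ofReal R ^ (2 * σ) * (N : ℝ≥0∞) ^ 2)
    (h2 : ∀ j, ∫⁻ x in Metric.closedBall 0 (2 * R),
          ‖schwartzConv h (schwartzPd j (mollifier n)) x‖ₑ ^ 2 ≤
        C * ENNReal.ofReal R ^ (2 * σ - 2) * (N : ℝ≥0∞) ^ 2) :
    ∫⁻ x, ‖momentumDensity X h (mollifier n) x‖ₑ ≤
      ENNReal.ofReal (6 * c) * C * ENNReal.ofReal R ^ (2 * σ - 1) * (N : ℝ≥0∞) ^ 2 := by
  have hρ := hasCompactSupport_mollifier n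
  have hm : ∀ ψ : 𝓢(R3, ℂ), HasCompactSupport ψ → Measurable fun x => ‖schwartzConv h ψ x‖ₑ :=
    fun ψ hψ => (contDiff_schwartzConv hh hψ (n := 0)).continuous.enorm.measurable
  have hR0 : ENNReal.ofReal R ≠ 0 := by simpa using hR
  have hSm : MeasurableSet (Metric.closedBall (0 : R3) (2 * R)) :=
    Metric.isClosed_closedBall.measurableSet
  have hpt : ∀ x, ‖momentumDensity X h (mollifier n) x‖ₑ ≤
      (Metric.closedBall (0 : R3) (2 * R)).indicator (fun x => ∑ k,
        (ENNReal.ofReal (c / R) * ‖schwartzConv h (mollifier n) x‖ₑ ^ 2 +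
          ENNReal.ofReal (c * R) * ‖schwartzConv h (schwartzPd k (mollifier n)) x‖ₑ ^ 2)) x := by
    intro x
    by_cases hx : x ∈ Metric.closedBall (0 : R3) (2 * R)
    · rw [Set.indicator_of_mem hx, momentumDensity]
      refine (enorm_sum_le _ _).trans (Finset.sum_le_sum fun k _ => ?_)
      rw [← ofReal_mul_norm_sq (by positivity), ← ofReal_mul_norm_sq (by positivity),
        ← ENNReal.ofReal_add (by positivity) (by positivity), Real.enorm_eq_ofReal_abs]
      apply ENNReal.ofReal_le_ofReal
      set z := schwartzConv h (mollifier n) x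
      set v := schwartzConv h (schwartzPd k (mollifier n)) x
      have a1 : |z.re * v.im - z.im * v.re| ≤ ‖z‖ * ‖v‖ := by
        have := abs_re_mul_add_im_mul_le z (-Complex.I * v)
        simpa [sub_eq_add_neg] using this
      have a2 : c * (‖z‖ * ‖v‖) ≤ c / R * ‖z‖ ^ 2 + c * R * ‖v‖ ^ 2 := by
        have e : c / R * ‖z‖ ^ 2 + c * R * ‖v‖ ^ 2 - c * (‖z‖ * ‖v‖) =
            c / R * ((‖z‖ - R * ‖v‖) ^ 2 + ‖z‖ * (R * ‖v‖)) := by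
          field_simp; ring
        have : 0 ≤ c / R * ((‖z‖ - R * ‖v‖) ^ 2 + ‖z‖ * (R * ‖v‖)) := by positivity
        linarith
      rw [abs_mul]
      exact (mul_le_mul (hX.abs_le k x) a1 (abs_nonneg _) hc.le).trans a2
    · have hx' : 2 * R < ‖x‖ := by simpa using hx
      rw [momentumDensity]
      simp [hX.eq_zero _ x hx'.le]
  refine (lintegral_mono hpt).trans ?_
  have hmk : ∀ k : Fin 3, Measurable fun x =>
      ENNReal.ofReal (c / R) * ‖schwartzConv h (mollifier n) x‖ₑ ^ 2 +
        ENNReal.ofReal (c * R) * ‖schwartzConv h (schwartzPd k (mollifier n)) x‖ₑ ^ 2 := fun k =>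
    (((hm _ hρ).pow_const _).const_mul _).add (((hm _ (hρ.schwartzPd k)).pow_const _).const_mul _)
  rw [lintegral_indicator hSm, lintegral_finsetSum _ fun k _ => hmk k]
  have hk : ∀ k ∈ Finset.univ, ∫⁻ x in Metric.closedBall (0 : R3) (2 * R),
      (ENNReal.ofReal (c / R) * ‖schwartzConv h (mollifier n) x‖ₑ ^ 2 +
          ENNReal.ofReal (c * R) * ‖schwartzConv h (schwartzPd k (mollifier n)) x‖ₑ ^ 2) ≤
      ENNReal.ofReal (2 * c) * C * ENNReal.ofReal R ^ (2 * σ - 1) * (N : ℝ≥0∞) ^ 2 := by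
    intro k _
    rw [lintegral_add_left (((hm _ hρ).pow_const _).const_mul _),
      lintegral_const_mul _ ((hm _ hρ).pow_const _),
      lintegral_const_mul _ ((hm _ (hρ.schwartzPd k)).pow_const _)]
    have p1 : ENNReal.ofReal (c / R) * ENNReal.ofReal R ^ (2 * σ) =
        ENNReal.ofReal c * ENNReal.ofReal R ^ (2 * σ - 1) := by
      rw [div_eq_mul_inv, ENNReal.ofReal_mul hc.le, ENNReal.ofReal_inv_of_pos hR,
        ← ENNReal.rpow_neg_one, mul_assoc, ← ENNReal.rpow_add _ _ hR0 ENNReal.ofReal_ne_top]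
      congr 2; ring
    have p2 : ENNReal.ofReal (c * R) * ENNReal.ofReal R ^ (2 * σ - 2) =
        ENNReal.ofReal c * ENNReal.ofReal R ^ (2 * σ - 1) := by
      rw [ENNReal.ofReal_mul hc.le, mul_assoc]
      have hadd := ENNReal.rpow_add 1 (2 * σ - 2) hR0 ENNReal.ofReal_ne_top
      rw [ENNReal.rpow_one] at hadd
      rw [← hadd]
      congr 2; ring
    calc _ ≤ ENNReal.ofReal (c / R) * (C * ENNReal.ofReal R ^ (2 * σ) * (N : ℝ≥0∞) ^ 2) +
          ENNReal.ofReal (c * R) * (C * ENNReal.ofReal R ^ (2 * σ - 2) * (N : ℝ≥0∞) ^ 2) := by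
          gcongr
          exact h2 k
      _ = ENNReal.ofReal (c / R) * ENNReal.ofReal R ^ (2 * σ) * (C * (N : ℝ≥0∞) ^ 2) +
          ENNReal.ofReal (c * R) * ENNReal.ofReal R ^ (2 * σ - 2) * (C * (N : ℝ≥0∞) ^ 2) := by ring
      _ = _ := by
          rw [p1, p2, ENNReal.ofReal_mul (by norm_num), ENNReal.ofReal_ofNat]
          ring
  refine (Finset.sum_le_sum hk).trans (le_of_eq ?_)
  rw [Finset.sum_const, Finset.card_univ, Fintype.card_fin, nsmul_eq_mul,
    show 6 * c = 3 * (2 * c) by ring, ENNReal.ofReal_mul (by norm_num : (0 : ℝ) ≤ 3),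
    ENNReal.ofReal_ofNat]
  push_cast
  ring

/-- The properties of a solution on a compact time interval that enter the Morawetz inequality. -/
structure IsWeakNLS (p : ℝ) (N : ℝ≥0) (a b : ℝ) (u : ℝ → R3 → ℂ) : Prop where
  le : a ≤ b
  meas : AEStronglyMeasurable (Function.uncurry u) ((volume.restrict (Set.Icc a b)).prod volume)
  memLp : MemLp (Function.uncurry fun s x => nlsNonlinearity p (u s x)) 2
    ((volume.restrict (Set.Icc a b)).prod volume)
  bound : ∀ᵐ s ∂volume.restrict (Set.Icc a b), SobolevBound (criticalRegularity p) N (u s)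
  bound_left : SobolevBound (criticalRegularity p) N (u a)
  bound_right : SobolevBound (criticalRegularity p) N (u b)
  weak : ∀ (φ : 𝓢(R3, ℂ)), ∀ t ∈ Set.Icc a b,
      IntervalIntegrable (fun τ => (∫ x, u τ x * schwartzGenerator φ x) -
        Complex.I * ∫ x, nlsNonlinearity p (u τ x) * φ x) volume a t ∧
      ∫ x, u t x * φ x = (∫ x, u a x * φ x) +
        ∫ τ in a..t, ((∫ x, u τ x * schwartzGenerator φ x) -
          Complex.I * ∫ x, nlsNonlinearity p (u τ x) * φ x)

theorem one_lt_criticalRegularity {p : ℝ} (hp : 4 < p) : 1 < criticalRegularity p := by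
  have : 2 / p < 1 / 2 := by rw [div_lt_div_iff₀ (by linarith) (by norm_num)]; linarith
  rw [criticalRegularity]; linarith

theorem criticalRegularity_lt {p : ℝ} (hp : 4 < p) : criticalRegularity p < 3 / 2 := by
  have : 0 < 2 / p := by positivity
  rw [criticalRegularity]; linarith

theorem sobolev_exponent_criticalRegularity {p : ℝ} (hp : 4 < p) :
    6 / (3 - 2 * criticalRegularity p) = 3 * p / 2 := by
  rw [criticalRegularity]; field_simp; norm_num

theorem exists_lintegral_rpow_le_of_sobolevBound {p : ℝ} (hp : 4 < p) :
    ∃ C : ℝ≥0, ∀ (f : R3 → ℂ) (N : ℝ≥0), SobolevBound (criticalRegularity p) N f →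
      ∫⁻ x, ‖f x‖ₑ ^ (3 * p / 2) ≤ C * (N : ℝ≥0∞) ^ (3 * p / 2) := by
  obtain ⟨C, hC⟩ := exists_mollified_sobolev (one_lt_criticalRegularity hp)
    (criticalRegularity_lt hp)
  rw [sobolev_exponent_criticalRegularity hp] at hC
  exact ⟨C, fun f N hf => lintegral_rpow_le_of_mollified hf.locallyIntegrable
    fun n => (hC f N hf n).1⟩

theorem IsMorawetzMultiplier.exists_bound_vdiv {c R δ : ℝ} {X : Fin 3 → R3 → ℝ}
    (h : IsMorawetzMultiplier c R δ X) : ∃ D, ∀ x, |vdiv X x| ≤ D := by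
  have hc : Continuous (vdiv X) := by
    unfold vdiv
    exact continuous_finsetSum _ fun k _ =>
      (contDiff_pd (n := 0) (contDiff_infty.1 (h.contDiff k) 1) k).continuous
  have h2 : ∀ x, 2 * R < ‖x‖ → vdiv X x = 0 := by
    intro x hx
    simp [vdiv, pd_eq_zero_of_far (fun x hx => h.eq_zero _ x (le_of_lt hx)) _ x hx]
  obtain ⟨D, hD⟩ := (isCompact_closedBall (0 : R3) (2 * R)).exists_bound_of_continuousOn
    hc.continuousOn
  refine ⟨max D 0, fun x => ?_⟩
  by_cases hx : 2 * R < ‖x‖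
  · rw [h2 x hx]; simp
  · exact (hD x (by simpa using hx)).trans (le_max_left _ _)

theorem IsWeakNLS.lintegral_rpow_lt_top {p : ℝ} (hp : 4 < p) {N : ℝ≥0} {a b : ℝ} {u : ℝ → R3 → ℂ}
    (h : IsWeakNLS p N a b u) :
    ∫⁻ s in Set.Icc a b, ∫⁻ x, ‖u s x‖ₑ ^ (2 * (p + 1)) < ∞ := by
  have hF2 := (memLp_two_iff_lintegral h.memLp.1).1 h.memLp
  rw [lintegral_prod _ (h.memLp.1.enorm.pow_const 2)] at hF2
  simpa only [Function.uncurry, enorm_nlsNonlinearity_sq (by linarith : 0 ≤ p)] using hF2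

theorem IsWeakNLS.aemeasurable_lintegral_rpow {p : ℝ} {N : ℝ≥0} {a b : ℝ} {u : ℝ → R3 → ℂ}
    (h : IsWeakNLS p N a b u) :
    AEMeasurable (fun s => ∫⁻ x, ‖u s x‖ₑ ^ (2 * (p + 1))) (volume.restrict (Set.Icc a b)) :=
  (h.meas.enorm.pow_const (2 * (p + 1))).lintegral_prod_right'

theorem IsWeakNLS.ae_lintegral_rpow_lt_top {p : ℝ} (hp : 4 < p) {N : ℝ≥0} {a b : ℝ}
    {u : ℝ → R3 → ℂ} (h : IsWeakNLS p N a b u) :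
    ∀ᵐ s ∂volume.restrict (Set.Icc a b), ∫⁻ x, ‖u s x‖ₑ ^ (2 * (p + 1)) < ∞ :=
  ae_lt_top' h.aemeasurable_lintegral_rpow (h.lintegral_rpow_lt_top hp).ne

theorem IsWeakNLS.aemeasurable_nlsCommutator {p : ℝ} (hp : 4 < p) {N : ℝ≥0} {a b : ℝ}
    {u : ℝ → R3 → ℂ} (h : IsWeakNLS p N a b u) (n : ℕ) :
    AEMeasurable (fun s => ∫⁻ x, ‖nlsCommutator p (u s) n x‖ₑ ^ 2)
      (volume.restrict (Set.Icc a b)) := by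
  have h1 := aestronglyMeasurable_schwartzConv h.memLp.1 (mollifier n)
  have h2 := (continuous_nlsNonlinearity (by linarith : 0 ≤ p)).comp_aestronglyMeasurable
    (aestronglyMeasurable_schwartzConv h.meas (mollifier n))
  exact ((h1.sub h2).enorm.pow_const 2).lintegral_prod_right'

theorem IsWeakNLS.tendsto_lintegral_nlsCommutator {p : ℝ} (hp : 4 < p) {N : ℝ≥0} {a b : ℝ}
    {u : ℝ → R3 → ℂ} (h : IsWeakNLS p N a b u) :
    Tendsto (fun n => ∫⁻ s in Set.Icc a b, ∫⁻ x, ‖nlsCommutator p (u s) n x‖ₑ ^ 2) atTop (𝓝 0) := by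
  have hp0 : 0 ≤ p := by linarith
  have := tendsto_lintegral_of_dominated_convergence' (μ := volume.restrict (Set.Icc a b))
    (F := fun n s => ∫⁻ x, ‖nlsCommutator p (u s) n x‖ₑ ^ 2) (f := fun _ => 0)
    (fun s => 4 * ∫⁻ x, ‖u s x‖ₑ ^ (2 * (p + 1))) (fun n => h.aemeasurable_nlsCommutator hp n)
    (fun n => h.bound.mono fun s hs => lintegral_nlsCommutator_le hp0 hs.locallyIntegrable n)
    (by
      rw [lintegral_const_mul' _ _ (by simp)]
      exact (ENNReal.mul_lt_top (by simp) (h.lintegral_rpow_lt_top hp)).ne)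
    (by
      filter_upwards [h.bound, h.ae_lintegral_rpow_lt_top hp] with s h1 h2
      exact _root_.tendsto_lintegral_nlsCommutator hp0 h1.locallyIntegrable h2)
  simpa using this

theorem exists_mollified_morawetz {p : ℝ} (hp : 4 < p) :
    ∃ A : ℝ≥0, ∀ R δ : ℝ, 0 < R → 0 < δ → ∃ K : ℝ≥0, ∀ (u : ℝ → R3 → ℂ) (N : ℝ≥0) (a b : ℝ) (n : ℕ),
      IsWeakNLS p N a b u → b - a ≤ R ^ 2 →
      ∫⁻ s in Set.Icc a b, ∫⁻ x in Metric.ball 0 R,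
          ENNReal.ofReal ((‖x‖ ^ 2 + δ ^ 2) ^ (-(1 / 2) : ℝ)) *
            ‖schwartzConv (u s) (mollifier n) x‖ₑ ^ (p + 2) ≤
        A * ENNReal.ofReal R ^ (2 * criticalRegularity p - 1) *
          ((N : ℝ≥0∞) ^ 2 + (N : ℝ≥0∞) ^ (p + 2)) +
        K * ∫⁻ s in Set.Icc a b, ∫⁻ x, ‖nlsCommutator p (u s) n x‖ₑ ^ 2 := by
  have hp0 : 0 ≤ p := by linarith
  obtain ⟨c, hc, hM⟩ := exists_morawetz_multiplier
  obtain ⟨C, hC⟩ := exists_mollified_local_bounds hp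
  obtain ⟨C₀, hC₀⟩ := exists_lintegral_rpow_le_of_sobolevBound hp
  refine ⟨Real.toNNReal (23 * c) * C, fun R δ hR hδ => ?_⟩
  obtain ⟨X, hX⟩ := hM R δ hR hδ
  obtain ⟨D, hD⟩ := hX.exists_bound_vdiv
  refine ⟨Real.toNNReal (D ^ 2 * R ^ 3 / (4 * c) + 3 * c * R), fun u N a b n hu hba => ?_⟩
  set σ := criticalRegularity p with hσ
  set μ := (volume : Measure ℝ).restrict (Set.Icc a b) with hμ
  set Γ₀ : ℝ≥0∞ := ENNReal.ofReal (11 * c) * C * ENNReal.ofReal R ^ (2 * σ - 3) *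
    ((N : ℝ≥0∞) ^ 2 + (N : ℝ≥0∞) ^ (p + 2)) with hΓ₀
  have hR0 : ENNReal.ofReal R ≠ 0 := by simpa using hR
  have hΓ₀t : Γ₀ ≠ ∞ := by
    refine ENNReal.mul_ne_top (ENNReal.mul_ne_top (ENNReal.mul_ne_top ENNReal.ofReal_ne_top
      ENNReal.coe_ne_top) (ENNReal.rpow_ne_top_of_ne_zero hR0 ENNReal.ofReal_ne_top))
      (ENNReal.add_ne_top.2 ⟨by simp, ENNReal.rpow_ne_top_of_nonneg (by linarith) (by simp)⟩)
  set K := D ^ 2 * R ^ 3 / (4 * c) + 3 * c * R with hK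
  set e : ℝ → ℝ≥0∞ := fun s => ∫⁻ x, ‖nlsCommutator p (u s) n x‖ₑ ^ 2 with he
  have hem : AEMeasurable e μ := hu.aemeasurable_nlsCommutator hp n
  have heint : ∫⁻ s, e s ∂μ ≠ ∞ := by
    have h1 : ∫⁻ s, e s ∂μ ≤ ∫⁻ s, (4 * ∫⁻ x, ‖u s x‖ₑ ^ (2 * (p + 1))) ∂μ :=
      lintegral_mono_ae (hu.bound.mono fun s hs =>
        lintegral_nlsCommutator_le hp0 hs.locallyIntegrable n)
    rw [lintegral_const_mul' _ _ (by simp)] at h1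
    exact (h1.trans_lt (ENNReal.mul_lt_top (by simp) (hu.lintegral_rpow_lt_top hp))).ne
  have hXc : ∀ k, Integrable (X k) := fun k =>
    (hX.contDiff k).continuous.integrable_of_hasCompactSupport
      (HasCompactSupport.intro (isCompact_closedBall (0 : R3) (2 * R)) fun x hx =>
        hX.eq_zero k x (by simpa using (not_le.1 (by simpa using hx) : 2 * R < ‖x‖).le))
  obtain ⟨hβi, hβe⟩ := integral_momentumDensity_sub hu.le hu.meas hu.memLp
    (by linarith : 1 < 3 * p / 2)
    (ENNReal.mul_ne_top ENNReal.coe_ne_top (ENNReal.rpow_ne_top_of_nonneg (by linarith)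
      ENNReal.coe_ne_top) : (C₀ : ℝ≥0∞) * (N : ℝ≥0∞) ^ (3 * p / 2) ≠ ∞)
    (hu.bound.mono fun s hs => hC₀ _ _ hs) hu.weak hXc (mollifier n)
  have hΓm : AEMeasurable (fun s => Γ₀ + ENNReal.ofReal K * e s) μ := (hem.const_mul _).const_add _
  have hΓint : ∫⁻ s, (Γ₀ + ENNReal.ofReal K * e s) ∂μ =
      Γ₀ * ENNReal.ofReal (b - a) + ENNReal.ofReal K * ∫⁻ s, e s ∂μ := by
    rw [lintegral_add_left measurable_const, lintegral_const_mul' _ _ ENNReal.ofReal_ne_top,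
      lintegral_const, hμ, Measure.restrict_apply_univ, Real.volume_Icc]
  have hmain := (lintegral_le_ofReal_add hβi hΓm (by
      rw [hΓint]
      exact ENNReal.add_ne_top.2 ⟨ENNReal.mul_ne_top hΓ₀t ENNReal.ofReal_ne_top,
        ENNReal.mul_ne_top ENNReal.ofReal_ne_top heint⟩) (by
      filter_upwards [hu.bound, hu.ae_lintegral_rpow_lt_top hp] with s h1 h2
      obtain ⟨l1, l2, l3⟩ := hC (u s) N R n hR h1
      exact fixed_time_lower (by linarith) hc hR hδ hX hD h1.locallyIntegrable h2 n hΓ₀t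
        (setLIntegral_localRemainder_le (by linarith) hc hR h1.locallyIntegrable n l1 l2 l3))).1
  rw [hΓint, ← hβe] at hmain
  have hmom : ENNReal.ofReal (∫ x, (momentumDensity X (u b) (mollifier n) x -
      momentumDensity X (u a) (mollifier n) x)) ≤
      ENNReal.ofReal (12 * c) * C * ENNReal.ofReal R ^ (2 * σ - 1) * (N : ℝ≥0∞) ^ 2 := by
    obtain ⟨l1, l2, -⟩ := hC (u a) N R n hR hu.bound_left
    obtain ⟨r1, r2, -⟩ := hC (u b) N R n hR hu.bound_right
    have hl := hX.lintegral_momentumDensity_le hc hR hu.bound_left.locallyIntegrable n l1 l2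
    have hr := hX.lintegral_momentumDensity_le hc hR hu.bound_right.locallyIntegrable n r1 r2
    have hmm : Measurable fun x => ‖momentumDensity X (u b) (mollifier n) x‖ₑ := by
      have hcc : ∀ ψ : 𝓢(R3, ℂ), HasCompactSupport ψ → Continuous (schwartzConv (u b) ψ) :=
        fun ψ hψ => (contDiff_schwartzConv hu.bound_right.locallyIntegrable hψ (n := 0)).continuous
      have hρ := hasCompactSupport_mollifier n
      have : Continuous (momentumDensity X (u b) (mollifier n)) := by
        unfold momentumDensity
        refine continuous_finsetSum _ fun k _ => ?_
        have h1 := hcc _ hρ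
        have h2 := hcc _ (hρ.schwartzPd k)
        have h3 := (hX.contDiff k).continuous
        fun_prop
      exact this.enorm.measurable
    calc _ ≤ ‖∫ x, (momentumDensity X (u b) (mollifier n) x -
          momentumDensity X (u a) (mollifier n) x)‖ₑ := by
          rw [Real.enorm_eq_ofReal_abs]
          exact ENNReal.ofReal_le_ofReal (le_abs_self _)
      _ ≤ ∫⁻ x, ‖momentumDensity X (u b) (mollifier n) x -
          momentumDensity X (u a) (mollifier n) x‖ₑ := enorm_integral_le_lintegral_enorm _
      _ ≤ ∫⁻ x, (‖momentumDensity X (u b) (mollifier n) x‖ₑ +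
          ‖momentumDensity X (u a) (mollifier n) x‖ₑ) := lintegral_mono fun x => enorm_sub_le
      _ = (∫⁻ x, ‖momentumDensity X (u b) (mollifier n) x‖ₑ) +
          ∫⁻ x, ‖momentumDensity X (u a) (mollifier n) x‖ₑ := lintegral_add_left hmm _
      _ ≤ _ := add_le_add hr hl
      _ = _ := by
        rw [show 12 * c = 2 * (6 * c) by ring, ENNReal.ofReal_mul (by norm_num : (0 : ℝ) ≤ 2),
          ENNReal.ofReal_ofNat]
        ring
  have hΓT : Γ₀ * ENNReal.ofReal (b - a) ≤ ENNReal.ofReal (11 * c) * C *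
      ENNReal.ofReal R ^ (2 * σ - 1) * ((N : ℝ≥0∞) ^ 2 + (N : ℝ≥0∞) ^ (p + 2)) := by
    calc _ ≤ Γ₀ * ENNReal.ofReal (R ^ 2) := by gcongr
      _ = ENNReal.ofReal (11 * c) * C * (ENNReal.ofReal R ^ (2 * σ - 3) *
          ENNReal.ofReal R ^ (2 : ℝ)) * ((N : ℝ≥0∞) ^ 2 + (N : ℝ≥0∞) ^ (p + 2)) := by
          rw [ENNReal.ofReal_pow hR.le, ENNReal.rpow_two, hΓ₀]; ring
      _ = _ := by
          rw [← ENNReal.rpow_add _ _ hR0 ENNReal.ofReal_ne_top]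
          congr 3; ring
  calc _ ≤ _ := hmain
    _ ≤ ENNReal.ofReal (∫ x, (momentumDensity X (u b) (mollifier n) x -
          momentumDensity X (u a) (mollifier n) x)) +
        (Γ₀ * ENNReal.ofReal (b - a) + ENNReal.ofReal K * ∫⁻ s, e s ∂μ) :=
      ENNReal.ofReal_add_le.trans (by gcongr; exact ENNReal.ofReal_toReal_le)
    _ ≤ ENNReal.ofReal (12 * c) * C * ENNReal.ofReal R ^ (2 * σ - 1) *
          ((N : ℝ≥0∞) ^ 2 + (N : ℝ≥0∞) ^ (p + 2)) +
        (ENNReal.ofReal (11 * c) * C * ENNReal.ofReal R ^ (2 * σ - 1) *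
          ((N : ℝ≥0∞) ^ 2 + (N : ℝ≥0∞) ^ (p + 2)) + ENNReal.ofReal K * ∫⁻ s, e s ∂μ) := by
        gcongr
        exact hmom.trans (by gcongr; exact le_self_add)
    _ = _ := by
        have h23 : ((Real.toNNReal (23 * c) * C : ℝ≥0) : ℝ≥0∞) =
            ENNReal.ofReal (12 * c) * C + ENNReal.ofReal (11 * c) * C := by
          rw [← add_mul, ← ENNReal.ofReal_add (by positivity) (by positivity),
            show 12 * c + 11 * c = 23 * c by ring, ENNReal.coe_mul]
          rfl
        rw [h23, show ((Real.toNNReal K : ℝ≥0) : ℝ≥0∞) = ENNReal.ofReal K from rfl]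
        ring

/-! ### Removal of the regularisation -/

theorem lintegral_lintegral_le_of_tendsto {μ : Measure ℝ} [SFinite μ] {ν : Measure R3} [SFinite ν]
    {f : ℕ → ℝ → R3 → ℝ≥0∞} {g : ℝ → R3 → ℝ≥0∞} {B : ℕ → ℝ≥0∞} {L : ℝ≥0∞}
    (hf : ∀ n, AEMeasurable (fun z : ℝ × R3 => f n z.1 z.2) (μ.prod ν))
    (hg : ∀ᵐ s ∂μ, ∀ᵐ x ∂ν, Tendsto (fun n => f n s x) atTop (𝓝 (g s x)))
    (hB : ∀ n, ∫⁻ s, ∫⁻ x, f n s x ∂ν ∂μ ≤ B n) (hL : Tendsto B atTop (𝓝 L)) :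
    ∫⁻ s, ∫⁻ x, g s x ∂ν ∂μ ≤ L := by
  have hslice : ∀ᵐ s ∂μ, ∀ n, AEMeasurable (f n s) ν :=
    ae_all_iff.2 fun n => (hf n).aestronglyMeasurable.prodMk_left.mono fun s hs => hs.aemeasurable
  calc ∫⁻ s, ∫⁻ x, g s x ∂ν ∂μ ≤ ∫⁻ s, liminf (fun n => ∫⁻ x, f n s x ∂ν) atTop ∂μ := by
        apply lintegral_mono_ae
        filter_upwards [hg, hslice] with s h1 h2
        calc ∫⁻ x, g s x ∂ν = ∫⁻ x, liminf (fun n => f n s x) atTop ∂ν :=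
              lintegral_congr_ae (h1.mono fun x hx => hx.liminf_eq.symm)
          _ ≤ _ := lintegral_liminf_le' h2
    _ ≤ liminf (fun n => ∫⁻ s, ∫⁻ x, f n s x ∂ν ∂μ) atTop :=
        lintegral_liminf_le' fun n => (hf n).lintegral_prod_right'
    _ ≤ liminf B atTop := liminf_le_liminf (Eventually.of_forall hB)
    _ = L := hL.liminf_eq

theorem tendsto_ofReal_regularised_inv {x : R3} (hx : x ≠ 0) :
    Tendsto (fun m : ℕ => ENNReal.ofReal
      ((‖x‖ ^ 2 + (1 / ((m : ℝ) + 1)) ^ 2) ^ (-(1 / 2) : ℝ))) atTop (𝓝 (‖x‖ₑ⁻¹)) := by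
  have hx0 : 0 < ‖x‖ := norm_pos_iff.2 hx
  have h1 : Tendsto (fun m : ℕ => ‖x‖ ^ 2 + (1 / ((m : ℝ) + 1)) ^ 2) atTop (𝓝 (‖x‖ ^ 2)) := by
    have := (tendsto_one_div_add_atTop_nhds_zero_nat (𝕜 := ℝ)).pow 2
    simpa using this.const_add (‖x‖ ^ 2)
  have h2 := h1.rpow_const (p := (-(1 / 2) : ℝ)) (Or.inl (by positivity))
  have e : (‖x‖ ^ 2) ^ (-(1 / 2) : ℝ) = ‖x‖⁻¹ := by
    rw [← Real.rpow_natCast, ← Real.rpow_mul hx0.le]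
    norm_num
    rw [Real.rpow_neg_one]
  rw [e] at h2
  have h3 := ENNReal.tendsto_ofReal h2
  rwa [ENNReal.ofReal_inv_of_pos hx0, ofReal_norm] at h3

theorem exists_morawetz_of_isWeakNLS {p : ℝ} (hp : 4 < p) :
    ∃ A : ℝ≥0, ∀ (R : ℝ) (u : ℝ → R3 → ℂ) (N : ℝ≥0) (a b : ℝ), 0 < R →
      IsWeakNLS p N a b u → b - a ≤ R ^ 2 →
      ∫⁻ s in Set.Icc a b, ∫⁻ x in Metric.ball 0 R, ‖u s x‖ₑ ^ (p + 2) / ‖x‖ₑ ≤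
        A * ENNReal.ofReal R ^ (2 * criticalRegularity p - 1) *
          ((N : ℝ≥0∞) ^ 2 + (N : ℝ≥0∞) ^ (p + 2)) := by
  obtain ⟨A, hA⟩ := exists_mollified_morawetz hp
  refine ⟨A, fun R u N a b hR hu hba => ?_⟩
  set L : ℝ≥0∞ := A * ENNReal.ofReal R ^ (2 * criticalRegularity p - 1) *
    ((N : ℝ≥0∞) ^ 2 + (N : ℝ≥0∞) ^ (p + 2)) with hL
  have hac : (volume.restrict (Set.Icc a b)).prod ((volume : Measure R3).restrict (Metric.ball 0 R)) ≪
      (volume.restrict (Set.Icc a b)).prod volume :=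
    Measure.AbsolutelyContinuous.rfl.prod Measure.absolutelyContinuous_restrict
  have hWm : ∀ δ : ℝ, Measurable fun z : ℝ × R3 =>
      ENNReal.ofReal ((‖z.2‖ ^ 2 + δ ^ 2) ^ (-(1 / 2) : ℝ)) := fun δ =>
    (Measurable.pow_const (by fun_prop) _).ennreal_ofReal
  have hδ : ∀ δ : ℝ, 0 < δ → ∫⁻ s in Set.Icc a b, ∫⁻ x in Metric.ball 0 R,
      ENNReal.ofReal ((‖x‖ ^ 2 + δ ^ 2) ^ (-(1 / 2) : ℝ)) * ‖u s x‖ₑ ^ (p + 2) ≤ L := by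
    intro δ hδ
    obtain ⟨K, hK⟩ := hA R δ hR hδ
    refine lintegral_lintegral_le_of_tendsto (f := fun n s x =>
      ENNReal.ofReal ((‖x‖ ^ 2 + δ ^ 2) ^ (-(1 / 2) : ℝ)) *
        ‖schwartzConv (u s) (mollifier n) x‖ₑ ^ (p + 2)) (fun n => ?_) ?_
      (fun n => hK u N a b n hu hba) ?_
    · exact ((hWm δ).aemeasurable.mul ((aestronglyMeasurable_schwartzConv hu.meas
        (mollifier n)).enorm.pow_const (p + 2))).mono_ac hac
    · filter_upwards [hu.bound] with s hs
      filter_upwards [ae_restrict_of_ae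
        (ae_tendsto_schwartzConv_mollifier hs.locallyIntegrable)] with x hx
      exact ENNReal.Tendsto.const_mul
        ((ENNReal.continuous_rpow_const.tendsto _).comp hx.enorm) (Or.inr ENNReal.ofReal_ne_top)
    · have := ENNReal.Tendsto.const_mul (hu.tendsto_lintegral_nlsCommutator hp)
        (Or.inr (ENNReal.coe_ne_top (r := K)))
      simpa using this.const_add L
  refine lintegral_lintegral_le_of_tendsto (f := fun m s x =>
      ENNReal.ofReal ((‖x‖ ^ 2 + (1 / ((m : ℝ) + 1)) ^ 2) ^ (-(1 / 2) : ℝ)) * ‖u s x‖ₑ ^ (p + 2))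
      (fun m => ?_) ?_ (fun m => hδ _ (by positivity)) tendsto_const_nhds
  · exact ((hWm _).aemeasurable.mul (hu.meas.enorm.pow_const (p + 2))).mono_ac hac
  · refine ae_of_all _ fun s => ?_
    have h0 : ∀ᵐ x ∂(volume : Measure R3).restrict (Metric.ball 0 R), x ≠ 0 :=
      compl_mem_ae_iff.2 (measure_singleton 0)
    filter_upwards [h0] with x hx
    rw [ENNReal.div_eq_inv_mul]
    exact ENNReal.Tendsto.mul_const (tendsto_ofReal_regularised_inv hx)
      (Or.inr (ENNReal.rpow_ne_top_of_nonneg (by linarith) enorm_ne_top))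

/-! ### Solutions are weak solutions -/

theorem enorm_rpow_le_add {r₁ r r₂ : ℝ} (h₁ : r₁ ≤ r) (h₂ : r ≤ r₂) (y : ℝ≥0∞) :
    y ^ r ≤ y ^ r₁ + y ^ r₂ := by
  rcases le_total y 1 with hy | hy
  · exact (ENNReal.rpow_le_rpow_of_exponent_ge hy h₁).trans le_self_add
  · exact (ENNReal.rpow_le_rpow_of_exponent_le hy h₂).trans le_add_self

theorem IsNLSSolution.isWeakNLS {p : ℝ} (hp : 4 < p) {I : Set ℝ} {u : ℝ → R3 → ℂ}
    (hI : I.OrdConnected) (hu : IsNLSSolution p I u) {N : ℝ≥0}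
    (hN : ∀ᵐ s ∂volume.restrict I, SobolevBound (criticalRegularity p) N (u s)) {a b : ℝ}
    (ha : a ∈ I) (hb : b ∈ I) (hab : a ≤ b) (hNa : SobolevBound (criticalRegularity p) N (u a))
    (hNb : SobolevBound (criticalRegularity p) N (u b)) : IsWeakNLS p N a b u := by
  have hp0 : 0 ≤ p := by linarith
  obtain ⟨t₀, ht₀, hD⟩ := hu.duhamel
  set J := Set.Icc (min a t₀) (max b t₀) with hJ
  have hJI : J ⊆ I := hI.out (by rcases min_choice a t₀ with h | h <;> rw [h] <;> assumption)
    (by rcases max_choice b t₀ with h | h <;> rw [h] <;> assumption)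
  have haJ : a ∈ J := ⟨min_le_left _ _, hab.trans (le_max_left _ _)⟩
  have hbJ : b ∈ J := ⟨(min_le_left _ _).trans hab, le_max_left _ _⟩
  have htJ : t₀ ∈ J := ⟨min_le_right _ _, le_max_right _ _⟩
  have hsub : Set.Icc a b ⊆ J := Set.Icc_subset_Icc haJ.1 hbJ.2
  have hle : (volume.restrict (Set.Icc a b)).prod (volume : Measure R3) ≤
      (volume.restrict J).prod volume := by
    rw [← Measure.restrict_univ (μ := (volume : Measure R3)), Measure.prod_restrict,
      Measure.prod_restrict]
    exact Measure.restrict_mono (Set.prod_mono hsub le_rfl) le_rfl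
  have hmem := hu.memLp J isCompact_Icc hJI
  obtain ⟨C, hC⟩ := exists_lintegral_rpow_le_of_sobolevBound hp
  have hFm : AEStronglyMeasurable (Function.uncurry fun s x => nlsNonlinearity p (u s x))
      ((volume.restrict J).prod volume) :=
    (continuous_nlsNonlinearity hp0).comp_aestronglyMeasurable hmem.1
  have hF : MemLp (Function.uncurry fun s x => nlsNonlinearity p (u s x)) 2
      ((volume.restrict J).prod volume) := by
    rw [memLp_two_iff_lintegral hFm]
    have h5 := lintegral_rpow_enorm_lt_top_of_eLpNorm_lt_top (by simp; linarith)
      ENNReal.ofReal_ne_top hmem.2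
    rw [ENNReal.toReal_ofReal (by linarith)] at h5
    have h3 : ∫⁻ z, ‖Function.uncurry u z‖ₑ ^ (3 * p / 2)
        ∂((volume.restrict J).prod (volume : Measure R3)) < ∞ := by
      rw [lintegral_prod _ (hmem.1.enorm.pow_const _)]
      calc _ ≤ ∫⁻ _ in J, C * (N : ℝ≥0∞) ^ (3 * p / 2) :=
            lintegral_mono_ae ((ae_restrict_of_ae_restrict_of_subset hJI hN).mono
              fun s hs => hC _ _ hs)
        _ < ∞ := by
            rw [lintegral_const, Measure.restrict_apply_univ]
            exact ENNReal.mul_lt_top (ENNReal.mul_lt_top ENNReal.coe_lt_top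
              (ENNReal.rpow_lt_top_of_nonneg (by linarith) ENNReal.coe_ne_top))
              isCompact_Icc.measure_lt_top
    calc ∫⁻ z, ‖(Function.uncurry fun s x => nlsNonlinearity p (u s x)) z‖ₑ ^ 2
          ∂((volume.restrict J).prod volume) ≤
        ∫⁻ z, (‖Function.uncurry u z‖ₑ ^ (3 * p / 2) + ‖Function.uncurry u z‖ₑ ^ (5 * p / 2))
          ∂((volume.restrict J).prod volume) := by
          refine lintegral_mono fun z => ?_
          simp only [Function.uncurry]
          rw [enorm_nlsNonlinearity_sq hp0]
          exact enorm_rpow_le_add (by linarith) (by linarith) _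
      _ = _ := lintegral_add_left' (hmem.1.enorm.pow_const _) _
      _ < ∞ := ENNReal.add_lt_top.2 ⟨h3, h5⟩
  obtain ⟨M, hM⟩ := ENNReal.lt_iff_exists_nnreal_btwn.1 (hu.mem_sobolev t₀ ht₀)
  obtain ⟨g, hg, -⟩ := SobolevBound.of_homSobolevNorm_lt hM.1
  exact ⟨hab, hmem.1.mono_measure hle, hF.mono_measure hle,
    ae_restrict_of_ae_restrict_of_subset (hsub.trans hJI) hN, hNa, hNb, fun φ t ht =>
    weak_formulation_of_subset htJ hF hg (fun t ht φ => hD t (hJI ht) φ) φ haJ (hsub ht)⟩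

theorem setLIntegral_le_of_forall_Icc {I : Set ℝ} (hI : I.OrdConnected) {G : ℝ → Prop}
    (hG : ∀ᵐ t ∂volume.restrict I, G t) {f : ℝ → ℝ≥0∞} {B : ℝ≥0∞}
    (h : ∀ a ∈ I, ∀ b ∈ I, a ≤ b → G a → G b → ∫⁻ t in Set.Icc a b, f t ≤ B) :
    ∫⁻ t in I, f t ≤ B := by
  have hd : Dense {t | t ∈ I → G t} :=
    Measure.dense_of_ae (μ := volume) ((ae_restrict_iff' hI.measurableSet).1 hG)
  obtain ⟨T, hTG, hTc, hTd⟩ := hd.exists_countable_dense_subset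
  let ι := {z : ℝ × ℝ // z ∈ (T ∩ I) ×ˢ (T ∩ I)}
  have hcount : Countable ι :=
    ((hTc.mono Set.inter_subset_left).prod (hTc.mono Set.inter_subset_left)).to_subtype
  have hdir : Directed (· ⊆ ·) fun z : ι => Set.Icc z.1.1 z.1.2 := by
    intro z w
    refine ⟨⟨(min z.1.1 w.1.1, max z.1.2 w.1.2), ?_, ?_⟩, ?_, ?_⟩
    · rcases min_choice z.1.1 w.1.1 with h | h <;> simp only [h]
      exacts [z.2.1, w.2.1]
    · rcases max_choice z.1.2 w.1.2 with h | h <;> simp only [h]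
      exacts [z.2.2, w.2.2]
    · exact Set.Icc_subset_Icc (min_le_left _ _) (le_max_left _ _)
    · exact Set.Icc_subset_Icc (min_le_right _ _) (le_max_right _ _)
  have hfr : volume (frontier I) = 0 := hI.convex.addHaar_frontier volume
  have hsub : interior I ⊆ ⋃ z : ι, Set.Icc z.1.1 z.1.2 := by
    intro t ht
    obtain ⟨ε, hε, hball⟩ := Metric.isOpen_iff.1 isOpen_interior t ht
    rw [Real.ball_eq_Ioo] at hball
    obtain ⟨a, haT, ha⟩ := hTd.exists_between (by linarith : t - ε < t)
    obtain ⟨b, hbT, hb⟩ := hTd.exists_between (by linarith : t < t + ε)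
    have haI : a ∈ I := interior_subset (hball ⟨ha.1, by linarith [ha.2]⟩)
    have hbI : b ∈ I := interior_subset (hball ⟨by linarith [hb.1], hb.2⟩)
    exact Set.mem_iUnion.2 ⟨⟨(a, b), ⟨haT, haI⟩, ⟨hbT, hbI⟩⟩, ha.2.le, hb.1.le⟩
  rw [← setLIntegral_congr (interior_ae_eq_of_null_frontier hfr)]
  refine (lintegral_mono_set hsub).trans ?_
  rw [setLIntegral_iUnion_of_directed _ hdir]
  refine iSup_le fun z => ?_
  rcases le_total z.1.1 z.1.2 with hz | hz
  · exact h _ z.2.1.2 _ z.2.2.2 hz (hTG z.2.1.1 z.2.1.2) (hTG z.2.2.1 z.2.2.2)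
  · rcases hz.eq_or_lt with hz | hz
    · rw [hz]; simp
    · rw [Set.Icc_eq_empty (not_le.2 hz)]; simp

theorem mainTheorem2 (p : ℝ) (hs₁ : 1 < criticalRegularity p) (hs₂ : criticalRegularity p < 3 / 2) :
    ∃ A : ℝ≥0, ∀ (I : Set ℝ) (u : ℝ → R3 → ℂ) (C : ℝ),
      I.OrdConnected → IsNLSSolution p I u → 1 ≤ C →
      ∫⁻ t in I, ∫⁻ x in {x : R3 | ‖x‖ₑ ≤ ENNReal.ofReal C * volume I ^ (1 / 2 : ℝ)},
          ‖u t x‖ₑ ^ (p + 2) / ‖x‖ₑ ≤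
        A * (ENNReal.ofReal C * volume I ^ (1 / 2 : ℝ)) ^ (2 * criticalRegularity p - 1) *
          (supSobolevNorm (criticalRegularity p) I u ^ 2 +
            supSobolevNorm (criticalRegularity p) I u ^ (p + 2)) := by
  have hp : 4 < p := by
    have h1 : 2 / p < 1 / 2 := by rw [criticalRegularity] at hs₁; linarith
    have h2 : 0 < 2 / p := by rw [criticalRegularity] at hs₂; linarith
    have h3 : 0 < p := by
      by_contra hcon
      exact absurd h2 (not_lt.2 (div_nonpos_of_nonneg_of_nonpos (by norm_num) (not_lt.1 hcon)))
    rw [div_lt_div_iff₀ h3 (by norm_num)] at h1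
    linarith
  obtain ⟨A, hA⟩ := exists_morawetz_of_isWeakNLS hp
  obtain ⟨C₀, hC₀⟩ := exists_lintegral_rpow_le_of_sobolevBound hp
  refine ⟨A + 1, fun I u C hI hu hC => ?_⟩
  set σ := criticalRegularity p with hσ
  set M := supSobolevNorm σ I u with hM
  have hC0 : ENNReal.ofReal C ≠ 0 := by simp; linarith
  have hσ1 : 0 < 2 * σ - 1 := by linarith
  have hA0 : ((A + 1 : ℝ≥0) : ℝ≥0∞) ≠ 0 := by simp
  rcases eq_or_ne (volume I) 0 with hI0 | hI0
  · rw [Measure.restrict_eq_zero.2 hI0]; simp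
  have hr0 : ENNReal.ofReal C * volume I ^ (1 / 2 : ℝ) ≠ 0 :=
    mul_ne_zero hC0 (by simp [hI0])
  have hr1 : (ENNReal.ofReal C * volume I ^ (1 / 2 : ℝ)) ^ (2 * σ - 1) ≠ 0 := by
    rwa [Ne, ENNReal.rpow_eq_zero_iff_of_pos hσ1]
  rcases eq_or_ne M ∞ with hMt | hMt
  · rw [hMt, ENNReal.top_pow (by norm_num), top_add, ENNReal.mul_top (mul_ne_zero hA0 hr1)]
    exact le_top
  have hlt : ∀ N : ℝ≥0, M < N → ∀ᵐ t ∂volume.restrict I, SobolevBound σ N (u t) := fun N hN =>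
    (ae_lt_of_essSup_lt hN).mono fun t ht => SobolevBound.of_homSobolevNorm_lt ht
  rcases eq_or_ne (volume I) ∞ with hIt | hIt
  · rcases eq_or_ne M 0 with hM0 | hM0
    · have hzero : ∀ᵐ t ∂volume.restrict I, ∀ᵐ x, u t x = 0 := by
        have hall : ∀ᵐ t ∂volume.restrict I, ∀ n : ℕ,
            SobolevBound σ (1 / ((n : ℝ≥0) + 1)) (u t) :=
          ae_all_iff.2 fun n => hlt _ (by rw [hM0]; simp)
        filter_upwards [hall] with t ht
        have hle : ∫⁻ x, ‖u t x‖ₑ ^ (3 * p / 2) ≤ 0 := by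
          have hlim : Tendsto (fun n : ℕ => (C₀ : ℝ≥0∞) *
              ((1 / ((n : ℝ≥0) + 1) : ℝ≥0) : ℝ≥0∞) ^ (3 * p / 2)) atTop (𝓝 0) := by
            have h1 : Tendsto (fun n : ℕ => ((1 / ((n : ℝ≥0) + 1) : ℝ≥0) : ℝ≥0∞)) atTop
                (𝓝 ((0 : ℝ≥0) : ℝ≥0∞)) :=
              ENNReal.tendsto_coe.2 tendsto_one_div_add_atTop_nhds_zero_nat
            have h2 := ENNReal.Tendsto.const_mul
              (((ENNReal.continuous_rpow_const (y := 3 * p / 2)).tendsto _).comp h1)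
              (Or.inr (ENNReal.coe_ne_top (r := C₀)))
            simpa [Function.comp_def, ENNReal.zero_rpow_of_pos (by linarith : 0 < 3 * p / 2)]
              using h2
          exact ge_of_tendsto' hlim fun n => hC₀ _ _ (ht n)
        have hm : AEMeasurable fun x => ‖u t x‖ₑ ^ (3 * p / 2) :=
          (ht 0).locallyIntegrable.aestronglyMeasurable.enorm.pow_const _
        filter_upwards [(lintegral_eq_zero_iff' hm).1 (le_antisymm hle zero_le)] with x hx
        have := (ENNReal.rpow_eq_zero_iff_of_pos (by linarith : 0 < 3 * p / 2)).1 hx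
        simpa using this
      have hL : ∫⁻ t in I, ∫⁻ x in {x : R3 | ‖x‖ₑ ≤ ENNReal.ofReal C * volume I ^ (1 / 2 : ℝ)},
          ‖u t x‖ₑ ^ (p + 2) / ‖x‖ₑ = ∫⁻ _ in I, 0 := by
        apply lintegral_congr_ae
        filter_upwards [hzero] with t ht
        rw [← lintegral_zero]
        apply lintegral_congr_ae
        filter_upwards [ae_restrict_of_ae ht] with x hx
        rw [hx, enorm_zero, ENNReal.zero_rpow_of_pos (by linarith), ENNReal.zero_div]
      rw [hL]
      simp
    · have : (ENNReal.ofReal C * volume I ^ (1 / 2 : ℝ)) ^ (2 * σ - 1) = ∞ := by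
        rw [hIt, ENNReal.top_rpow_of_pos (by norm_num), ENNReal.mul_top hC0,
          ENNReal.top_rpow_of_pos hσ1]
      rw [this, ENNReal.mul_top hA0, ENNReal.top_mul]
      · exact le_top
      · simp [hM0]
  set T := (volume I).toReal with hT
  have hT0 : 0 < T := ENNReal.toReal_pos hI0 hIt
  have hIT : volume I = ENNReal.ofReal T := (ENNReal.ofReal_toReal hIt).symm
  set R := C * T ^ (1 / 2 : ℝ) with hR
  have hR0 : 0 < R := by positivity
  have hRe : ENNReal.ofReal C * volume I ^ (1 / 2 : ℝ) = ENNReal.ofReal R := by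
    rw [hIT, ENNReal.ofReal_rpow_of_pos hT0, ← ENNReal.ofReal_mul (by linarith)]
  have hTR : T ≤ R ^ 2 := by
    have : (T ^ (1 / 2 : ℝ)) ^ 2 = T := by
      rw [← Real.rpow_natCast, ← Real.rpow_mul hT0.le]; norm_num
    rw [hR, mul_pow, this]
    exact le_mul_of_one_le_left hT0.le (one_le_pow₀ hC)
  have hset : {x : R3 | ‖x‖ₑ ≤ ENNReal.ofReal R} = Metric.closedBall 0 R := by
    ext x
    rw [Set.mem_ofPred_eq, mem_closedBall_zero_iff, ← ofReal_norm,
      ENNReal.ofReal_le_ofReal_iff hR0.le]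
  have hball : (Metric.closedBall (0 : R3) R : Set R3) =ᵐ[volume] Metric.ball 0 R := by
    refine (ae_eq_of_subset_of_measure_ge Metric.ball_subset_closedBall ?_
      Metric.isOpen_ball.measurableSet.nullMeasurableSet measure_closedBall_lt_top.ne).symm
    exact (Measure.addHaar_closedBall_eq_addHaar_ball volume (0 : R3) R).le
  rw [hRe, hset, Measure.restrict_congr_set hball]
  have hN : ∀ N : ℝ≥0, M < N →
      ∫⁻ t in I, ∫⁻ x in Metric.ball 0 R, ‖u t x‖ₑ ^ (p + 2) / ‖x‖ₑ ≤
        (A + 1 : ℝ≥0) * ENNReal.ofReal R ^ (2 * σ - 1) *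
          ((N : ℝ≥0∞) ^ 2 + (N : ℝ≥0∞) ^ (p + 2)) := by
    intro N hMN
    refine setLIntegral_le_of_forall_Icc hI (hlt N hMN) fun a ha b hb hab hGa hGb => ?_
    have hw := hu.isWeakNLS hp hI (hlt N hMN) ha hb hab hGa hGb
    have hba : b - a ≤ R ^ 2 := by
      have h1 : volume (Set.Icc a b) ≤ volume I := measure_mono (hI.out ha hb)
      rw [Real.volume_Icc, hIT, ENNReal.ofReal_le_ofReal_iff hT0.le] at h1
      exact h1.trans hTR
    refine (hA R u N a b hR0 hw hba).trans ?_
    gcongr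
    exact le_self_add
  lift M to ℝ≥0 using hMt with M' hM'
  have hlim : Tendsto (fun n : ℕ => ((A + 1 : ℝ≥0) : ℝ≥0∞) * ENNReal.ofReal R ^ (2 * σ - 1) *
      (((M' + 1 / ((n : ℝ≥0) + 1) : ℝ≥0) : ℝ≥0∞) ^ 2 +
        ((M' + 1 / ((n : ℝ≥0) + 1) : ℝ≥0) : ℝ≥0∞) ^ (p + 2))) atTop
      (𝓝 (((A + 1 : ℝ≥0) : ℝ≥0∞) * ENNReal.ofReal R ^ (2 * σ - 1) *
        ((M' : ℝ≥0∞) ^ 2 + (M' : ℝ≥0∞) ^ (p + 2)))) := by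
    have h1 : Tendsto (fun n : ℕ => ((M' + 1 / ((n : ℝ≥0) + 1) : ℝ≥0) : ℝ≥0∞)) atTop
        (𝓝 (M' : ℝ≥0∞)) := by
      refine ENNReal.tendsto_coe.2 ?_
      simpa using (tendsto_one_div_add_atTop_nhds_zero_nat (𝕜 := ℝ≥0)).const_add M'
    refine ENNReal.Tendsto.const_mul ?_ (Or.inr (ENNReal.mul_ne_top ENNReal.coe_ne_top
      (ENNReal.rpow_ne_top_of_nonneg hσ1.le ENNReal.ofReal_ne_top)))
    exact (((ENNReal.continuous_pow 2).tendsto _).comp h1).add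
      ((ENNReal.continuous_rpow_const.tendsto _).comp h1)
  refine ge_of_tendsto' hlim fun n => hN _ ?_
  exact_mod_cast lt_add_of_pos_right M' (by positivity)
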